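/- Let $d\ge 3$. **Models.** A model consists of a set $\mathrm B$ of bodies, subsets $\mathrm{IOb}\subseteq\mathrm{Ob}\subseteq\mathrm B$ (inertial observers, observers) and $\mathrm{Ph}\subseteq\mathrm B$ (photons), an ordered field $\mathrm Q$ of quantities, and a world-view relation $\mathrm W\subseteq\mathrm{Ob}\times\mathrm B\times\mathrm Q^d$. For $p\in\mathrm Q^d$ let $p_\tau=p_1$, $p_\sigma=(p_2,\dots,p_d)$, and let $|\cdot|$ be Euclidean length. Put $ev_m(p)=\{b\in\mathrm B:\mathrm W(m,b,p)\}$, $Cd_m=\{p: ev_m(p)\ne\emptyset\}$, $Ev_m=\{ev_m(p):p\in Cd_m\}$, $wl_m(b)=\{p: b\in ev_m(p)\}$. An event is an element of $Ev=\bigcup_{m\in\mathrm{Ob}}Ev_m$. $Crd_m(e)$ denotes the unique $p\in Cd_m$ with $ev_m(p)=e$; any formula in which $Crd_m(e)$ is written includes the claim that it exists and is unique. Put $\mathsf{time}_m(e,e')=|Crd_m(e)_\tau-Crd_m(e')_\tau|$ and $\mathsf{dist}_m(e,e')=|Crd_m(e)_\sigma-Crd_m(e')_\sigma|$; $e\sim_m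 e'$ means $Crd_m(e)_\tau=Crd_m(e')_\tau$. Observer $m$ is co-moving with $k$ at $e$, $m\succ_e k$, iff for every $\varepsilon>0$ there is $\delta>0$ such that $|p-Crd_m(ev_k(p))|\le\varepsilon|p-Crd_k(e)|$ for all $p\in Cd_k$ for which there is $q\in Cd_k$ with $ev_k(q)=e$ and $|p-q|<\delta$. A co-moving inertial observer of $k$ is an $m\in\mathrm{IOb}$ with $m\succ_e k$ for some $e\in Ev_k$ with $k\in e$. **$\mathrm{AccRel}_d$** consists of the axioms: (EOF) every positive quantity has a square root; (Self$^-$) for $m\in\mathrm{Ob}$, $p\in Cd_m$: $m\in ev_m(p)\iff p_\sigma=0$; (Ph) for $m\in\mathrm{IOb}$, $p,q\in\mathrm Q^d$: $|p_\sigma-q_\sigma|=|p_\tau-q_\tau|\iff\mathrm{Ph}\cap ev_m(p)\cap ev_m(q)\neq\emptyset$; (Ev) $Ev_m=Ev_k$ for $m,k\in\mathrm{IOb}$; (SimDist) for $m,k\in\mathrm{IOb}$ and $e_1,e_2\in Ev_m\cap Ev_k$, if $e_1\sim_m e_2$ and $e_1\sim_k e_2$ then $\mathsf{dist}_m(e_1,e_2)=\mathsf{dist}_k(e_1,e_2)$;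 (EvTr) if $m\in\mathrm{Ob}$, $e\in Ev$ and $m\in e$, then $e\in Ev_m$; (Self$^+$) for $m\in\mathrm{Ob}$ the set $\{p_\tau: m\in ev_m(p)\}$ is connected (contains all quantities between any two of its elements); (Acc) if $k\in\mathrm{Ob}$, $e\in Ev_k$ and $k\in e$, then $m\succ_e k$ for some $m\in\mathrm{IOb}$; (IND) every nonempty bounded subset of $\mathrm Q$ that is definable, with parameters, by a first-order formula in the language $\mathrm B,\mathrm{Ob},\mathrm{IOb},\mathrm{Ph},\mathrm Q,+,\cdot,\le,\mathrm W$ has a supremum. **Notions.** Observers $b,c$ are coplanar iff, for some $m\in\mathrm{IOb}$, $wl_m(b)\cup wl_m(c)$ lies in a plane parallel to the time axis. Event $e_1$ precedes $e_2$ (and $e_2$ succeeds $e_1$) according to $k$ iff $Crd_m(e_1)_\tau\le Crd_m(e_2)_\tau$ for all co-moving inertial observers $m$ of $k$. Events $e_1,e_2$ are photon simultaneous for $k$, $e_1\sim^{ph}_k e_2$, iff there are an event $e\ni k$ and photons $ph_1\in e\cap e_1$, $ph_2\in e\cap e_2$ such that $e_1$ and $e_2$ precede $e$ according to $k$. Observer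 $c$ is approaching (moving away from) $b$ as seen by $b$ by photons iff for every event $e_b\ni b$ and every event $e_c\ni c$ with $e_b\sim^{ph}_b e_c$ there is an event $e$ such that $b',c'\in e$ for all $b',c'\in\mathrm{IOb}$ with $b'\succ_{e_b}b$ and $c'\succ_{e_c}c$, and $e_b$ precedes (succeeds) $e$ according to $b$. The clock of $x$ runs slower than the clock of $y$ as seen by $k$ by photons iff $\mathsf{time}_x(e_x,\bar e_x)<\mathsf{time}_y(e_y,\bar e_y)$ for all events with $x\in e_x\cap\bar e_x$, $y\in e_y\cap\bar e_y$, $e_x\sim^{ph}_k e_y$, $\bar e_x\sim^{ph}_k\bar e_y$ and $(e_x,e_y)\neq(\bar e_x,\bar e_y)$. **Theorem.** Assume $\mathrm{AccRel}_d$, and let $b,c\in\mathrm{Ob}$ be coplanar observers that do not participate together in two distinct events. Then: (1) if $c$ is approaching $b$ as seen by $b$ by photons, then the clock of $b$ runs slower than the clock of $c$ as seen by $b$ by photons; (2) if $c$ is moving away from $b$ as seen by $b$ by photons, then the clock of $c$ runs slower than the clock of $b$ as seen by $b$ by photons. -/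

import Mathlib

namespace AccRelTheory

/-! ### Models: bodies, quantities and the world-view relation -/

/-- The relation symbols of the first-order language. The operations `+` and `·` are operations on
the quantities only, so in a one-sorted universe they are given by their graphs. -/
inductive Symb (d : ℕ) : ℕ → Type
  | body : Symb d 1
  | ob : Symb d 1
  | iob : Symb d 1
  | ph : Symb d 1
  | qty : Symb d 1
  | add : Symb d 3
  | mul : Symb d 3
  | le : Symb d 2
  | wview : Symb d (d + 2)

/-- The first-order language of the theory, in spacetime dimension `d`. -/
def lang (d : ℕ) : FirstOrder.Language.{0, 0} := ⟨fun _ => Empty, Symb d⟩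

/-- A model, with bodies `B` and quantities `Q`: the observers, the inertial observers, the photons,
and the world-view relation, where `W m b p` says that the observer `m` coordinatizes the body `b`
at the coordinate point `p`. -/
structure Model (d : ℕ) (B Q : Type*) where
  Ob : Set B
  IOb : Set B
  Ph : Set B
  W : B → B → (Fin d → Q) → Prop
  iob_subset_ob : IOb ⊆ Ob
  ob_of_w : ∀ {m b : B} {p : Fin d → Q}, W m b p → m ∈ Ob

section Length

variable {Q : Type*} [Field Q] [LinearOrder Q]

open Classical in
/-- The non-negative square root of a quantity, where it exists (and `0` otherwise). -/
noncomputable def qsqrt (x : Q) : Q :=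
  if h : ∃ y : Q, 0 ≤ y ∧ y * y = x then h.choose else 0

theorem qsqrt_spec {x : Q} (h : ∃ y : Q, 0 ≤ y ∧ y * y = x) :
    0 ≤ qsqrt x ∧ qsqrt x * qsqrt x = x := by
  unfold qsqrt
  rw [dif_pos h]
  exact h.choose_spec

/-- The Euclidean length of a vector. -/
noncomputable def elen {ι : Type*} [Fintype ι] (p : ι → Q) : Q :=
  qsqrt (∑ i, p i ^ 2)

/-- The time component of a coordinate point. -/
def timeOf {d : ℕ} [NeZero d] (p : Fin d → Q) : Q := p 0

/-- The space component of a coordinate point. -/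
def spaceOf {d : ℕ} [NeZero d] (p : Fin d → Q) : {i : Fin d // i ≠ 0} → Q := fun i => p i

/-- A plane parallel to the time axis. -/
def IsVerticalPlane {d : ℕ} [NeZero d] (P : AffineSubspace Q (Fin d → Q)) : Prop :=
  (P : Set (Fin d → Q)).Nonempty ∧ Module.finrank Q P.direction = 2 ∧
    (Pi.single 0 1 : Fin d → Q) ∈ P.direction

end Length

namespace Model

variable {d : ℕ} {B Q : Type*} (M : Model d B Q)

/-- The model as a structure for the first-order language; its universe consists of the bodies
and the quantities. -/
@[reducible] def interp [Add Q] [Mul Q] [LE Q] : (lang d).Structure (B ⊕ Q) where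
  funMap := fun f => nomatch f
  RelMap := fun {_} r => match r with
    | .body => fun x => ∃ b : B, x 0 = Sum.inl b
    | .ob => fun x => ∃ b ∈ M.Ob, x 0 = Sum.inl b
    | .iob => fun x => ∃ b ∈ M.IOb, x 0 = Sum.inl b
    | .ph => fun x => ∃ b ∈ M.Ph, x 0 = Sum.inl b
    | .qty => fun x => ∃ q : Q, x 0 = Sum.inr q
    | .add => fun x => ∃ q r : Q, x 0 = Sum.inr q ∧ x 1 = Sum.inr r ∧ x 2 = Sum.inr (q + r)
    | .mul => fun x => ∃ q r : Q, x 0 = Sum.inr q ∧ x 1 = Sum.inr r ∧ x 2 = Sum.inr (q * r)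
    | .le => fun x => ∃ q r : Q, x 0 = Sum.inr q ∧ x 1 = Sum.inr r ∧ q ≤ r
    | .wview => fun x => ∃ (m b : B) (p : Fin d → Q), x 0 = Sum.inl m ∧ x 1 = Sum.inl b ∧
        (∀ i : Fin d, x i.succ.succ = Sum.inr (p i)) ∧ M.W m b p

/-- A set of quantities is definable if a first-order formula of the language, with arbitrary
bodies and quantities as parameters, defines it. -/
def DefinableSet [Add Q] [Mul Q] [LE Q] (S : Set Q) : Prop :=
  @Set.Definable₁ (B ⊕ Q) Set.univ (lang d) M.interp (Sum.inr '' S)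

/-! ### Events and coordinates -/

/-- The event (set of bodies) that `m` observes at `p`. -/
def ev (m : B) (p : Fin d → Q) : Set B := {b | M.W m b p}

/-- The coordinate-domain of `m`. -/
def Cd (m : B) : Set (Fin d → Q) := {p | (M.ev m p).Nonempty}

/-- The nonempty events observed by `m`. -/
def EvOf (m : B) : Set (Set B) := {e | ∃ p ∈ M.Cd m, M.ev m p = e}

/-- All observed events. -/
def Ev : Set (Set B) := {e | ∃ m ∈ M.Ob, e ∈ M.EvOf m}

/-- `q` is the unique coordinate point of the event `e` for `m`, that is, `Crd_m(e)` exists and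
equals `q`. -/
def IsCrd (m : B) (e : Set B) (q : Fin d → Q) : Prop :=
  q ∈ M.Cd m ∧ M.ev m q = e ∧ ∀ q' ∈ M.Cd m, M.ev m q' = e → q' = q

/-- The world-line of the body `b` according to `m`. -/
def wl (m b : B) : Set (Fin d → Q) := {p | b ∈ M.ev m p}

variable [Field Q] [LinearOrder Q]

/-- The coordinate neighborhood of the event `e` with radius `δ` according to `k`. -/
def nbhd (k : B) (e : Set B) (δ : Q) : Set (Fin d → Q) :=
  {p | p ∈ M.Cd k ∧ ∃ q ∈ M.Cd k, M.ev k q = e ∧ elen (p - q) < δ}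

variable [NeZero d]

/-- The events `e₁` and `e₂` have the same time coordinate for `m`. -/
def Simultaneous (m : B) (e₁ e₂ : Set B) : Prop :=
  ∃ p q, M.IsCrd m e₁ p ∧ M.IsCrd m e₂ q ∧ timeOf p = timeOf q

/-- The elapsed time between `e₁` and `e₂` measured by `m` is (defined and equal to) `t`. -/
def HasTime (m : B) (e₁ e₂ : Set B) (t : Q) : Prop :=
  ∃ p q, M.IsCrd m e₁ p ∧ M.IsCrd m e₂ q ∧ t = |timeOf p - timeOf q|

/-- The spatial distance of `e₁` and `e₂` according to `m` is (defined and equal to) `r`. -/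
def HasDist (m : B) (e₁ e₂ : Set B) (r : Q) : Prop :=
  ∃ p q, M.IsCrd m e₁ p ∧ M.IsCrd m e₂ q ∧ r = elen (spaceOf p - spaceOf q)

/-- `m` is a co-moving observer of `k` at the event `e`. -/
def CoMoving (m k : B) (e : Set B) : Prop :=
  ∀ ε : Q, 0 < ε → ∃ δ : Q, 0 < δ ∧ ∀ p ∈ M.nbhd k e δ,
    ∃ p' r, M.IsCrd m (M.ev k p) p' ∧ M.IsCrd k e r ∧ elen (p - p') ≤ ε * elen (p - r)

/-- `m` is a co-moving inertial observer of `k` (at some event in which `k` coordinatizes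
himself). -/
def IsCoMovingInertial (m k : B) : Prop :=
  m ∈ M.IOb ∧ ∃ e ∈ M.EvOf k, k ∈ e ∧ M.CoMoving m k e

/-! ### The axioms -/

/-- The axioms of special relativity, for inertial observers. -/
structure SpecRel : Prop where
  /-- Every positive quantity has a square root. -/
  axEOF : ∀ x : Q, 0 < x → ∃ y : Q, y * y = x
  /-- An observer observes himself exactly at the points of his time axis (within his
  coordinate-domain). -/
  axSelfMinus : ∀ m ∈ M.Ob, ∀ p ∈ M.Cd m, m ∈ M.ev m p ↔ spaceOf p = 0
  /-- For inertial observers, photons connect exactly the points on lines of slope 1. -/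
  axPh : ∀ m ∈ M.IOb, ∀ p q : Fin d → Q,
    elen (spaceOf p - spaceOf q) = |timeOf p - timeOf q| ↔
      (M.Ph ∩ M.ev m p ∩ M.ev m q).Nonempty
  /-- Inertial observers coordinatize the same events. -/
  axEv : ∀ m ∈ M.IOb, ∀ k ∈ M.IOb, M.EvOf m = M.EvOf k
  /-- Inertial observers agree on the distance of events that are simultaneous for both. -/
  axSimDist : ∀ m ∈ M.IOb, ∀ k ∈ M.IOb, ∀ e₁ ∈ M.EvOf m ∩ M.EvOf k,
    ∀ e₂ ∈ M.EvOf m ∩ M.EvOf k, M.Simultaneous m e₁ e₂ → M.Simultaneous k e₁ e₂ →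
      ∃ r : Q, M.HasDist m e₁ e₂ r ∧ M.HasDist k e₁ e₂ r

/-- The axioms for accelerated observers, with the induction schema. -/
structure AccRel : Prop extends SpecRel M where
  /-- An observer coordinatizes every event in which he participates. -/
  axEvTr : ∀ m ∈ M.Ob, ∀ e ∈ M.Ev, m ∈ e → e ∈ M.EvOf m
  /-- The set of instants at which an observer is present in his own world-view is connected. -/
  axSelfPlus : ∀ m ∈ M.Ob, ∀ x ∈ timeOf '' {p | m ∈ M.ev m p},
    ∀ y ∈ timeOf '' {p | m ∈ M.ev m p}, ∀ z, x < z → z < y → z ∈ timeOf '' {p | m ∈ M.ev m p}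
  /-- At any event in which an observer coordinatizes himself there is a co-moving inertial
  observer. -/
  axAcc : ∀ k ∈ M.Ob, ∀ e ∈ M.EvOf k, k ∈ e → ∃ m ∈ M.IOb, M.CoMoving m k e
  /-- Every nonempty bounded set of quantities that is definable with parameters has a
  supremum. -/
  ind : ∀ S : Set Q, M.DefinableSet S → S.Nonempty → BddAbove S → BddBelow S →
    ∃ s, IsLUB S s

/-! ### Notions of the theorem -/

/-- `k` and `b` are coplanar: their world-lines lie in one vertical plane in the coordinate system
of some inertial observer. -/
def Coplanar (k b : B) : Prop :=
  ∃ m ∈ M.IOb, ∃ P : AffineSubspace Q (Fin d → Q),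
    IsVerticalPlane P ∧ M.wl m k ∪ M.wl m b ⊆ (P : Set (Fin d → Q))

/-- `e₁` precedes `e₂` (and `e₂` succeeds `e₁`) according to `k`. -/
def Precedes (k : B) (e₁ e₂ : Set B) : Prop :=
  ∀ m, M.IsCoMovingInertial m k →
    ∃ p q, M.IsCrd m e₁ p ∧ M.IsCrd m e₂ q ∧ timeOf p ≤ timeOf q

/-- `e₁` and `e₂` are photon simultaneous for `k`. -/
def PhotonSim (k : B) (e₁ e₂ : Set B) : Prop :=
  ∃ e ∈ M.Ev, ∃ ph₁ ∈ M.Ph, ∃ ph₂ ∈ M.Ph, k ∈ e ∧ ph₁ ∈ e ∩ e₁ ∧ ph₂ ∈ e ∩ e₂ ∧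
    M.Precedes k e₁ e ∧ M.Precedes k e₂ e

/-- The co-moving inertial observers of `b` at `eb` and of `c` at `ec` all participate in the
event `e`. -/
def WouldMeetAt (b c : B) (eb ec e : Set B) : Prop :=
  ∀ b' ∈ M.IOb, ∀ c' ∈ M.IOb, M.CoMoving b' b eb → M.CoMoving c' c ec → b' ∈ e ∧ c' ∈ e

/-- `c` is approaching `b` as seen by `b` by photons at the event `eb`. -/
def ApproachingAt (c b : B) (eb : Set B) : Prop :=
  b ∈ eb ∧ ∀ ec ∈ M.Ev, c ∈ ec → M.PhotonSim b eb ec →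
    ∃ e ∈ M.Ev, M.WouldMeetAt b c eb ec e ∧ M.Precedes b eb e

/-- `c` is moving away from `b` as seen by `b` by photons at the event `eb`. -/
def MovingAwayAt (c b : B) (eb : Set B) : Prop :=
  b ∈ eb ∧ ∀ ec ∈ M.Ev, c ∈ ec → M.PhotonSim b eb ec →
    ∃ e ∈ M.Ev, M.WouldMeetAt b c eb ec e ∧ M.Precedes b e eb

/-- `c` is approaching `b` as seen by `b` by photons. -/
def Approaching (c b : B) : Prop := ∀ eb ∈ M.Ev, b ∈ eb → M.ApproachingAt c b eb

/-- `c` is moving away from `b` as seen by `b` by photons. -/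
def MovingAway (c b : B) : Prop := ∀ eb ∈ M.Ev, b ∈ eb → M.MovingAwayAt c b eb

/-- The clock of `b` runs slower than the clock of `c` as seen by `k` by photons. The degenerate
choice of twice the same pair of events, for which no time elapses, is excluded. -/
def RunsSlower (k b c : B) : Prop :=
  ∀ eb ∈ M.Ev, ∀ eb' ∈ M.Ev, ∀ ec ∈ M.Ev, ∀ ec' ∈ M.Ev,
    b ∈ eb ∩ eb' → c ∈ ec ∩ ec' → M.PhotonSim k eb ec → M.PhotonSim k eb' ec' →
      ¬ (eb = eb' ∧ ec = ec') →
        ∃ s t : Q, M.HasTime b eb eb' s ∧ M.HasTime c ec ec' t ∧ s < t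

/-- `b` and `c` do not participate together in two distinct events. -/
def MeetAtMostOnce (b c : B) : Prop :=
  ∀ e ∈ M.Ev, ∀ e' ∈ M.Ev, b ∈ e → c ∈ e → b ∈ e' → c ∈ e' → e = e'

end Model

end AccRelTheory

/-! Take an inertial frame in which both world-lines lie in a vertical plane, with null coordinates
U, V there: along a photon in the plane one of them is constant. Suppose photons of constant U lead
from `c` to `b`. Parametrize both world-lines by U; the clock readings of `c` and `b` then have
derivatives 1/a₁ and 1/a, where a₁ and a are the U-components of the unit tangents. So elapsed times
are compared by comparing a₁ with a at photon-connected events, which is the Doppler shift. A unit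
tangent in the plane has null components a and 1/a, and elementary algebra shows that a - a₁ has the
sign of the parameter at which the tangent line of `b` crosses that of `c` (`doppler`). Approaching
means that this crossing is not before the event of `b`, moving away that it is not after it. The
mean value theorem passes from derivatives to elapsed times (`NullCurve.sub_lt_sub`,
`NullCurve.sub_lt_sub'`). If the photons at the two ends have opposite directions, the curves have
met in between (`NullCurve.exists_meet`), and the comparison is split at the meeting.

Two foundations are needed. First, inertial observers are related by Poincaré transformations
(`SpecRel.poincare`). Light-like parallelograms make a bijection that preserves light-like
separation additive up to translation; square roots and the agreement on distances of simultaneous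
events then make it linear and isometric. Hence a co-moving observer of `b` has a unit time
direction tangent to the world-line of `b`, and measures time by the Minkowski product with it.

Second, the quantities form an ordered field with suprema only for definable sets. World-lines are
definable (`IsWorldline.defOn`), and for definable functions the maximum, intermediate value and
mean value theorems remain available. -/

set_option linter.unusedSectionVars false
set_option linter.unusedSimpArgs false

namespace AccRelTheory

/-! ### The Minkowski form and bijections preserving light-like separation. -/

section Minkowski

variable {d : ℕ} [NeZero d] {Q : Type*} [Field Q]

/-- The Minkowski form, with signature `(+, -, …, -)`. -/
def mink (x y : Fin d → Q) : Q := 2 * x 0 * y 0 - x ⬝ᵥ y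

theorem mink_add_left (x y z : Fin d → Q) : mink (x + y) z = mink x z + mink y z := by
  simp only [mink, Pi.add_apply, add_dotProduct]; ring

theorem mink_add_right (x y z : Fin d → Q) : mink x (y + z) = mink x y + mink x z := by
  simp only [mink, Pi.add_apply, dotProduct_add]; ring

theorem mink_sub_left (x y z : Fin d → Q) : mink (x - y) z = mink x z - mink y z := by
  simp only [mink, Pi.sub_apply, sub_dotProduct]; ring

theorem mink_sub_right (x y z : Fin d → Q) : mink x (y - z) = mink x y - mink x z := by
  simp only [mink, Pi.sub_apply, dotProduct_sub]; ring

theorem mink_smul_left (c : Q) (x y : Fin d → Q) : mink (c • x) y = c * mink x y := by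
  simp only [mink, Pi.smul_apply, smul_dotProduct, smul_eq_mul]; ring

theorem mink_smul_right (c : Q) (x y : Fin d → Q) : mink x (c • y) = c * mink x y := by
  simp only [mink, Pi.smul_apply, dotProduct_smul, smul_eq_mul]; ring

theorem mink_neg_left (x y : Fin d → Q) : mink (-x) y = -mink x y := by
  simp only [mink, Pi.neg_apply, neg_dotProduct]; ring

theorem mink_neg_right (x y : Fin d → Q) : mink x (-y) = -mink x y := by
  simp only [mink, Pi.neg_apply, dotProduct_neg]; ring

theorem mink_comm (x y : Fin d → Q) : mink x y = mink y x := by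
  simp only [mink, dotProduct_comm x y]; ring

theorem mink_zero_left (x : Fin d → Q) : mink 0 x = 0 := by
  simp [mink]

theorem mink_single_zero_right (x : Fin d → Q) (c : Q) :
    mink x (Pi.single 0 c) = c * x 0 := by
  simp only [mink, dotProduct_single, Pi.single_eq_same]; ring

theorem mink_single_right (x : Fin d → Q) {i : Fin d} (hi : i ≠ 0) (c : Q) :
    mink x (Pi.single i c) = -(c * x i) := by
  simp only [mink, dotProduct_single, Pi.single_eq_of_ne hi.symm]; ring

variable [LinearOrder Q] [IsStrictOrderedRing Q]

theorem eq_zero_of_null_of_time_eq_zero {x : Fin d → Q} (hx : mink x x = 0) (h0 : x 0 = 0) :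
    x = 0 := by
  rw [mink, h0] at hx
  refine dotProduct_self_eq_zero.1 ?_
  linarith

/-- Orthogonal null vectors are parallel. -/
theorem exists_smul_of_null {x y : Fin d → Q} (hx : mink x x = 0) (hy : mink y y = 0)
    (hxy : mink x y = 0) (hy0 : y ≠ 0) : ∃ c : Q, x = c • y := by
  have h0 : y 0 ≠ 0 := fun h => hy0 (eq_zero_of_null_of_time_eq_zero hy h)
  refine ⟨x 0 / y 0, ?_⟩
  rw [← sub_eq_zero]
  apply eq_zero_of_null_of_time_eq_zero
  · simp only [mink_sub_left, mink_sub_right, mink_smul_left, mink_smul_right, mink_comm y x, hx,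
      hy, hxy]
    ring
  · simp [h0]

/-! ### Bijections that preserve the relation of being connected by a light signal -/

/-- A bijection that preserves and reflects light-like separation. -/
def NullPreserving (f : (Fin d → Q) ≃ (Fin d → Q)) : Prop :=
  ∀ p q, mink (p - q) (p - q) = 0 ↔ mink (f p - f q) (f p - f q) = 0

/-- The increment of a map. -/
def incr (f : (Fin d → Q) ≃ (Fin d → Q)) (p u : Fin d → Q) : Fin d → Q := f (p + u) - f p

theorem apply_add_incr (f : (Fin d → Q) ≃ (Fin d → Q)) (p u : Fin d → Q) :
    f (p + u) = f p + incr f p u := by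
  simp [incr]

theorem incr_symm (f : (Fin d → Q) ≃ (Fin d → Q)) (p u : Fin d → Q) :
    incr f.symm (f p) (incr f p u) = u := by
  simp [incr]

theorem incr_ne_zero {f : (Fin d → Q) ≃ (Fin d → Q)} (p : Fin d → Q) {u : Fin d → Q}
    (hu : u ≠ 0) : incr f p u ≠ 0 := by
  simpa [incr, sub_eq_zero] using hu

namespace NullPreserving

variable {f : (Fin d → Q) ≃ (Fin d → Q)} (hf : NullPreserving f)
include hf

theorem symm : NullPreserving f.symm := fun p q => by
  rw [hf (f.symm p) (f.symm q)]; simp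

theorem null_incr (p : Fin d → Q) {u : Fin d → Q} (hu : mink u u = 0) :
    mink (incr f p u) (incr f p u) = 0 := by
  rw [incr, ← hf]; simpa using hu

/-- The images of `p`, `p + u` and `p + l • u` are pairwise light-like separated, so the increments
from `f p` are null and orthogonal, hence parallel. Null lines thus go into null lines, and onto
them by the same argument for `f.symm`. -/
theorem exists_apply_add_smul (p : Fin d → Q) {u : Fin d → Q} (hu : mink u u = 0) (hu0 : u ≠ 0)
    (l : Q) : ∃ c : Q, f (p + l • u) = f p + c • incr f p u := by
  have h1 : mink (f (p + l • u) - f p) (f (p + l • u) - f p) = 0 := by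
    rw [← hf]; simp [mink_smul_left, mink_smul_right, hu]
  have h2 : mink (f (p + l • u) - f p - incr f p u) (f (p + l • u) - f p - incr f p u) = 0 := by
    have : f (p + l • u) - f p - incr f p u = f (p + l • u) - f (p + u) := by simp [incr]
    rw [this, ← hf]
    have : p + l • u - (p + u) = (l - 1) • u := by rw [sub_smul, one_smul]; abel
    simp [this, mink_smul_left, mink_smul_right, hu]
  have h3 := hf.null_incr p hu
  obtain ⟨c, hc⟩ := exists_smul_of_null h1 h3 (by
    rw [mink_sub_left (f (p + l • u) - f p), mink_sub_right, mink_sub_right _ _ (incr f p u),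
      mink_comm (incr f p u), h1, h3] at h2
    linarith) (incr_ne_zero p hu0)
  exact ⟨c, by rw [← hc]; abel⟩

theorem exists_smul_apply_add (p : Fin d → Q) {u : Fin d → Q} (hu : mink u u = 0) (hu0 : u ≠ 0)
    (c : Q) : ∃ l : Q, f (p + l • u) = f p + c • incr f p u := by
  obtain ⟨l, hl⟩ := hf.symm.exists_apply_add_smul (f p) (hf.null_incr p hu)
    (incr_ne_zero p hu0) c
  refine ⟨l, ?_⟩
  rw [incr_symm, f.symm_apply_apply] at hl
  rw [← hl, f.apply_symm_apply]

/-- A point outside the hyperplane orthogonal to a null line is light-like separated from some point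
of the line; a point of the hyperplane is so only if it lies on the line. Light-like separation
therefore detects orthogonality to a null line. -/
theorem orthogonal_incr (p r : Fin d → Q) {u : Fin d → Q} (hu : mink u u = 0) (hu0 : u ≠ 0)
    (h : mink (r - p) u = 0) : mink (f r - f p) (incr f p u) = 0 := by
  by_contra hne
  have hD := hf.null_incr p hu
  set D := incr f p u
  set w := f r - f p with hw
  -- As `D` is null, `w - c • D` has Minkowski square `mink w w - 2 * c * mink w D`, which vanishes
  -- for this coefficient.
  obtain ⟨l, hl⟩ := hf.exists_smul_apply_add p hu hu0 (mink w w / (2 * mink w D))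
  have h1 : mink (r - (p + l • u)) (r - (p + l • u)) = 0 := by
    rw [hf, hl]
    have : f r - (f p + (mink w w / (2 * mink w D)) • D) = w - (mink w w / (2 * mink w D)) • D := by
      rw [hw]; abel
    rw [this]
    simp only [mink_sub_left, mink_sub_right, mink_smul_left, mink_smul_right, mink_comm D w, hD]
    field_simp
    ring
  have h2 : mink (r - p) (r - p) = 0 := by
    have : r - (p + l • u) = (r - p) - l • u := by abel
    rw [this] at h1
    simpa only [mink_sub_left (r - p), mink_sub_right _ (r - p), mink_smul_left, mink_smul_right,
      mink_comm u (r - p), hu, h, mul_zero, sub_zero] using h1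
  obtain ⟨k, hk⟩ := exists_smul_of_null h2 hu h hu0
  obtain ⟨c, hc⟩ := hf.exists_apply_add_smul p hu hu0 k
  rw [← hk, add_sub_cancel] at hc
  apply hne
  rw [hw, hc, add_sub_cancel_left, mink_smul_left, hD, mul_zero]

theorem orthogonal_incr_iff (p r : Fin d → Q) {u : Fin d → Q} (hu : mink u u = 0) (hu0 : u ≠ 0) :
    mink (r - p) u = 0 ↔ mink (f r - f p) (incr f p u) = 0 := by
  refine ⟨hf.orthogonal_incr p r hu hu0, fun h => ?_⟩
  have := hf.symm.orthogonal_incr (f p) (f r) (hf.null_incr p hu) (incr_ne_zero p hu0) h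
  simpa [incr_symm] using this

/-- Otherwise the image of the line through `p` along `v` would cross the null hyperplane at `f q`
orthogonal to `incr f q u`. The line itself is parallel to the null hyperplane at `q`, so one common
point puts all of it there, and the images of `p` and `p + v` give a contradiction. -/
theorem parallel_incr (p q : Fin d → Q) {u v : Fin d → Q} (hu : mink u u = 0) (hu0 : u ≠ 0)
    (hv : mink v v = 0) (hv0 : v ≠ 0) (h : mink v u = 0) :
    mink (incr f p v) (incr f q u) = 0 := by
  by_contra hne
  obtain ⟨l, hl⟩ := hf.exists_smul_apply_add p hv hv0
    (-mink (f p - f q) (incr f q u) / mink (incr f p v) (incr f q u))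
  have h1 : mink (p + l • v - q) u = 0 := by
    rw [hf.orthogonal_incr_iff _ _ hu hu0, hl, add_sub_right_comm, mink_add_left, mink_smul_left]
    field_simp
    ring
  have h2 : ∀ k : Q, mink (f (p + k • v) - f q) (incr f q u) = 0 := fun k => by
    rw [← hf.orthogonal_incr_iff _ _ hu hu0]
    rw [add_sub_right_comm, mink_add_left, mink_smul_left, h] at h1 ⊢
    simpa using h1
  have h3 := h2 0
  have h4 := h2 1
  rw [zero_smul, add_zero] at h3
  rw [one_smul, apply_add_incr, add_sub_right_comm, mink_add_left, h3, zero_add] at h4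
  exact hne h4

theorem parallel_incr_iff (p q : Fin d → Q) {u v : Fin d → Q} (hu : mink u u = 0) (hu0 : u ≠ 0)
    (hv : mink v v = 0) (hv0 : v ≠ 0) :
    mink v u = 0 ↔ mink (incr f p v) (incr f q u) = 0 := by
  refine ⟨hf.parallel_incr p q hu hu0 hv hv0, fun h => ?_⟩
  have := hf.symm.parallel_incr (f p) (f q) (hf.null_incr q hu) (incr_ne_zero q hu0)
    (hf.null_incr p hv) (incr_ne_zero p hv0) h
  simpa [incr_symm] using this

/-- A parallelogram with null sides goes to a quadrilateral with parallel opposite sides, in ratios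
`α` and `β`. Summing along both ways round and pairing with the null image of `v` leaves `α = 1`. -/
theorem incr_add_eq (p : Fin d → Q) {u v : Fin d → Q} (hu : mink u u = 0)
    (hv : mink v v = 0) (h : mink u v ≠ 0) : incr f (p + v) u = incr f p u := by
  have hu0 : u ≠ 0 := by rintro rfl; exact h (mink_zero_left v)
  have hv0 : v ≠ 0 := by rintro rfl; exact h (by rw [mink_comm, mink_zero_left])
  obtain ⟨α, hα⟩ := exists_smul_of_null (hf.null_incr (p + v) hu) (hf.null_incr p hu)
    (hf.parallel_incr _ _ hu hu0 hu hu0 hu) (incr_ne_zero p hu0)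
  obtain ⟨β, hβ⟩ := exists_smul_of_null (hf.null_incr (p + u) hv) (hf.null_incr p hv)
    (hf.parallel_incr _ _ hv hv0 hv hv0 hv) (incr_ne_zero p hv0)
  have h1 : incr f p u + incr f (p + u) v = incr f p v + incr f (p + v) u := by
    simp only [incr, add_right_comm p v u]; abel
  have h2 : mink (incr f p u) (incr f p v) ≠ 0 := by
    rwa [Ne, ← hf.parallel_incr_iff _ _ hv hv0 hu hu0]
  have h3 := congrArg (fun x => mink x (incr f p v)) h1
  simp only [hα, hβ, mink_add_left, mink_smul_left, hf.null_incr p hv] at h3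
  have h4 : (1 - α) * mink (incr f p u) (incr f p v) = 0 := by linear_combination h3
  rcases mul_eq_zero.1 h4 with h5 | h5
  · rw [hα, ← sub_eq_zero.1 h5, one_smul]
  · exact absurd h5 h2

end NullPreserving

/-- The null vector `e₀ + ε eᵢ`, for `ε = ±1`. -/
def nullVec (i : Fin d) (ε : Q) : Fin d → Q := Pi.single 0 1 + Pi.single i ε

theorem mink_nullVec (x : Fin d → Q) {i : Fin d} (hi : i ≠ 0) (ε : Q) :
    mink x (nullVec i ε) = x 0 - ε * x i := by
  rw [nullVec, mink_add_right, mink_single_zero_right, mink_single_right _ hi]; ring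

theorem nullVec_zero {i : Fin d} (hi : i ≠ 0) (ε : Q) : nullVec i ε 0 = 1 := by
  simp [nullVec, hi.symm]

theorem nullVec_self {i : Fin d} (hi : i ≠ 0) (ε : Q) : nullVec i ε i = ε := by
  simp [nullVec, hi]

theorem nullVec_ne {i j : Fin d} (hij : i ≠ j) (hj : j ≠ 0) (ε : Q) : nullVec i ε j = 0 := by
  simp [nullVec, hij.symm, hj]

theorem nullVec_null {i : Fin d} (hi : i ≠ 0) {ε : Q} (hε : ε * ε = 1) :
    mink (nullVec i ε) (nullVec i ε) = 0 := by
  rw [mink_nullVec _ hi, nullVec_zero hi, nullVec_self hi, hε, sub_self]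

theorem nullVec_ne_zero {i : Fin d} (hi : i ≠ 0) (ε : Q) : nullVec i ε ≠ 0 := fun h => by
  have := congrFun h 0
  rw [nullVec_zero hi] at this
  simp at this

/-- A subgroup that contains the multiples of the vectors `e₀ ± eᵢ` is everything. -/
theorem mem_of_nullVec_mem (S : AddSubgroup (Fin d → Q)) {j : Fin d} (hj : j ≠ 0)
    (h : ∀ i, i ≠ 0 → ∀ ε : Q, ε = 1 ∨ ε = -1 → ∀ l : Q, l • nullVec i ε ∈ S) (x : Fin d → Q) :
    x ∈ S := by
  have h0 : ∀ i (l : Q), Pi.single i l ∈ S := by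
    intro i l
    by_cases hi : i = 0
    · subst hi
      have := S.add_mem (h j hj 1 (Or.inl rfl) (l / 2)) (h j hj (-1) (Or.inr rfl) (l / 2))
      convert this using 1
      ext k
      simp only [nullVec, Pi.single_apply, Pi.add_apply, Pi.smul_apply, smul_eq_mul]
      split_ifs <;> ring
    · have := S.sub_mem (h i hi 1 (Or.inl rfl) (l / 2)) (h i hi (-1) (Or.inr rfl) (l / 2))
      convert this using 1
      ext k
      simp only [nullVec, Pi.single_apply, Pi.add_apply, Pi.sub_apply, Pi.smul_apply, smul_eq_mul]
      split_ifs <;> ring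
  rw [← Finset.univ_sum_single x]
  exact S.sum_mem fun i _ => h0 i (x i)

/-- A bijection that preserves and reflects light-like separation is additive up to a
translation, if there are at least two space dimensions. -/
theorem NullPreserving.add {f : (Fin d → Q) ≃ (Fin d → Q)} (hf : NullPreserving f) {i₁ i₂ : Fin d}
    (h₁ : i₁ ≠ 0) (h₂ : i₂ ≠ 0) (h₁₂ : i₁ ≠ i₂) (p x : Fin d → Q) :
    f (p + x) = f p + (f x - f 0) := by
  have hsq : ∀ {ε : Q}, ε = 1 ∨ ε = -1 → ε * ε = 1 := by rintro ε (rfl | rfl) <;> ring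
  have hnull : ∀ {i : Fin d} (_ : i ≠ 0) {ε : Q} (_ : ε = 1 ∨ ε = -1) (l : Q),
      mink (l • nullVec i ε) (l • nullVec i ε) = 0 := fun hi ε hε l => by
    rw [mink_smul_left, mink_smul_right, nullVec_null hi (hsq hε)]; ring
  have hshift : ∀ i, i ≠ 0 → ∀ ε : Q, ε = 1 ∨ ε = -1 → ∀ l : Q, ∀ q v : Fin d → Q,
      incr f (q + v) (l • nullVec i ε) = incr f q (l • nullVec i ε) := by
    intro i hi ε hε l q v
    by_cases hl : l = 0
    · simp [hl, incr]
    -- The translations that leave this increment unchanged form a subgroup, so it suffices to test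
    -- the vectors e₀ ± eⱼ and their multiples.
    let S : AddSubgroup (Fin d → Q) :=
      { carrier := {v | ∀ q, incr f (q + v) (l • nullVec i ε) = incr f q (l • nullVec i ε)}
        zero_mem' := fun q => by rw [add_zero]
        add_mem' := fun {a b} ha hb q => by rw [← add_assoc, hb, ha]
        neg_mem' := fun {a} ha q => by rw [← ha (q + -a), neg_add_cancel_right] }
    have hne : ∀ j, j ≠ 0 → ∀ η : Q, η = 1 ∨ η = -1 → (j ≠ i ∨ η = -ε) → ∀ k : Q,
        k • nullVec j η ∈ S := by
      intro j hj η hη hor k q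
      by_cases hk : k = 0
      · simp [hk]
      refine hf.incr_add_eq q (hnull hi hε l) (hnull hj hη k) ?_
      rw [mink_smul_left, mink_smul_right, mink_nullVec _ hj, nullVec_zero hi]
      refine mul_ne_zero hl (mul_ne_zero hk ?_)
      by_cases hij : j = i
      · subst hij
        rw [nullVec_self hi, hor.resolve_left (by simp), neg_mul, hsq hε]
        norm_num
      · rw [nullVec_ne (Ne.symm hij) hj]; simp
    refine mem_of_nullVec_mem S h₁ (fun j hj η hη k => ?_) v q
    by_cases hor : j ≠ i ∨ η = -ε
    · exact hne j hj η hη hor k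
    · push Not at hor
      obtain ⟨rfl, hηε⟩ := hor
      have hηε' : η = ε := by
        rcases hη with rfl | rfl <;> rcases hε with rfl | rfl <;> simp_all
      subst hηε'
      obtain ⟨j', hj'0, hj'⟩ : ∃ j', j' ≠ 0 ∧ j' ≠ j := by
        by_cases h : i₁ = j
        · exact ⟨i₂, h₂, fun h' => h₁₂ (h.trans h'.symm)⟩
        · exact ⟨i₁, h₁, h⟩
      -- A translation along the vector's own direction is not covered by `incr_add_eq`. A second
      -- space axis j' expresses it by directions that are: e₀ + η eⱼ = (e₀ + eⱼ') + (e₀ - eⱼ') -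
      -- (e₀ - η eⱼ).
      have := S.sub_mem (S.add_mem (hne j' hj'0 1 (Or.inl rfl) (Or.inl hj') k)
        (hne j' hj'0 (-1) (Or.inr rfl) (Or.inl hj') k))
        (hne j hj (-η) (by rcases hη with rfl | rfl <;> simp) (Or.inr rfl) k)
      convert this using 1
      ext t
      simp only [nullVec, Pi.single_apply, Pi.add_apply, Pi.sub_apply, Pi.smul_apply, smul_eq_mul]
      split_ifs <;> ring
  let S : AddSubgroup (Fin d → Q) :=
    { carrier := {v | ∀ q, f (q + v) = f q + (f v - f 0)}
      zero_mem' := fun q => by simp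
      add_mem' := fun {a b} ha hb q => by
        rw [← add_assoc, hb (q + a), ha q, hb a]; abel
      neg_mem' := fun {a} ha q => by
        have h3 := ha (q + -a)
        have h4 := ha (-a)
        rw [neg_add_cancel_right] at h3
        rw [neg_add_cancel] at h4
        have h5 := eq_sub_of_add_eq h3.symm
        have h6 := eq_sub_of_add_eq h4.symm
        change f (q + -a) = f q + (f (-a) - f 0)
        rw [h5, h6]; abel }
  refine mem_of_nullVec_mem S h₁ (fun i hi ε hε l q => ?_) x p
  have := hshift i hi ε hε l 0 q
  rw [zero_add, incr, incr, zero_add] at this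
  rw [← this]; abel

end Minkowski

end AccRelTheory

namespace AccRelTheory

/-! ### From additive null-preserving maps to Lorentz transformations. -/

section Semilinear

variable {d : ℕ} [NeZero d] {Q : Type*} [Field Q] [LinearOrder Q] [IsStrictOrderedRing Q]

theorem exists_mul_self_of_nonneg (hsq : ∀ x : Q, 0 < x → ∃ y : Q, y * y = x) {x : Q}
    (hx : 0 ≤ x) : ∃ y : Q, 0 ≤ y ∧ y * y = x := by
  rcases hx.eq_or_lt with rfl | hx
  · exact ⟨0, le_rfl, mul_zero 0⟩
  · obtain ⟨y, hy⟩ := hsq x hx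
    exact ⟨|y|, abs_nonneg y, by rw [abs_mul_abs_self, hy]⟩

/-- The scalars in an additive bijection which preserves null vectors: on the opposite null vectors
`e₀ ± eᵢ` they agree and are multiplicative. -/
theorem scalar_mul (hsq : ∀ x : Q, 0 < x → ∃ y : Q, y * y = x)
    (g : (Fin d → Q) → (Fin d → Q)) (hadd : ∀ x y, g (x + y) = g x + g y)
    (hnull : ∀ x, mink x x = 0 ↔ mink (g x) (g x) = 0) {i j : Fin d} (hi : i ≠ 0) (hj : j ≠ 0)
    (hij : i ≠ j) {φ ψ : Q → Q} (hφ : ∀ l, g (l • nullVec i 1) = φ l • g (nullVec i 1))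
    (hψ : ∀ l, g (l • nullVec i (-1)) = ψ l • g (nullVec i (-1)))
    (hg0 : ∀ x, g x = 0 → x = 0) :
    (∀ l, φ l = ψ l) ∧ (∀ l k, 0 < l → φ (l * k) = φ l * φ k) := by
  have hneg : ∀ x, g (-x) = -g x := fun x => (AddMonoidHom.mk' g hadd).map_neg x
  have hz : g 0 = 0 := (AddMonoidHom.mk' g hadd).map_zero
  have hu : mink (g (nullVec i (1 : Q))) (g (nullVec i 1)) = 0 :=
    (hnull _).1 (nullVec_null hi (by ring))
  have hv : mink (g (nullVec i (-1 : Q))) (g (nullVec i (-1))) = 0 :=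
    (hnull _).1 (nullVec_null hi (by ring))
  have hκ : mink (g (nullVec i (1 : Q))) (g (nullVec i (-1))) ≠ 0 := fun h => by
    have h1 : mink (g (nullVec i (1 : Q) + nullVec i (-1))) (g (nullVec i 1 + nullVec i (-1))) = 0 := by
      rw [hadd]
      simp only [mink_add_left, mink_add_right, mink_comm (g (nullVec i (-1))) (g (nullVec i 1)),
        hu, hv, h]
      ring
    rw [← hnull] at h1
    simp only [mink_add_left, mink_add_right, mink_nullVec _ hi, nullVec_zero hi,
      nullVec_self hi, Pi.add_apply] at h1
    norm_num at h1
  -- With u, v = e₀ ± eᵢ, the vector a u + b v + c eⱼ has square 4ab - c². Using both c and -c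
  -- cancels the cross terms in the image, so that `φ a * ψ b` depends only on the product ab when
  -- this is non-negative.
  have huv : ∀ a b c : Q, 4 * (a * b) = c * c →
      2 * (φ a * ψ b * mink (g (nullVec i 1)) (g (nullVec i (-1)))) +
        mink (g (Pi.single j c)) (g (Pi.single j c)) = 0 := by
    intro a b c habc
    have key : ∀ c : Q, 4 * (a * b) = c * c →
        mink (g (a • nullVec i 1 + b • nullVec i (-1) + Pi.single j c))
          (g (a • nullVec i 1 + b • nullVec i (-1) + Pi.single j c)) = 0 := by
      intro c habc
      rw [← hnull]
      simp only [mink_add_left, mink_add_right, mink_smul_left, mink_smul_right,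
        mink_nullVec _ hi, mink_single_right _ hj, nullVec_zero hi, nullVec_self hi,
        nullVec_ne hij hj, Pi.add_apply, Pi.smul_apply, smul_eq_mul, Pi.single_apply, hij,
        hi.symm, hj.symm, if_false, if_true]
      linear_combination habc
    have k1 := key c habc
    have k2 := key (-c) (by linear_combination habc)
    rw [show (Pi.single j (-c) : Fin d → Q) = -Pi.single j c by
      rw [Pi.single_neg]] at k2
    simp only [hadd, hφ, hψ, hneg, mink_add_left, mink_add_right, mink_smul_left,
      mink_smul_right, mink_neg_left, mink_neg_right, hu, hv,
      mink_comm (g (nullVec i (-1))) (g (nullVec i 1))] at k1 k2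
    linear_combination (k1 + k2) / 2
  have hprod : ∀ a b a' b' : Q, 0 ≤ a * b → a * b = a' * b' → φ a * ψ b = φ a' * ψ b' := by
    intro a b a' b' hab hab'
    obtain ⟨y, -, hy⟩ := exists_mul_self_of_nonneg hsq hab
    have h1 := huv a b (2 * y) (by rw [← hy]; ring)
    have h2 := huv a' b' (2 * y) (by rw [← hab', ← hy]; ring)
    apply mul_right_cancel₀ hκ
    linear_combination (h1 - h2) / 2
  have hφ1 : φ 1 = 1 := by
    have h1 := hφ 1
    rw [one_smul] at h1
    have h2 : (φ 1 - 1) • g (nullVec i 1) = 0 := by rw [sub_smul, ← h1, one_smul, sub_self]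
    rcases smul_eq_zero.1 h2 with h | h
    · exact sub_eq_zero.1 h
    · exact absurd (hg0 _ h) (nullVec_ne_zero hi 1)
  have hψ1 : ψ 1 = 1 := by
    have h1 := hψ 1
    rw [one_smul] at h1
    have h2 : (ψ 1 - 1) • g (nullVec i (-1)) = 0 := by rw [sub_smul, ← h1, one_smul, sub_self]
    rcases smul_eq_zero.1 h2 with h | h
    · exact sub_eq_zero.1 h
    · exact absurd (hg0 _ h) (nullVec_ne_zero hi (-1))
  have hodd : ∀ (ε : Q) (χ : Q → Q), (∀ l, g (l • nullVec i ε) = χ l • g (nullVec i ε)) →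
      ∀ l, χ (-l) = -χ l := by
    intro ε χ hχ l
    have h1 : (χ (-l) + χ l) • g (nullVec i ε) = 0 := by
      rw [add_smul, ← hχ, ← hχ, ← hadd, neg_smul, neg_add_cancel, hz]
    rcases smul_eq_zero.1 h1 with h | h
    · linarith
    · exact absurd (hg0 _ h) (nullVec_ne_zero hi ε)
  have hpos : ∀ l, 0 ≤ l → φ l = ψ l := fun l hl => by
    have := hprod l 1 1 l (by simpa using hl) (by ring)
    rwa [hφ1, hψ1, mul_one, one_mul] at this
  have heq : ∀ l, φ l = ψ l := fun l => by
    rcases le_total 0 l with h | h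
    · exact hpos l h
    · have := hpos (-l) (by linarith)
      rw [hodd 1 φ hφ, hodd (-1) ψ hψ] at this
      linarith
  refine ⟨heq, fun l k hl => ?_⟩
  have hmul : ∀ k, 0 ≤ k → φ (l * k) = φ l * φ k := fun k hk => by
    have := hprod l k (l * k) 1 (by positivity) (by ring)
    rw [hψ1, mul_one, ← heq] at this
    exact this.symm
  rcases le_total 0 k with h | h
  · exact hmul k h
  · have := hmul (-k) (by linarith)
    rw [mul_neg, hodd 1 φ hφ, hodd 1 φ hφ] at this
    linarith

/-- An additive bijection which preserves null vectors, and which preserves the length of each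
vector that has time component zero before and after, is a Lorentz transformation. -/
theorem lorentz_of_additive (hsq : ∀ x : Q, 0 < x → ∃ y : Q, y * y = x)
    (g : (Fin d → Q) → (Fin d → Q)) (hadd : ∀ x y, g (x + y) = g x + g y)
    (hnull : ∀ x, mink x x = 0 ↔ mink (g x) (g x) = 0)
    (hline : ∀ u, mink u u = 0 → u ≠ 0 → (∀ l : Q, ∃ c : Q, g (l • u) = c • g u) ∧
      ∀ c : Q, ∃ l : Q, g (l • u) = c • g u)
    (hg0 : ∀ x, g x = 0 → x = 0)
    (hdist : ∀ x, x 0 = 0 → g x 0 = 0 → mink (g x) (g x) = mink x x)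
    {i₁ i₂ : Fin d} (h₁ : i₁ ≠ 0) (h₂ : i₂ ≠ 0) (h₁₂ : i₁ ≠ i₂) :
    (∀ (l : Q) x, g (l • x) = l • g x) ∧ ∀ x, mink (g x) (g x) = mink x x := by
  have hn1 : ∀ i : Fin d, i ≠ 0 → mink (nullVec i (1 : Q)) (nullVec i 1) = 0 :=
    fun i hi => nullVec_null hi (by ring)
  have hn2 : ∀ i : Fin d, i ≠ 0 → mink (nullVec i (-1 : Q)) (nullVec i (-1)) = 0 :=
    fun i hi => nullVec_null hi (by ring)
  have hoth : ∀ i : Fin d, ∃ j : Fin d, j ≠ 0 ∧ i ≠ j := fun i => by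
    by_cases h : i = i₁
    · exact ⟨i₂, h₂, h ▸ h₁₂⟩
    · exact ⟨i₁, h₁, h⟩
  have hφ : ∀ i : {i : Fin d // i ≠ 0}, ∃ φ : Q → Q,
      (∀ l, g (l • nullVec i.1 1) = φ l • g (nullVec i.1 1)) := fun i => by
    choose φ hφ using (hline _ (hn1 i.1 i.2) (nullVec_ne_zero i.2 1)).1
    exact ⟨φ, hφ⟩
  have hψ : ∀ i : {i : Fin d // i ≠ 0}, ∃ φ : Q → Q,
      (∀ l, g (l • nullVec i.1 (-1)) = φ l • g (nullVec i.1 (-1))) := fun i => by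
    choose φ hφ using (hline _ (hn2 i.1 i.2) (nullVec_ne_zero i.2 (-1))).1
    exact ⟨φ, hφ⟩
  choose φ hφ using hφ
  choose ψ hψ using hψ
  have hS : ∀ (i j : Fin d) (hi : i ≠ 0), j ≠ 0 → i ≠ j → _ := fun i j hi hj hij =>
    scalar_mul hsq g hadd hnull hi hj hij (hφ ⟨i, hi⟩) (hψ ⟨i, hi⟩) hg0
  have hφψ : ∀ i l, φ i l = ψ i l := fun i => by
    obtain ⟨j, hj, hij⟩ := hoth i.1
    exact (hS i.1 j i.2 hj hij).1
  have hsum : ∀ (i : Fin d) (l : Q), (Pi.single 0 (2 * l) : Fin d → Q) =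
      l • nullVec i 1 + l • nullVec i (-1) := fun i l => by
    ext k
    simp only [nullVec, Pi.single_apply, Pi.add_apply, Pi.smul_apply, smul_eq_mul]
    split_ifs <;> ring
  have hdiff : ∀ (i : Fin d) (l : Q), l • nullVec i (-1) + (Pi.single i (2 * l) : Fin d → Q) =
      l • nullVec i 1 := fun i l => by
    ext k
    simp only [nullVec, Pi.single_apply, Pi.add_apply, Pi.smul_apply, smul_eq_mul]
    split_ifs <;> ring
  -- The time axis is a sum of opposite null directions for every space axis, and this forces the
  -- scalar maps of all space axes to coincide.
  have htime : ∀ i l, g (Pi.single 0 (2 * l)) = φ i l • g (Pi.single 0 (2 * 1)) := fun i l => by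
    rw [hsum i.1, hsum i.1 1, hadd, hadd, hφ, hψ, ← hφψ, one_smul, one_smul, smul_add]
  have hspace : ∀ (i : {i : Fin d // i ≠ 0}) l,
      g (Pi.single i.1 (2 * l)) = φ i l • g (Pi.single i.1 (2 * 1)) := fun i l => by
    have h1 := congrArg g (hdiff i.1 l)
    have h2 := congrArg g (hdiff i.1 1)
    rw [hadd, hφ, hψ, ← hφψ] at h1
    rw [hadd, one_smul, one_smul] at h2
    rw [← h2, smul_add] at h1
    exact add_left_cancel h1
  have he0 : g (Pi.single 0 (2 * 1)) ≠ 0 := fun h => by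
    have := congrFun (hg0 _ h) 0
    simp at this
  have hφeq : ∀ i j l, φ i l = φ j l := fun i j l => by
    have h := htime i l
    rw [htime j l, ← sub_eq_zero, ← sub_smul] at h
    rcases smul_eq_zero.1 h with h | h
    · linarith
    · exact absurd h he0
  set χ := φ ⟨i₁, h₁⟩ with hχ
  have hsingle : ∀ (i : Fin d) l, g (Pi.single i (2 * l)) = χ l • g (Pi.single i (2 * 1)) := by
    intro i l
    by_cases hi : i = 0
    · subst hi; exact htime _ l
    · rw [hspace ⟨i, hi⟩ l, hφeq ⟨i, hi⟩ ⟨i₁, h₁⟩]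
  have hmul : ∀ l k, 0 < l → χ (l * k) = χ l * χ k := (hS i₁ i₂ h₁ h₂ h₁₂).2
  have hsurj : ∀ c, ∃ l, χ l = c := fun c => by
    obtain ⟨l, hl⟩ := (hline _ (hn1 i₁ h₁) (nullVec_ne_zero h₁ 1)).2 c
    refine ⟨l, ?_⟩
    have h1 := hφ ⟨i₁, h₁⟩ l
    rw [hl, ← sub_eq_zero, ← sub_smul] at h1
    rcases smul_eq_zero.1 h1 with h | h
    · rw [hχ]; linarith
    · exact absurd (hg0 _ h) (nullVec_ne_zero h₁ 1)
  have hχz : χ 0 = 0 := by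
    have h := htime ⟨i₁, h₁⟩ 0
    have hz : g 0 = 0 := (AddMonoidHom.mk' g hadd).map_zero
    rw [mul_zero, Pi.single_zero, hz] at h
    exact (smul_eq_zero.1 h.symm).resolve_right he0
  -- The condition `hdist` concerns only space vectors whose images have no time component. Two
  -- space axes yield a nonzero one; since `g` is so far only known to be semilinear, its
  -- coefficients are found from the surjectivity of `χ`.
  obtain ⟨x₁, x₂, hx, hx0⟩ : ∃ x₁ x₂ : Q, (x₁ ≠ 0 ∨ x₂ ≠ 0) ∧
      χ x₁ * g (Pi.single i₁ (2 * 1)) 0 + χ x₂ * g (Pi.single i₂ (2 * 1)) 0 = 0 := by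
    by_cases h : g (Pi.single i₁ (2 * 1)) 0 = 0
    · exact ⟨1, 0, Or.inl one_ne_zero, by rw [h, hχz]; ring⟩
    · obtain ⟨x₁, hx₁⟩ := hsurj (-g (Pi.single i₂ (2 * 1)) 0)
      obtain ⟨x₂, hx₂⟩ := hsurj (g (Pi.single i₁ (2 * 1)) 0)
      refine ⟨x₁, x₂, Or.inr ?_, by rw [hx₁, hx₂]; ring⟩
      rintro rfl
      exact h (by rw [← hx₂, hχz])
  have hx0' : mink (Pi.single i₁ (2 * x₁) + Pi.single i₂ (2 * x₂) : Fin d → Q)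
      (Pi.single i₁ (2 * x₁) + Pi.single i₂ (2 * x₂)) ≠ 0 := by
    intro h
    have := eq_zero_of_null_of_time_eq_zero h (by simp [h₁.symm, h₂.symm])
    have e1 := congrFun this i₁
    have e2 := congrFun this i₂
    simp [h₁₂, h₁₂.symm] at e1 e2
    rcases hx with hx | hx
    · exact hx e1
    · exact hx e2
  have hχsq : ∀ l, 0 < l → χ l * χ l = l * l := by
    intro l hl
    have hgl : g (Pi.single i₁ (2 * (l * x₁)) + Pi.single i₂ (2 * (l * x₂))) =
        χ l • g (Pi.single i₁ (2 * x₁) + Pi.single i₂ (2 * x₂)) := by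
      rw [hadd, hadd, hsingle, hsingle _ (l * x₂), hsingle i₁ x₁, hsingle i₂ x₂, hmul _ _ hl,
        hmul _ _ hl, smul_add, smul_smul, smul_smul]
    have hl' : (Pi.single i₁ (2 * (l * x₁)) + Pi.single i₂ (2 * (l * x₂)) : Fin d → Q) =
        l • (Pi.single i₁ (2 * x₁) + Pi.single i₂ (2 * x₂)) := by
      ext k
      simp only [Pi.single_apply, Pi.add_apply, Pi.smul_apply, smul_eq_mul]
      split_ifs <;> ring
    have hg0' : g (Pi.single i₁ (2 * x₁) + Pi.single i₂ (2 * x₂)) 0 = 0 := by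
      rw [hadd, hsingle, hsingle i₂]; simpa using hx0
    have d1 := hdist (Pi.single i₁ (2 * x₁) + Pi.single i₂ (2 * x₂)) (by simp [h₁.symm, h₂.symm])
      hg0'
    have d2 := hdist (Pi.single i₁ (2 * (l * x₁)) + Pi.single i₂ (2 * (l * x₂)))
      (by simp [h₁.symm, h₂.symm]) (by rw [hgl, Pi.smul_apply, hg0', smul_zero])
    rw [hgl, hl', mink_smul_left, mink_smul_right, mink_smul_left, mink_smul_right, d1] at d2
    apply mul_right_cancel₀ hx0'
    linear_combination d2
  -- Positive quantities are squares and `χ` is multiplicative on them, so `χ l` is a square. This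
  -- selects the sign in `χ l = ± l`.
  have hχpos : ∀ l, 0 < l → χ l = l := by
    intro l hl
    obtain ⟨y, hy⟩ := hsq l hl
    have hy0 : y ≠ 0 := by rintro rfl; simp at hy; exact hl.ne hy
    have h1 : χ l = χ |y| * χ |y| := by
      rw [← hmul _ _ (abs_pos.2 hy0), abs_mul_abs_self, hy]
    have h2 : 0 ≤ χ l := by rw [h1]; exact mul_self_nonneg _
    exact (mul_self_inj h2 hl.le).1 (hχsq l hl)
  have hsingle' : ∀ (i : Fin d) l, 0 ≤ l → g (Pi.single i (2 * l)) = l • g (Pi.single i (2 * 1)) := by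
    intro i l hl
    rw [hsingle]
    rcases hl.eq_or_lt with rfl | hl
    · rw [hχz]
    · rw [hχpos l hl]
  have hneg : ∀ x, g (-x) = -g x := fun x => (AddMonoidHom.mk' g hadd).map_neg x
  have hlin1 : ∀ (i : Fin d) l, g (Pi.single i (2 * l)) = l • g (Pi.single i (2 * 1)) := by
    intro i l
    rcases le_total 0 l with h | h
    · exact hsingle' i l h
    · have := hsingle' i (-l) (by linarith)
      rw [mul_neg, Pi.single_neg, hneg, neg_smul, neg_inj] at this
      exact this
  have hgsum : ∀ x, g x = ∑ i, g (Pi.single i (x i)) := fun x => by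
    conv_lhs => rw [← Finset.univ_sum_single x]
    exact map_sum (AddMonoidHom.mk' g hadd) _ _
  have hlin : ∀ (l : Q) x, g (l • x) = l • g x := by
    intro l x
    rw [hgsum, hgsum x, Finset.smul_sum]
    refine Finset.sum_congr rfl fun i _ => ?_
    have e1 := hlin1 i ((l • x) i / 2)
    have e2 := hlin1 i (x i / 2)
    rw [mul_div_cancel₀ _ two_ne_zero] at e1 e2
    rw [e1, e2, smul_smul, Pi.smul_apply, smul_eq_mul, mul_div_assoc]
  refine ⟨hlin, ?_⟩
  set k := mink (g (Pi.single 0 1)) (g (Pi.single 0 1)) with hk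
  have hg1 : ∀ i ≠ 0, g (nullVec i (1 : Q)) = g (Pi.single 0 1) + g (Pi.single i 1) := fun i _ => by
    rw [nullVec, hadd]
  have hg2 : ∀ i ≠ 0, g (nullVec i (-1 : Q)) = g (Pi.single 0 1) - g (Pi.single i 1) := fun i _ => by
    rw [nullVec, hadd, Pi.single_neg, hneg, sub_eq_add_neg]
  have hkk : ∀ i ≠ 0, mink (g (Pi.single i 1)) (g (Pi.single i 1)) = -k ∧
      mink (g (Pi.single 0 1)) (g (Pi.single i 1)) = 0 := by
    intro i hi
    have e1 := (hnull _).1 (hn1 i hi)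
    have e2 := (hnull _).1 (hn2 i hi)
    rw [hg1 i hi] at e1
    rw [hg2 i hi] at e2
    simp only [mink_add_left, mink_add_right, mink_sub_left, mink_sub_right,
      mink_comm (g (Pi.single i 1)) (g (Pi.single 0 1)), ← hk] at e1 e2
    constructor <;> linarith
  have hcross : ∀ i j, i ≠ j → mink (g (Pi.single i 1)) (g (Pi.single j 1)) = 0 := by
    intro i j hij
    by_cases hi : i = 0
    · subst hi; exact (hkk j hij.symm).2
    by_cases hj : j = 0
    · subst hj; rw [mink_comm]; exact (hkk i hi).2
    -- Since 5² = 3² + 4², this is a null vector involving both space axes. In the square of its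
    -- image everything but the cross term of the two axes cancels.
    have h1 : mink ((5 : Q) • Pi.single 0 1 + (3 : Q) • Pi.single i 1 + (4 : Q) • Pi.single j 1)
        ((5 : Q) • Pi.single 0 1 + (3 : Q) • Pi.single i 1 + (4 : Q) • Pi.single j 1 : Fin d → Q) =
          0 := by
      simp only [mink_add_left, mink_add_right, mink_smul_left, mink_smul_right,
        mink_single_zero_right, mink_single_right _ hi, mink_single_right _ hj, Pi.add_apply,
        Pi.smul_apply, smul_eq_mul, Pi.single_apply, hi, hj, hij, hij.symm, Ne.symm hi, Ne.symm hj, if_true, if_false]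
      norm_num
    rw [hnull] at h1
    simp only [hadd, hlin, mink_add_left, mink_add_right, mink_smul_left, mink_smul_right,
      mink_comm (g (Pi.single i 1)) (g (Pi.single 0 1)),
      mink_comm (g (Pi.single j 1)) (g (Pi.single 0 1)),
      mink_comm (g (Pi.single j 1)) (g (Pi.single i 1)), (hkk i hi).1, (hkk i hi).2,
      (hkk j hj).1, (hkk j hj).2, ← hk] at h1
    linarith
  let G : (Fin d → Q) →ₗ[Q] (Fin d → Q) := { toFun := g, map_add' := hadd, map_smul' := hlin }
  let Mk : LinearMap.BilinForm Q (Fin d → Q) :=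
    LinearMap.mk₂ Q mink mink_add_left mink_smul_left mink_add_right mink_smul_right
  have hform : Mk.compl₁₂ G G = k • Mk := by
    refine (Pi.basisFun Q (Fin d)).ext fun i => (Pi.basisFun Q (Fin d)).ext fun j => ?_
    simp only [Pi.basisFun_apply, LinearMap.compl₁₂_apply, LinearMap.smul_apply, smul_eq_mul]
    change mink (g (Pi.single i 1)) (g (Pi.single j 1)) = k * mink (Pi.single i 1) (Pi.single j 1)
    by_cases hij : i = j
    · subst hij
      by_cases hi : i = 0
      · subst hi; rw [mink_single_zero_right, Pi.single_eq_same, ← hk]; ring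
      · rw [(hkk i hi).1, mink_single_right _ hi, Pi.single_eq_same]; ring
    · rw [hcross i j hij]
      by_cases hj : j = 0
      · subst hj; rw [mink_single_zero_right, Pi.single_eq_of_ne (Ne.symm hij)]; ring
      · rw [mink_single_right _ hj, Pi.single_eq_of_ne (Ne.symm hij)]; ring
  have hform' : ∀ x, mink (g x) (g x) = k * mink x x := fun x =>
    LinearMap.congr_fun (LinearMap.congr_fun hform x) x
  have hk1 : k = 1 := by
    have d1 := hdist (Pi.single i₁ (2 * x₁) + Pi.single i₂ (2 * x₂)) (by simp [h₁.symm, h₂.symm])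
      (by rw [hadd, hsingle, hsingle i₂]; simpa using hx0)
    rw [hform'] at d1
    exact mul_right_cancel₀ hx0' (by rw [d1, one_mul])
  intro x
  rw [hform', hk1, one_mul]

end Semilinear

end AccRelTheory

namespace AccRelTheory

/-! ### Euclidean length in terms of the Minkowski form. -/

section Length

variable {d : ℕ} [NeZero d] {Q : Type*} [Field Q] [LinearOrder Q] [IsStrictOrderedRing Q]

theorem elen_nonneg_and_sq (hsq : ∀ x : Q, 0 < x → ∃ y : Q, y * y = x) {ι : Type*} [Fintype ι]
    (v : ι → Q) : 0 ≤ elen v ∧ elen v * elen v = ∑ i, v i ^ 2 :=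
  qsqrt_spec (exists_mul_self_of_nonneg hsq (Finset.sum_nonneg fun i _ => sq_nonneg (v i)))

theorem abs_le_elen (hsq : ∀ x : Q, 0 < x → ∃ y : Q, y * y = x) {ι : Type*} [Fintype ι]
    (v : ι → Q) (i : ι) : |v i| ≤ elen v := by
  obtain ⟨h0, h1⟩ := elen_nonneg_and_sq hsq v
  refine abs_le_of_sq_le_sq ?_ h0
  rw [pow_two (elen v), h1]
  exact Finset.single_le_sum (f := fun i => v i ^ 2) (fun i _ => sq_nonneg _) (Finset.mem_univ i)

theorem elen_space_mul_self (hsq : ∀ x : Q, 0 < x → ∃ y : Q, y * y = x) (p q : Fin d → Q) :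
    elen (spaceOf p - spaceOf q) * elen (spaceOf p - spaceOf q) =
      (p - q) 0 * (p - q) 0 - mink (p - q) (p - q) := by
  rw [(elen_nonneg_and_sq hsq _).2, mink]
  have h : (p - q) ⬝ᵥ (p - q) = (p - q) 0 ^ 2 + ∑ i : {i : Fin d // i ≠ 0}, (p - q) i ^ 2 := by
    rw [← Fintype.sum_eq_add_sum_subtype_ne (fun i => (p - q) i ^ 2) 0]
    exact Finset.sum_congr rfl fun i _ => (pow_two _).symm
  rw [h]
  have : ∑ i, (spaceOf p - spaceOf q) i ^ 2 = ∑ i : {i : Fin d // i ≠ 0}, (p - q) i ^ 2 := rfl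
  rw [this]; ring

theorem elen_space_eq_abs_iff (hsq : ∀ x : Q, 0 < x → ∃ y : Q, y * y = x) (p q : Fin d → Q) :
    elen (spaceOf p - spaceOf q) = |timeOf p - timeOf q| ↔ mink (p - q) (p - q) = 0 := by
  have h := elen_space_mul_self hsq p q
  have h0 := (elen_nonneg_and_sq hsq (spaceOf p - spaceOf q)).1
  have ht : |timeOf p - timeOf q| * |timeOf p - timeOf q| = (p - q) 0 * (p - q) 0 :=
    abs_mul_abs_self _
  rw [← mul_self_inj h0 (abs_nonneg _), h, ht]
  constructor <;> intro h <;> linarith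

end Length

/-! ### World-view transformations between inertial observers. -/

namespace Model

variable {d : ℕ} [NeZero d] {B Q : Type*} [Field Q] [LinearOrder Q] [IsStrictOrderedRing Q]
  {M : Model d B Q}

theorem SpecRel.photon_iff (hM : M.SpecRel) {m : B} (hm : m ∈ M.IOb) (p q : Fin d → Q) :
    mink (p - q) (p - q) = 0 ↔ (M.Ph ∩ M.ev m p ∩ M.ev m q).Nonempty := by
  rw [← hM.axPh m hm, elen_space_eq_abs_iff hM.axEOF]

/-- A point is light-like separated from itself, so a photon is present there. -/
theorem SpecRel.mem_Cd (hM : M.SpecRel) {m : B} (hm : m ∈ M.IOb) (p : Fin d → Q) : p ∈ M.Cd m := by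
  obtain ⟨x, ⟨-, hx⟩, -⟩ := (hM.photon_iff hm p p).1 (by simp [mink])
  exact ⟨x, hx⟩

/-- By `photon_iff` an event determines the light cone at its coordinate point, and a light cone
determines its apex: the difference of two apexes is null and orthogonal to e₀ ± e₁. -/
theorem SpecRel.ev_injective (hM : M.SpecRel) (hd : 3 ≤ d) {m : B} (hm : m ∈ M.IOb) :
    Function.Injective (M.ev m) := by
  intro p q hpq
  have h : ∀ r, mink (p - r) (p - r) = 0 ↔ mink (q - r) (q - r) = 0 := fun r => by
    rw [hM.photon_iff hm, hM.photon_iff hm, hpq]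
  have h1 : mink (p - q) (p - q) = 0 := by rw [h q]; simp [mink]
  have h3 : ∀ i : Fin d, i ≠ 0 → ∀ ε : Q, ε * ε = 1 → mink (p - q) (nullVec i ε) = 0 := by
    intro i hi ε hε
    have hn := nullVec_null hi hε
    have := (h (q - nullVec i ε)).2 (by rw [sub_sub_cancel]; exact hn)
    rw [← sub_add] at this
    simpa [mink_add_left, mink_add_right, hn, h1, mink_comm (nullVec i ε)] using this
  have hi : (⟨1, by omega⟩ : Fin d) ≠ 0 := fun h => by simp [Fin.ext_iff] at h
  have e1 := h3 _ hi 1 (by ring)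
  have e2 := h3 _ hi (-1) (by ring)
  rw [mink_nullVec _ hi] at e1 e2
  exact sub_eq_zero.1 (eq_zero_of_null_of_time_eq_zero h1 (by linarith))

theorem SpecRel.isCrd_iff (hM : M.SpecRel) (hd : 3 ≤ d) {m : B} (hm : m ∈ M.IOb) (e : Set B)
    (p : Fin d → Q) : M.IsCrd m e p ↔ M.ev m p = e :=
  ⟨fun h => h.2.1, fun h => ⟨hM.mem_Cd hm p, h, fun _ _ hq =>
    hM.ev_injective hd hm (hq.trans h.symm)⟩⟩

/-- The world-view transformation between inertial observers is a Poincaré transformation. -/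
theorem SpecRel.poincare (hM : M.SpecRel) (hd : 3 ≤ d) {m k : B} (hm : m ∈ M.IOb)
    (hk : k ∈ M.IOb) : ∃ (L : (Fin d → Q) →ₗ[Q] (Fin d → Q)) (a : Fin d → Q),
      (∀ x y, mink (L x) (L y) = mink x y) ∧ ∀ p, M.ev k p = M.ev m (L p + a) := by
  have hex : ∀ m ∈ M.IOb, ∀ k ∈ M.IOb, ∀ p, ∃ q, M.ev m q = M.ev k p := by
    intro m hm k hk p
    have : M.ev k p ∈ M.EvOf m := by
      rw [hM.axEv m hm k hk]; exact ⟨p, hM.mem_Cd hk p, rfl⟩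
    obtain ⟨q, -, hq⟩ := this
    exact ⟨q, hq⟩
  choose F hF using hex m hm k hk
  choose G hG using hex k hk m hm
  let f : (Fin d → Q) ≃ (Fin d → Q) :=
    { toFun := F, invFun := G
      left_inv := fun p => hM.ev_injective hd hk (by rw [hG, hF])
      right_inv := fun p => hM.ev_injective hd hm (by rw [hF, hG]) }
  have hfF : ∀ p, M.ev m (f p) = M.ev k p := hF
  have hf : NullPreserving f := fun p q => by
    rw [hM.photon_iff hk, hM.photon_iff hm, hfF, hfF]
  have hi1 : (⟨1, by omega⟩ : Fin d) ≠ 0 := fun h => by simp [Fin.ext_iff] at h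
  have hi2 : (⟨2, by omega⟩ : Fin d) ≠ 0 := fun h => by simp [Fin.ext_iff] at h
  have hi12 : (⟨1, by omega⟩ : Fin d) ≠ ⟨2, by omega⟩ := fun h => by simp [Fin.ext_iff] at h
  have hadd := hf.add hi1 hi2 hi12
  have hnull : ∀ x, mink x x = 0 ↔ mink (f x - f 0) (f x - f 0) = 0 := fun x => by
    rw [← hf, sub_zero]
  have hgadd : ∀ x y, f (x + y) - f 0 = (f x - f 0) + (f y - f 0) := fun x y => by
    rw [hadd]; abel
  have hline : ∀ u, mink u u = 0 → u ≠ 0 →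
      (∀ l : Q, ∃ c : Q, f (l • u) - f 0 = c • (f u - f 0)) ∧
        ∀ c : Q, ∃ l : Q, f (l • u) - f 0 = c • (f u - f 0) := by
    intro u hu hu0
    constructor
    · intro l
      obtain ⟨c, hc⟩ := hf.exists_apply_add_smul 0 hu hu0 l
      exact ⟨c, by rw [zero_add, incr, zero_add] at hc; rw [hc, add_sub_cancel_left]⟩
    · intro c
      obtain ⟨l, hl⟩ := hf.exists_smul_apply_add 0 hu hu0 c
      exact ⟨l, by rw [zero_add, incr, zero_add] at hl; rw [hl, add_sub_cancel_left]⟩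
  -- For a difference without time component the squared spatial distance is minus the Minkowski
  -- square, so this is the agreement on distances of simultaneous events.
  have hdist : ∀ x : Fin d → Q, x 0 = 0 → (f x - f 0) 0 = 0 →
      mink (f x - f 0) (f x - f 0) = mink x x := by
    intro x hx hfx
    have hmem : ∀ p, M.ev k p ∈ M.EvOf m ∩ M.EvOf k := fun p =>
      ⟨⟨f p, hM.mem_Cd hm _, hfF p⟩, ⟨p, hM.mem_Cd hk _, rfl⟩⟩
    have hcm : ∀ p, M.IsCrd m (M.ev k p) (f p) := fun p => (hM.isCrd_iff hd hm _ _).2 (hfF p)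
    have hck : ∀ p, M.IsCrd k (M.ev k p) p := fun p => (hM.isCrd_iff hd hk _ _).2 rfl
    obtain ⟨r, ⟨p, q, hp, hq, hr⟩, ⟨p', q', hp', hq', hr'⟩⟩ :=
      hM.axSimDist m hm k hk _ (hmem x) _ (hmem 0)
        ⟨_, _, hcm x, hcm 0, sub_eq_zero.1 hfx⟩ ⟨_, _, hck x, hck 0, hx⟩
    obtain rfl := (hcm x).2.2 p hp.1 hp.2.1
    obtain rfl := (hcm 0).2.2 q hq.1 hq.2.1
    obtain rfl := (hck x).2.2 p' hp'.1 hp'.2.1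
    obtain rfl := (hck 0).2.2 q' hq'.1 hq'.2.1
    have e1 := elen_space_mul_self hM.axEOF (f p') (f 0)
    have e2 := elen_space_mul_self hM.axEOF p' 0
    rw [← hr, hfx] at e1
    rw [← hr', sub_zero, hx] at e2
    linarith
  obtain ⟨hsmul, hmink⟩ := lorentz_of_additive hM.axEOF (fun x => f x - f 0) hgadd hnull hline
    (fun x hx => f.injective (sub_eq_zero.1 hx)) hdist hi1 hi2 hi12
  refine ⟨{ toFun := fun x => f x - f 0, map_add' := hgadd, map_smul' := hsmul }, f 0, ?_, ?_⟩
  · intro x y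
    have h := hmink (x + y)
    simp only [hgadd] at h
    simp only [mink_add_left, mink_add_right, hmink, mink_comm y x,
      mink_comm (f y - f 0) (f x - f 0)] at h
    change mink (f x - f 0) (f y - f 0) = mink x y
    linarith
  · intro p
    change _ = M.ev m (f p - f 0 + f 0)
    rw [sub_add_cancel, hfF]

end Model

end AccRelTheory

namespace AccRelTheory

namespace Model

open FirstOrder FirstOrder.Language

/-! ### Definable relations between quantities. -/

section Definability

variable {d : ℕ} {B Q : Type*} [Field Q] [LinearOrder Q] [IsStrictOrderedRing Q]
  (M : Model d B Q)

/-- Definability with parameters of a set of tuples of bodies and quantities. -/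
def TupleDefinable {ι : Type} (S : Set (ι → B ⊕ Q)) : Prop :=
  @Set.Definable (B ⊕ Q) Set.univ (lang d) M.interp ι S

/-- Definability with parameters of a property of tuples of quantities. -/
def Def {ι : Type} (P : (ι → Q) → Prop) : Prop :=
  M.TupleDefinable {v | ∃ q : ι → Q, v = Sum.inr ∘ q ∧ P q}

/-- A function of quantities with definable graph. -/
def DefFun {ι : Type} (f : (ι → Q) → Q) : Prop :=
  M.Def (fun q : Option ι → Q => q none = f (fun i => q (some i)))

variable {M}

theorem tupleDefinable_rel {ι : Type} {n : ℕ} (r : Symb d n) (ts : Fin n → ι ⊕ (B ⊕ Q)) :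
    M.TupleDefinable {v : ι → B ⊕ Q | M.interp.RelMap r (fun j => Sum.elim v id (ts j))} := by
  let := M.interp
  let R : (lang d)[[(Set.univ : Set (B ⊕ Q))]].Relations n := Sum.inl r
  refine ⟨R.formula (fun j => Sum.elim (fun i => Term.var i)
      (fun c => ((lang d).con (⟨c, trivial⟩ : (Set.univ : Set (B ⊕ Q)))).term) (ts j)), ?_⟩
  ext v
  refine Iff.trans ?_ Formula.realize_rel.symm
  refine iff_of_eq (congrArg (M.interp.RelMap r) (funext fun j => ?_))
  rcases ts j with i | c
  · rfl
  · simp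

theorem tupleDefinable_qty {ι : Type} [Finite ι] :
    M.TupleDefinable {v : ι → B ⊕ Q | ∃ q : ι → Q, v = Sum.inr ∘ q} := by
  let := M.interp
  have h : M.TupleDefinable (⋂ i : ι, {v : ι → B ⊕ Q | M.interp.RelMap Symb.qty
      (fun j : Fin 1 => Sum.elim v id ((fun _ => Sum.inl i : Fin 1 → ι ⊕ (B ⊕ Q)) j))}) :=
    Set.definable_iInter_of_finite fun i => tupleDefinable_rel Symb.qty _
  convert h using 1
  ext v
  simp only [Set.mem_iInter]
  constructor
  · rintro ⟨q, rfl⟩ i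
    exact ⟨q i, rfl⟩
  · intro h
    choose q hq using h
    exact ⟨q, funext hq⟩

section Closure

variable {ι κ : Type}

theorem Def.congr {P P' : (ι → Q) → Prop} (h : M.Def P) (hP : ∀ q, P' q ↔ P q) : M.Def P' := by
  have : P' = P := funext fun q => propext (hP q)
  rwa [this]

theorem Def.and {P P' : (ι → Q) → Prop} (h : M.Def P) (h' : M.Def P') :
    M.Def (fun q => P q ∧ P' q) := by
  let := M.interp
  have := Set.Definable.inter h h'
  unfold Def TupleDefinable
  convert this using 1
  ext v
  constructor
  · rintro ⟨q, hq, h1, h2⟩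
    exact ⟨⟨q, hq, h1⟩, ⟨q, hq, h2⟩⟩
  · rintro ⟨⟨q, rfl, h1⟩, ⟨q', hq', h2⟩⟩
    obtain rfl : q = q' := Sum.inr_injective.comp_left hq'
    exact ⟨q, rfl, h1, h2⟩

/-- The complement is formed among all tuples of bodies and quantities, so it must be cut back to
tuples of quantities. -/
theorem Def.not [Finite ι] {P : (ι → Q) → Prop} (h : M.Def P) : M.Def (fun q => ¬P q) := by
  let := M.interp
  have := Set.Definable.inter (tupleDefinable_qty (M := M) (ι := ι)) (Set.Definable.compl h)
  unfold Def TupleDefinable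
  convert this using 1
  ext v
  constructor
  · rintro ⟨q, rfl, h1⟩
    refine ⟨⟨q, rfl⟩, ?_⟩
    rintro ⟨q', hq', h2⟩
    obtain rfl : q = q' := Sum.inr_injective.comp_left hq'
    exact h1 h2
  · rintro ⟨⟨q, rfl⟩, h1⟩
    exact ⟨q, rfl, fun h2 => h1 ⟨q, rfl, h2⟩⟩

theorem Def.imp [Finite ι] {P P' : (ι → Q) → Prop} (h : M.Def P) (h' : M.Def P') :
    M.Def (fun q => P q → P' q) :=
  (h.and h'.not).not.congr fun q => by tauto

theorem Def.forall_finite [Finite ι] [Finite κ] {P : κ → (ι → Q) → Prop}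
    (h : ∀ k, M.Def (P k)) : M.Def (fun q => ∀ k, P k q) := by
  let := M.interp
  have := Set.Definable.inter (tupleDefinable_qty (M := M) (ι := ι))
    (Set.definable_iInter_of_finite h)
  unfold Def TupleDefinable
  convert this using 1
  ext v
  constructor
  · rintro ⟨q, rfl, h1⟩
    exact ⟨⟨q, rfl⟩, Set.mem_iInter.2 fun k => ⟨q, rfl, h1 k⟩⟩
  · rintro ⟨⟨q, rfl⟩, h1⟩
    refine ⟨q, rfl, fun k => ?_⟩
    obtain ⟨q', hq', h2⟩ := Set.mem_iInter.1 h1 k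
    obtain rfl : q = q' := Sum.inr_injective.comp_left hq'
    exact h2

theorem Def.exs [Finite ι] [Finite κ] {P : (ι → Q) → (κ → Q) → Prop}
    (h : M.Def (fun q : ι ⊕ κ → Q => P (fun i => q (Sum.inl i)) (fun j => q (Sum.inr j)))) :
    M.Def (fun q => ∃ y, P q y) := by
  let := M.interp
  have := Set.Definable.image_comp h (Sum.inl : ι → ι ⊕ κ)
  unfold Def TupleDefinable
  convert this using 1
  ext v
  constructor
  · rintro ⟨q, rfl, y, h1⟩
    exact ⟨Sum.inr ∘ Sum.elim q y, ⟨_, rfl, h1⟩, rfl⟩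
  · rintro ⟨_, ⟨q, rfl, h1⟩, rfl⟩
    exact ⟨fun i => q (Sum.inl i), rfl, _, h1⟩

theorem Def.reindex [Finite ι] {P : (κ → Q) → Prop} (h : M.Def P) (g : κ → ι) :
    M.Def (fun q : ι → Q => P (fun j => q (g j))) := by
  let := M.interp
  have := Set.Definable.inter (tupleDefinable_qty (M := M) (ι := ι))
    (Set.Definable.preimage_comp g h)
  unfold Def TupleDefinable
  convert this using 1
  ext v
  constructor
  · rintro ⟨q, rfl, h1⟩
    exact ⟨⟨q, rfl⟩, ⟨_, rfl, h1⟩⟩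
  · rintro ⟨⟨q, rfl⟩, ⟨q', hq', h1⟩⟩
    obtain rfl : (fun j => q (g j)) = q' := Sum.inr_injective.comp_left hq'
    exact ⟨q, rfl, h1⟩

theorem Def.ex [Finite ι] {P : (ι → Q) → Q → Prop}
    (h : M.Def (fun q : Option ι → Q => P (fun i => q (some i)) (q none))) :
    M.Def (fun q => ∃ x, P q x) := by
  have h1 : M.Def (fun q : ι ⊕ Unit → Q => P (fun i => q (Sum.inl i)) (q (Sum.inr ()))) :=
    h.reindex (fun o : Option ι => o.elim (Sum.inr ()) Sum.inl)
  refine (Def.exs (P := fun q (y : Unit → Q) => P q (y ())) h1).congr fun q => ?_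
  exact ⟨fun ⟨x, hx⟩ => ⟨fun _ => x, hx⟩, fun ⟨y, hy⟩ => ⟨y (), hy⟩⟩

theorem Def.all [Finite ι] {P : (ι → Q) → Q → Prop}
    (h : M.Def (fun q : Option ι → Q => P (fun i => q (some i)) (q none))) :
    M.Def (fun q => ∀ x, P q x) :=
  (Def.ex (P := fun q x => ¬P q x) h.not).not.congr fun q => by push Not; rfl

/-- The language is relational: a term is replaced by an existentially quantified value tied to it
by the graph. -/
theorem Def.subst [Finite ι] [Finite κ] {P : (κ → Q) → Prop} (h : M.Def P)
    {f : κ → (ι → Q) → Q} (hf : ∀ j, M.DefFun (f j)) :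
    M.Def (fun q : ι → Q => P (fun j => f j q)) := by
  have h1 : M.Def (fun q : ι ⊕ κ → Q =>
      (∀ j, q (Sum.inr j) = f j (fun i => q (Sum.inl i))) ∧ P (fun j => q (Sum.inr j))) :=
    (Def.forall_finite fun j =>
      (hf j).reindex (fun o : Option ι => o.elim (Sum.inr j) Sum.inl)).and (h.reindex Sum.inr)
  refine (Def.exs (P := fun q y => (∀ j, y j = f j q) ∧ P y) h1).congr fun q => ?_
  constructor
  · intro h
    exact ⟨fun j => f j q, fun _ => rfl, h⟩
  · rintro ⟨y, hy, h⟩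
    obtain rfl : y = fun j => f j q := funext hy
    exact h

theorem DefFun.reindex [Finite ι] {f : (κ → Q) → Q} (h : M.DefFun f) (g : κ → ι) :
    M.DefFun (fun q : ι → Q => f (fun j => q (g j))) :=
  Def.reindex (ι := Option ι) h (Option.map g)

theorem Def.rel₂ [Finite ι] {R : Q → Q → Prop} (hR : M.Def (fun q : Fin 2 → Q => R (q 0) (q 1)))
    {f g : (ι → Q) → Q} (hf : M.DefFun f) (hg : M.DefFun g) : M.Def (fun q => R (f q) (g q)) :=
  hR.subst (f := ![f, g]) (by intro j; fin_cases j <;> assumption)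

theorem def_le_rel : M.Def (fun q : Fin 2 → Q => q 0 ≤ q 1) := by
  have h := tupleDefinable_rel (M := M) Symb.le (fun j : Fin 2 => (Sum.inl j : Fin 2 ⊕ (B ⊕ Q)))
  unfold Def
  convert h using 1
  ext v
  constructor
  · rintro ⟨q, rfl, h1⟩
    exact ⟨q 0, q 1, rfl, rfl, h1⟩
  · rintro ⟨q, r, h0, h1, h2⟩
    refine ⟨![q, r], funext fun j => ?_, h2⟩
    fin_cases j <;> assumption

theorem def_add_rel : M.Def (fun q : Fin 3 → Q => q 2 = q 0 + q 1) := by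
  have h := tupleDefinable_rel (M := M) Symb.add (fun j : Fin 3 => (Sum.inl j : Fin 3 ⊕ (B ⊕ Q)))
  unfold Def
  convert h using 1
  ext v
  constructor
  · rintro ⟨q, rfl, h1⟩
    exact ⟨q 0, q 1, rfl, rfl, congrArg Sum.inr h1⟩
  · rintro ⟨q, r, h0, h1, h2⟩
    refine ⟨![q, r, q + r], funext fun j => ?_, rfl⟩
    fin_cases j <;> assumption

theorem def_mul_rel : M.Def (fun q : Fin 3 → Q => q 2 = q 0 * q 1) := by
  have h := tupleDefinable_rel (M := M) Symb.mul (fun j : Fin 3 => (Sum.inl j : Fin 3 ⊕ (B ⊕ Q)))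
  unfold Def
  convert h using 1
  ext v
  constructor
  · rintro ⟨q, rfl, h1⟩
    exact ⟨q 0, q 1, rfl, rfl, congrArg Sum.inr h1⟩
  · rintro ⟨q, r, h0, h1, h2⟩
    refine ⟨![q, r, q * r], funext fun j => ?_, rfl⟩
    fin_cases j <;> assumption

theorem def_eq_rel : M.Def (fun q : Fin 2 → Q => q 0 = q 1) :=
  (def_le_rel.and (def_le_rel.reindex ![1, 0])).congr fun q => by
    simpa using le_antisymm_iff

theorem defFun_var [Finite ι] (i : ι) : M.DefFun (fun q : ι → Q => q i) :=
  (def_eq_rel.reindex ![none, some i]).congr fun q => by simp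

theorem defFun_const [Finite ι] (c : Q) : M.DefFun (fun _ : ι → Q => c) := by
  let := M.interp
  have h := tupleDefinable_rel (M := M) Symb.le
    (fun j : Fin 2 => (![Sum.inl none, Sum.inr (Sum.inr c)] j : Option ι ⊕ (B ⊕ Q)))
  have h' := tupleDefinable_rel (M := M) Symb.le
    (fun j : Fin 2 => (![Sum.inr (Sum.inr c), Sum.inl none] j : Option ι ⊕ (B ⊕ Q)))
  have := Set.Definable.inter (tupleDefinable_qty (M := M) (ι := Option ι))
    (Set.Definable.inter h h')
  unfold DefFun Def TupleDefinable
  convert this using 1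
  ext v
  constructor
  · rintro ⟨q, rfl, h1⟩
    exact ⟨⟨q, rfl⟩, ⟨q none, c, rfl, rfl, h1.le⟩, ⟨c, q none, rfl, rfl, h1.ge⟩⟩
  · rintro ⟨⟨q, rfl⟩, ⟨a, b, h0, h1, h2⟩, ⟨a', b', h0', h1', h2'⟩⟩
    refine ⟨q, rfl, ?_⟩
    obtain rfl : q none = a := Sum.inr_injective h0
    obtain rfl : c = b := Sum.inr_injective h1
    obtain rfl : c = a' := Sum.inr_injective h0'
    obtain rfl : q none = b' := Sum.inr_injective h1'
    exact le_antisymm h2 h2'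

theorem DefFun.add [Finite ι] {f g : (ι → Q) → Q} (hf : M.DefFun f) (hg : M.DefFun g) :
    M.DefFun (fun q => f q + g q) :=
  def_add_rel.subst (f := ![fun q : Option ι → Q => f (fun i => q (some i)),
    fun q => g (fun i => q (some i)), fun q => q none]) (by
      intro j
      fin_cases j
      · exact hf.reindex some
      · exact hg.reindex some
      · exact defFun_var none)

theorem DefFun.mul [Finite ι] {f g : (ι → Q) → Q} (hf : M.DefFun f) (hg : M.DefFun g) :
    M.DefFun (fun q => f q * g q) :=
  def_mul_rel.subst (f := ![fun q : Option ι → Q => f (fun i => q (some i)),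
    fun q => g (fun i => q (some i)), fun q => q none]) (by
      intro j
      fin_cases j
      · exact hf.reindex some
      · exact hg.reindex some
      · exact defFun_var none)

theorem DefFun.sub [Finite ι] {f g : (ι → Q) → Q} (hf : M.DefFun f) (hg : M.DefFun g) :
    M.DefFun (fun q => f q - g q) := by
  have := hf.add ((defFun_const (-1)).mul hg)
  simpa only [neg_one_mul, ← sub_eq_add_neg] using this

theorem DefFun.sum [Finite ι] {α : Type*} (s : Finset α) {f : α → (ι → Q) → Q}
    (hf : ∀ a, M.DefFun (f a)) : M.DefFun (fun q => ∑ a ∈ s, f a q) := by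
  classical
  induction s using Finset.induction_on with
  | empty => simpa using defFun_const 0
  | insert a s ha ih => simpa only [Finset.sum_insert ha] using (hf a).add ih

theorem Def.le [Finite ι] {f g : (ι → Q) → Q} (hf : M.DefFun f) (hg : M.DefFun g) :
    M.Def (fun q => f q ≤ g q) := def_le_rel.rel₂ hf hg

theorem Def.eq [Finite ι] {f g : (ι → Q) → Q} (hf : M.DefFun f) (hg : M.DefFun g) :
    M.Def (fun q => f q = g q) := def_eq_rel.rel₂ hf hg

theorem Def.lt [Finite ι] {f g : (ι → Q) → Q} (hf : M.DefFun f) (hg : M.DefFun g) :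
    M.Def (fun q => f q < g q) := (Def.le hg hf).not.congr fun _ => not_le.symm

end Closure

theorem Def.definableSet {S : Set Q} (h : M.Def (fun q : Fin 1 → Q => q 0 ∈ S)) :
    M.DefinableSet S := by
  unfold DefinableSet Set.Definable₁
  unfold Def TupleDefinable at h
  convert h using 1
  ext v
  constructor
  · rintro ⟨x, hx, hv⟩
    refine ⟨fun _ => x, funext fun j => ?_, hx⟩
    rw [Subsingleton.elim j 0]; exact hv.symm
  · rintro ⟨q, rfl, hq⟩
    exact ⟨q 0, hq, rfl⟩

/-- The property of being observed by `m` at a point is definable. -/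
theorem def_W (m x : B) : M.Def (fun q : Fin d → Q => M.W m x q) := by
  let := M.interp
  have h := tupleDefinable_rel (M := M) Symb.wview (fun j : Fin (d + 2) =>
    (Matrix.vecCons (Sum.inr (Sum.inl m)) (Matrix.vecCons (Sum.inr (Sum.inl x)) fun i => Sum.inl i) j :
      Fin d ⊕ (B ⊕ Q)))
  unfold Def
  convert h using 1
  ext v
  constructor
  · rintro ⟨q, rfl, h1⟩
    exact ⟨m, x, q, rfl, rfl, fun i => rfl, h1⟩
  · rintro ⟨m', x', p, h0, h1, h2, h3⟩
    obtain rfl : m = m' := Sum.inl_injective h0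
    obtain rfl : x = x' := Sum.inl_injective h1
    exact ⟨p, funext h2, h3⟩

/-- Coordinatizing the same event is a definable relation. -/
theorem def_ev_eq (k m : B) : M.Def (fun q : Fin d ⊕ Fin d → Q =>
    M.ev k (fun i => q (Sum.inl i)) = M.ev m (fun i => q (Sum.inr i))) := by
  let := M.interp
  have hW : ∀ (k : B) (g : Fin d → Fin d ⊕ Fin d), M.TupleDefinable
      {v : (Fin d ⊕ Fin d) ⊕ Unit → B ⊕ Q | M.interp.RelMap Symb.wview fun j : Fin (d + 2) =>
        Sum.elim v id (Matrix.vecCons (Sum.inr (Sum.inl k)) (Matrix.vecCons (Sum.inl (Sum.inr ()))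
          fun i => Sum.inl (Sum.inl (g i))) j : ((Fin d ⊕ Fin d) ⊕ Unit) ⊕ (B ⊕ Q))} :=
    fun k g => tupleDefinable_rel Symb.wview _
  have h1 := hW k Sum.inl
  have h2 := hW m Sum.inr
  -- The quantifier over participants of the events runs over the whole universe. Quantities do no
  -- harm, since the world-view relation fails for them on both sides.
  have h3 := Set.Definable.forall_of_finite
    (Set.Definable.inter ((Set.Definable.compl h1).union h2) ((Set.Definable.compl h2).union h1))
  have h4 := Set.Definable.inter (tupleDefinable_qty (M := M) (ι := Fin d ⊕ Fin d)) h3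
  have key : ∀ (k : B) (g : Fin d → Fin d ⊕ Fin d) (q : Fin d ⊕ Fin d → Q) (u : Unit → B ⊕ Q),
      (Sum.elim (Sum.inr ∘ q) u : (Fin d ⊕ Fin d) ⊕ Unit → B ⊕ Q) ∈
        {v : (Fin d ⊕ Fin d) ⊕ Unit → B ⊕ Q | M.interp.RelMap Symb.wview fun j : Fin (d + 2) =>
        Sum.elim v id (Matrix.vecCons (Sum.inr (Sum.inl k)) (Matrix.vecCons (Sum.inl (Sum.inr ()))
          fun i => Sum.inl (Sum.inl (g i))) j : ((Fin d ⊕ Fin d) ⊕ Unit) ⊕ (B ⊕ Q))} ↔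
      ∃ x : B, u () = Sum.inl x ∧ M.W k x (fun i => q (g i)) := by
    intro k g q u
    constructor
    · rintro ⟨m', x', p, h0, h1, h2, h3⟩
      obtain rfl : k = m' := Sum.inl_injective h0
      obtain rfl : (fun i => q (g i)) = p := funext fun i => Sum.inr_injective (h2 i)
      exact ⟨x', h1, h3⟩
    · rintro ⟨x, hx, hW⟩
      exact ⟨k, x, _, rfl, hx, fun i => rfl, hW⟩
  unfold Def TupleDefinable
  convert h4 using 1
  ext v
  constructor
  · rintro ⟨q, rfl, hq⟩
    refine ⟨⟨q, rfl⟩, fun u => ?_⟩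
    have hq' : ∀ x, M.W k x (fun i => q (Sum.inl i)) ↔ M.W m x (fun i => q (Sum.inr i)) :=
      fun x => Set.ext_iff.1 hq x
    refine ⟨(or_congr (not_congr (key k Sum.inl q u)) (key m Sum.inr q u)).2 ?_,
      (or_congr (not_congr (key m Sum.inr q u)) (key k Sum.inl q u)).2 ?_⟩
    · simp only [hq']
      tauto
    · simp only [hq']
      tauto
  · rintro ⟨⟨q, rfl⟩, hu⟩
    refine ⟨q, rfl, Set.ext fun x => ?_⟩
    obtain ⟨hu1, hu2⟩ := hu (fun _ => Sum.inl x)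
    replace hu1 := (or_congr (not_congr (key k Sum.inl q _)) (key m Sum.inr q _)).1 hu1
    replace hu2 := (or_congr (not_congr (key m Sum.inr q _)) (key k Sum.inl q _)).1 hu2
    simp only [Sum.inl.injEq, exists_eq_left'] at hu1 hu2
    change M.W k x _ ↔ M.W m x _
    tauto

end Definability

end Model

end AccRelTheory

namespace AccRelTheory

open Filter Topology Set

/-! ### Derivatives over an ordered field. -/

section Slope

variable {Q : Type*} [Field Q] [TopologicalSpace Q]
  {E : Type*} [AddCommGroup E] [Module Q E] [TopologicalSpace E]

/-- The curve `f` on `D` has derivative `m` at `x`. -/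
def HasSlope (f : Q → E) (D : Set Q) (x : Q) (m : E) : Prop :=
  Tendsto (fun y => (y - x)⁻¹ • (f y - f x)) (𝓝[D \ {x}] x) (𝓝 m)

theorem HasSlope.mono {f : Q → E} {D D' : Set Q} {x : Q} {m : E} (h : HasSlope f D x m)
    (hD : D' ⊆ D) : HasSlope f D' x m :=
  h.mono_left (nhdsWithin_mono _ (sdiff_subset_sdiff_left hD))

theorem HasSlope.map {E' : Type*} [AddCommGroup E'] [Module Q E'] [TopologicalSpace E']
    {f : Q → E} {D : Set Q} {x : Q} {m : E} (h : HasSlope f D x m) (L : E →ₗ[Q] E')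
    (hL : Continuous L) : HasSlope (fun y => L (f y)) D x (L m) := by
  refine ((hL.tendsto m).comp h).congr fun y => ?_
  simp

theorem HasSlope.sub [ContinuousSub E] {f g : Q → E} {D : Set Q} {x : Q} {m k : E}
    (hf : HasSlope f D x m) (hg : HasSlope g D x k) : HasSlope (fun y => f y - g y) D x (m - k) := by
  refine (Tendsto.sub hf hg).congr fun y => ?_
  rw [← smul_sub, sub_sub_sub_comm]

variable [LinearOrder Q] [IsStrictOrderedRing Q] [OrderTopology Q]

theorem HasSlope.neg {f : Q → Q} {D : Set Q} {x m : Q} (h : HasSlope f D x m) :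
    HasSlope (fun y => -f y) D x (-m) := by
  refine (Tendsto.neg h).congr fun y => ?_
  simp only [smul_eq_mul]; ring

theorem hasSlope_mul (c : Q) (D : Set Q) (x : Q) : HasSlope (fun y => c * y) D x c := by
  refine tendsto_const_nhds.congr' ?_
  filter_upwards [self_mem_nhdsWithin] with y hy
  have : y - x ≠ 0 := sub_ne_zero.2 hy.2
  simp only [smul_eq_mul]; field_simp

theorem HasSlope.comp_mul {f : Q → Q} {D : Set Q} {c x m : Q} (h : HasSlope f D (c * x) m)
    (hc : c ≠ 0) : HasSlope (fun y => f (c * y)) {y | c * y ∈ D} x (c * m) := by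
  have ht : Tendsto (fun y : Q => c * y) (𝓝[{y | c * y ∈ D} \ {x}] x)
      (𝓝[D \ {c * x}] (c * x)) := by
    refine tendsto_nhdsWithin_iff.2 ⟨?_, ?_⟩
    · exact ((continuous_const.mul continuous_id).tendsto x).mono_left nhdsWithin_le_nhds
    · filter_upwards [self_mem_nhdsWithin] with y hy
      exact ⟨hy.1, fun h => hy.2 (mul_left_cancel₀ hc h)⟩
  refine ((Tendsto.comp h ht).const_mul c).congr fun y => ?_
  simp only [Function.comp_apply, smul_eq_mul]
  rw [← mul_sub, mul_inv, ← mul_assoc, mul_inv_cancel_left₀ hc]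

theorem HasSlope.continuousWithinAt {f : Q → Q} {D : Set Q} {x m : Q} (h : HasSlope f D x m) :
    ContinuousWithinAt f D x := by
  rw [← continuousWithinAt_sdiff_self]
  have h1 : Tendsto (fun y : Q => y - x) (𝓝[D \ {x}] x) (𝓝 0) := by
    have : Tendsto (fun y : Q => y - x) (𝓝 x) (𝓝 (x - x)) := tendsto_id.sub_const x
    rw [sub_self] at this
    exact this.mono_left nhdsWithin_le_nhds
  have h2 := (h1.mul h).add_const (f x)
  rw [zero_mul, zero_add] at h2
  refine Tendsto.congr' ?_ h2
  filter_upwards [self_mem_nhdsWithin] with y hy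
  have : y - x ≠ 0 := sub_ne_zero.2 hy.2
  simp only [smul_eq_mul]; field_simp; ring

theorem HasSlope.nonpos_of_right {f : Q → Q} {D : Set Q} {x m b : Q} (h : HasSlope f D x m)
    (hb : x < b) (hD : Ioo x b ⊆ D) (hf : ∀ y ∈ Ioo x b, f y ≤ f x) : m ≤ 0 := by
  have : (𝓝[Ioo x b] x).NeBot := left_nhdsWithin_Ioo_neBot hb
  refine le_of_tendsto (h.mono_left (nhdsWithin_mono x
    (fun y hy => ⟨hD hy, ne_of_gt hy.1⟩ : Ioo x b ⊆ D \ {x}))) ?_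
  filter_upwards [self_mem_nhdsWithin] with y hy
  exact mul_nonpos_of_nonneg_of_nonpos (inv_nonneg.2 (sub_nonneg.2 hy.1.le))
    (sub_nonpos.2 (hf y hy))

theorem HasSlope.nonneg_of_left {f : Q → Q} {D : Set Q} {x m a : Q} (h : HasSlope f D x m)
    (ha : a < x) (hD : Ioo a x ⊆ D) (hf : ∀ y ∈ Ioo a x, f y ≤ f x) : 0 ≤ m := by
  have : (𝓝[Ioo a x] x).NeBot := right_nhdsWithin_Ioo_neBot ha
  refine ge_of_tendsto (h.mono_left (nhdsWithin_mono x
    (fun y hy => ⟨hD hy, ne_of_lt hy.2⟩ : Ioo a x ⊆ D \ {x}))) ?_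
  filter_upwards [self_mem_nhdsWithin] with y hy
  exact mul_nonneg_of_nonpos_of_nonpos (inv_nonpos.2 (sub_nonpos.2 hy.2.le))
    (sub_nonpos.2 (hf y hy))

theorem HasSlope.eq_zero_of_max {f : Q → Q} {a b x m : Q} (h : HasSlope f (Icc a b) x m)
    (hx : x ∈ Ioo a b) (hf : ∀ y ∈ Icc a b, f y ≤ f x) : m = 0 :=
  le_antisymm
    (h.nonpos_of_right hx.2 (fun _ hy => ⟨(hx.1.trans hy.1).le, hy.2.le⟩)
      fun y hy => hf y ⟨(hx.1.trans hy.1).le, hy.2.le⟩)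
    (h.nonneg_of_left hx.1 (fun _ hy => ⟨hy.1.le, (hy.2.trans hx.2).le⟩)
      fun y hy => hf y ⟨hy.1.le, (hy.2.trans hx.2).le⟩)

/-- At an isolated point every value would count as a derivative; a second point of the interval
excludes this and makes slopes unique. -/
theorem nhdsWithin_sdiff_neBot {D : Set Q} (hD : D.OrdConnected) {x y : Q} (hx : x ∈ D)
    (hy : y ∈ D) (hxy : x ≠ y) : (𝓝[D \ {x}] x).NeBot := by
  rcases hxy.lt_or_gt with h | h
  · have : (𝓝[Ioo x y] x).NeBot := left_nhdsWithin_Ioo_neBot h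
    exact this.mono (nhdsWithin_mono x
      fun z hz => ⟨hD.out hx hy (Ioo_subset_Icc_self hz), ne_of_gt hz.1⟩)
  · have : (𝓝[Ioo y x] x).NeBot := right_nhdsWithin_Ioo_neBot h
    exact this.mono (nhdsWithin_mono x
      fun z hz => ⟨hD.out hy hx (Ioo_subset_Icc_self hz), ne_of_lt hz.2⟩)

end Slope

/-! ### Calculus of definable functions. -/

namespace Model

variable {d : ℕ} {B Q : Type*} [Field Q] [LinearOrder Q] [IsStrictOrderedRing Q]

/-- The induction schema: nonempty bounded definable sets have suprema. -/
def Induction (M : Model d B Q) : Prop :=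
  ∀ S : Set Q, M.DefinableSet S → S.Nonempty → BddAbove S → BddBelow S → ∃ s, IsLUB S s

/-- The function `f` is definable on `D`. -/
def DefOn (M : Model d B Q) (f : Q → Q) (D : Set Q) : Prop :=
  M.Def (fun q : Fin 2 → Q => q 0 ∈ D ∧ q 1 = f (q 0))

variable {M : Model d B Q}

section DefOn

variable {f g : Q → Q} {D : Set Q}

theorem DefOn.rel {ι : Type} [Finite ι] (h : M.DefOn f D) {F G : (ι → Q) → Q} (hF : M.DefFun F)
    (hG : M.DefFun G) : M.Def (fun q => F q ∈ D ∧ G q = f (F q)) :=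
  Def.rel₂ (R := fun x y => x ∈ D ∧ y = f x) h hF hG

theorem DefOn.congr (h : M.DefOn f D) (hfg : ∀ x ∈ D, g x = f x) : M.DefOn g D :=
  Def.congr h fun _ => and_congr_right fun hx => by rw [hfg _ hx]

theorem DefOn.mono_Icc (h : M.DefOn f D) {a b : Q} (hab : Icc a b ⊆ D) : M.DefOn f (Icc a b) := by
  refine (Def.and h (Def.and (Def.le (defFun_const a) (defFun_var 0))
    (Def.le (defFun_var 0) (defFun_const b)))).congr fun q => ?_
  exact ⟨fun ⟨h1, h2⟩ => ⟨⟨hab h1, h2⟩, h1⟩, fun ⟨⟨_, h2⟩, h1⟩ => ⟨h1, h2⟩⟩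

theorem DefOn.comp {f : Q → Q} (h : M.DefOn f D) {E : Set Q} (hg : M.DefOn g E)
    (hfE : ∀ x ∈ D, f x ∈ E) : M.DefOn (fun x => g (f x)) D := by
  have : M.Def (fun q : Fin 2 → Q => ∃ y, (q 0 ∈ D ∧ y = f (q 0)) ∧ (y ∈ E ∧ q 1 = g y)) :=
    Def.ex ((h.rel (defFun_var _) (defFun_var _)).and (hg.rel (defFun_var _) (defFun_var _)))
  refine this.congr fun q => ?_
  constructor
  · rintro ⟨h1, h2⟩
    exact ⟨_, ⟨h1, rfl⟩, hfE _ h1, h2⟩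
  · rintro ⟨_, ⟨h1, rfl⟩, -, h2⟩
    exact ⟨h1, h2⟩

theorem DefOn.sub (hf : M.DefOn f D) (hg : M.DefOn g D) : M.DefOn (fun x => f x - g x) D := by
  have : M.Def (fun q : Fin 2 → Q => ∃ y z, (q 0 ∈ D ∧ y = f (q 0)) ∧ (q 0 ∈ D ∧ z = g (q 0)) ∧
      q 1 = y - z) :=
    Def.ex (Def.ex ((hf.rel (defFun_var _) (defFun_var _)).and
      ((hg.rel (defFun_var _) (defFun_var _)).and
        (Def.eq (defFun_var _) ((defFun_var _).sub (defFun_var _))))))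
  refine this.congr fun q => ?_
  constructor
  · rintro ⟨h1, h2⟩
    exact ⟨_, _, ⟨h1, rfl⟩, ⟨h1, rfl⟩, h2⟩
  · rintro ⟨_, _, ⟨h1, rfl⟩, ⟨-, rfl⟩, h2⟩
    exact ⟨h1, h2⟩

theorem DefOn.mul_const (hf : M.DefOn f D) (c : Q) : M.DefOn (fun x => c * f x) D := by
  have : M.Def (fun q : Fin 2 → Q => ∃ y, (q 0 ∈ D ∧ y = f (q 0)) ∧ q 1 = c * y) :=
    Def.ex ((hf.rel (defFun_var _) (defFun_var _)).and
        (Def.eq (defFun_var _) ((defFun_const c).mul (defFun_var _))))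
  refine this.congr fun q => ?_
  constructor
  · rintro ⟨h1, h2⟩
    exact ⟨_, ⟨h1, rfl⟩, h2⟩
  · rintro ⟨_, ⟨h1, rfl⟩, h2⟩
    exact ⟨h1, h2⟩

theorem DefOn.neg (hf : M.DefOn f D) : M.DefOn (fun x => -f x) D :=
  (hf.mul_const (-1)).congr fun _ _ => by ring

theorem DefOn.id (hf : M.DefOn f D) : M.DefOn (fun x => x) D := by
  have : M.Def (fun q : Fin 2 → Q => ∃ y, (q 0 ∈ D ∧ y = f (q 0)) ∧ q 1 = q 0) :=
    Def.ex ((hf.rel (defFun_var _) (defFun_var _)).and (Def.eq (defFun_var _) (defFun_var _)))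
  refine this.congr fun q => ?_
  constructor
  · rintro ⟨h1, h2⟩
    exact ⟨_, ⟨h1, rfl⟩, h2⟩
  · rintro ⟨_, ⟨h1, rfl⟩, h2⟩
    exact ⟨h1, h2⟩

theorem DefOn.comp_mul (hf : M.DefOn f D) (c : Q) :
    M.DefOn (fun x => f (c * x)) {x | c * x ∈ D} :=
  hf.rel (ι := Fin 2) ((defFun_const c).mul (defFun_var 0)) (defFun_var 1)

theorem DefOn.invFunOn [Nonempty Q] (hf : M.DefOn f D) (hinj : InjOn f D) :
    M.DefOn (Function.invFunOn f D) (f '' D) := by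
  have : M.Def (fun q : Fin 2 → Q => q 1 ∈ D ∧ q 0 = f (q 1)) :=
    hf.rel (defFun_var _) (defFun_var _)
  refine this.congr fun q => ?_
  constructor
  · rintro ⟨h1, h2⟩
    rw [h2]
    exact ⟨Function.invFunOn_mem h1, (Function.invFunOn_eq h1).symm⟩
  · rintro ⟨h1, h2⟩
    rw [h2]
    exact ⟨mem_image_of_mem f h1, (hinj.leftInvOn_invFunOn h1).symm⟩

end DefOn

section Calculus

variable [TopologicalSpace Q] [OrderTopology Q] {f : Q → Q} {a b : Q}

theorem exists_Ioo_of_eventually {x : Q} {p : Q → Prop} {D : Set Q} (h : ∀ᶠ y in 𝓝[D] x, p y) :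
    ∃ l u, l < x ∧ x < u ∧ ∀ y ∈ D, l < y → y < u → p y := by
  obtain ⟨l, u, hx, hlu⟩ := mem_nhds_iff_exists_Ioo_subset.1 (eventually_nhdsWithin_iff.1 h)
  exact ⟨l, u, hx.1, hx.2, fun y hy h1 h2 => hlu ⟨h1, h2⟩ hy⟩

/-- A definable continuous function on a closed interval has a maximum. -/
theorem exists_max (hI : M.Induction) (hab : a ≤ b) (hf : ContinuousOn f (Icc a b))
    (hd : M.DefOn f (Icc a b)) : ∃ x ∈ Icc a b, ∀ y ∈ Icc a b, f y ≤ f x := by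
  by_contra! hne
  -- This definable set takes the place of compactness: every value attained before x is exceeded at
  -- or after x. If there is no maximum, the set reaches beyond its own supremum. Values are
  -- quantified through the graph of `f`, which is what is definable.
  let S : Set Q := {x | (a ≤ x ∧ x ≤ b) ∧ ∀ y y', (y ∈ Icc a b ∧ y' = f y) → y < x →
    ∃ z z', (z ∈ Icc a b ∧ z' = f z) ∧ x ≤ z ∧ y' < z'}
  have hS : M.DefinableSet S := by
    apply Def.definableSet
    refine ((Def.le (defFun_const a) (defFun_var _)).and
      (Def.le (defFun_var _) (defFun_const b))).and (Def.all (Def.all ?_))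
    refine (hd.rel (defFun_var _) (defFun_var _)).imp
      ((Def.lt (defFun_var _) (defFun_var _)).imp (Def.ex (Def.ex ?_)))
    exact (hd.rel (defFun_var _) (defFun_var _)).and
      ((Def.le (defFun_var _) (defFun_var _)).and (Def.lt (defFun_var _) (defFun_var _)))
  have haS : a ∈ S := ⟨⟨le_rfl, hab⟩, fun y _ hy hya => absurd hy.1.1 (not_le.2 hya)⟩
  obtain ⟨s, hs⟩ := hI S hS ⟨a, haS⟩ ⟨b, fun x hx => hx.1.2⟩ ⟨a, fun x hx => hx.1.1⟩
  have hsI : s ∈ Icc a b := ⟨hs.1 haS, hs.2 fun x hx => hx.1.2⟩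
  obtain ⟨w, hw, hsw⟩ := hne s hsI
  obtain ⟨l, u, hl, hu, hlu⟩ := exists_Ioo_of_eventually ((hf s hsI).eventually_lt_const hsw)
  obtain ⟨x, hxS, hlx, hxs⟩ := hs.exists_between hl
  -- Values between `l` and `u` are below `f w`. So either `w` itself is beyond `u`, or it lies at
  -- or before `l` and `x ∈ S` gives a larger value after `x`, necessarily beyond `u`.
  obtain ⟨z₀, hz₀, hwz₀, huz₀⟩ : ∃ z₀ ∈ Icc a b, f w ≤ f z₀ ∧ u ≤ z₀ := by
    rcases le_or_gt u w with h | h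
    · exact ⟨w, hw, le_rfl, h⟩
    · have hwl : w ≤ l := by
        by_contra! h'
        exact lt_irrefl _ (hlu w hw h' h)
      obtain ⟨z, _, ⟨hz, rfl⟩, hxz, hwz⟩ := hxS.2 w _ ⟨hw, rfl⟩ (hwl.trans_lt hlx)
      refine ⟨z, hz, hwz.le, ?_⟩
      by_contra! h'
      exact lt_asymm hwz (hlu z hz (hlx.trans_le hxz) h')
  obtain ⟨x', hsx', hx'u⟩ := exists_between hu
  have hx'S : x' ∈ S := by
    refine ⟨⟨hsI.1.trans hsx'.le, hx'u.le.trans (huz₀.trans hz₀.2)⟩, ?_⟩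
    rintro y _ ⟨hy, rfl⟩ hyx'
    rcases lt_or_ge y x with h | h
    · obtain ⟨z, _, ⟨hz, rfl⟩, hxz, hyz⟩ := hxS.2 y _ ⟨hy, rfl⟩ h
      rcases le_or_gt x' z with h' | h'
      · exact ⟨z, _, ⟨hz, rfl⟩, h', hyz⟩
      · exact ⟨z₀, _, ⟨hz₀, rfl⟩, hx'u.le.trans huz₀,
          (hyz.trans (hlu z hz (hlx.trans_le hxz) (h'.trans hx'u))).trans_le hwz₀⟩
    · exact ⟨z₀, _, ⟨hz₀, rfl⟩, hx'u.le.trans huz₀,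
        (hlu y hy (hlx.trans_le h) (hyx'.trans hx'u)).trans_le hwz₀⟩
  exact absurd (hs.1 hx'S) (not_le.2 hsx')

/-- The intermediate value theorem for definable functions. -/
theorem exists_eq_of_le_of_le (hI : M.Induction) (hab : a ≤ b) (hf : ContinuousOn f (Icc a b))
    (hd : M.DefOn f (Icc a b)) {c : Q} (ha : f a ≤ c) (hb : c ≤ f b) :
    ∃ x ∈ Icc a b, f x = c := by
  let S : Set Q := {x | ∃ y, (x ∈ Icc a b ∧ y = f x) ∧ y ≤ c}
  have hS : M.DefinableSet S := by
    apply Def.definableSet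
    exact Def.ex ((hd.rel (defFun_var _) (defFun_var _)).and
      (Def.le (defFun_var _) (defFun_const c)))
  have hmem : ∀ x, x ∈ S ↔ x ∈ Icc a b ∧ f x ≤ c := fun x =>
    ⟨fun ⟨y, ⟨h1, h2⟩, h3⟩ => ⟨h1, h2 ▸ h3⟩, fun ⟨h1, h2⟩ => ⟨_, ⟨h1, rfl⟩, h2⟩⟩
  have haS : a ∈ S := (hmem a).2 ⟨left_mem_Icc.2 hab, ha⟩
  obtain ⟨s, hs⟩ := hI S hS ⟨a, haS⟩ ⟨b, fun x hx => ((hmem x).1 hx).1.2⟩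
    ⟨a, fun x hx => ((hmem x).1 hx).1.1⟩
  have hsI : s ∈ Icc a b := ⟨hs.1 haS, hs.2 fun x hx => ((hmem x).1 hx).1.2⟩
  refine ⟨s, hsI, le_antisymm ?_ ?_⟩
  · by_contra! h
    obtain ⟨l, u, hl, hu, hlu⟩ := exists_Ioo_of_eventually ((hf s hsI).eventually_const_lt h)
    obtain ⟨x, hxS, hlx, hxs⟩ := hs.exists_between hl
    obtain ⟨hxI, hxc⟩ := (hmem x).1 hxS
    exact absurd (hlu x hxI hlx (hxs.trans_lt hu)) (not_lt.2 hxc)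
  · by_contra! h
    have hsb : s < b := lt_of_le_of_ne hsI.2 (by rintro rfl; exact absurd hb (not_le.2 h))
    obtain ⟨l, u, hl, hu, hlu⟩ := exists_Ioo_of_eventually ((hf s hsI).eventually_lt_const h)
    obtain ⟨x, hsx, hx⟩ := exists_between (lt_min hu hsb)
    have hxI : x ∈ Icc a b := ⟨hsI.1.trans hsx.le, (hx.trans_le (min_le_right _ _)).le⟩
    refine absurd (hs.1 ((hmem x).2 ⟨hxI, ?_⟩)) (not_le.2 hsx)
    exact (hlu x hxI (hl.trans hsx) (hx.trans_le (min_le_left _ _))).le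

theorem exists_eq_of_ge_of_ge (hI : M.Induction) (hab : a ≤ b) (hf : ContinuousOn f (Icc a b))
    (hd : M.DefOn f (Icc a b)) {c : Q} (ha : c ≤ f a) (hb : f b ≤ c) :
    ∃ x ∈ Icc a b, f x = c := by
  obtain ⟨x, hx, h⟩ := exists_eq_of_le_of_le (f := fun x => -f x) hI hab hf.neg hd.neg
    (neg_le_neg ha) (neg_le_neg hb)
  exact ⟨x, hx, neg_inj.1 h⟩

/-- The mean value theorem for definable functions. -/
theorem exists_slope_mul_eq (hI : M.Induction) (hab : a < b) (hf : ContinuousOn f (Icc a b))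
    (hd : M.DefOn f (Icc a b)) : ∃ c ∈ Ioo a b, ∀ m, HasSlope f (Icc a b) c m →
      m * (b - a) = f b - f a := by
  have hba : b - a ≠ 0 := (sub_pos.2 hab).ne'
  set k := (f b - f a) / (b - a) with hk
  have hkm : k * (b - a) = f b - f a := by rw [hk]; field_simp
  let g : Q → Q := fun x => f x - k * x
  have hgab : g a = g b := by
    change f a - k * a = f b - k * b
    linear_combination hkm
  have hgc : ContinuousOn g (Icc a b) := hf.sub (continuousOn_const.mul continuousOn_id)
  have hgd : M.DefOn g (Icc a b) := hd.sub (hd.id.mul_const k)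
  have hgs : ∀ c m, HasSlope f (Icc a b) c m → HasSlope g (Icc a b) c (m - k) := fun c m h =>
    h.sub (hasSlope_mul k _ c)
  suffices h : ∃ c ∈ Ioo a b, ∀ m, HasSlope g (Icc a b) c m → m = 0 by
    obtain ⟨c, hc, h⟩ := h
    exact ⟨c, hc, fun m hm => by rw [sub_eq_zero.1 (h _ (hgs c m hm)), hkm]⟩
  -- Rolle's argument: some extremum of `g` is interior, or both are attained at the ends, where `g`
  -- has equal values, and `g` is constant.
  obtain ⟨x, hx, hxmax⟩ := exists_max hI hab.le hgc hgd
  obtain ⟨y, hy, hymin⟩ := exists_max hI hab.le hgc.neg hgd.neg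
  by_cases hxI : x ∈ Ioo a b
  · exact ⟨x, hxI, fun m hm => hm.eq_zero_of_max hxI hxmax⟩
  by_cases hyI : y ∈ Ioo a b
  · exact ⟨y, hyI, fun m hm => neg_eq_zero.1 (hm.neg.eq_zero_of_max hyI hymin)⟩
  have hend : ∀ z ∈ Icc a b, z ∉ Ioo a b → g z = g a := by
    intro z hz hzI
    rcases hz.1.eq_or_lt with h | h
    · rw [h]
    · rcases hz.2.eq_or_lt with h' | h'
      · rw [h', hgab]
      · exact absurd ⟨h, h'⟩ hzI
  obtain ⟨c, hc⟩ := exists_between hab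
  have hconst : ∀ z ∈ Icc a b, g z = g a := fun z hz => by
    have h1 := hxmax z hz
    have h2 : -g z ≤ -g y := hymin z hz
    rw [hend x hx hxI] at h1
    rw [hend y hy hyI] at h2
    linarith
  refine ⟨c, hc, fun m hm => hm.eq_zero_of_max hc fun z hz => ?_⟩
  rw [hconst z hz, hconst c ⟨hc.1.le, hc.2.le⟩]

variable {D : Set Q} {m : Q → Q}

theorem strictMonoOn_of_slope_pos (hI : M.Induction) (hD : D.OrdConnected) (hd : M.DefOn f D)
    (hm : ∀ x ∈ D, HasSlope f D x (m x)) (hpos : ∀ x ∈ D, 0 < m x) : StrictMonoOn f D := by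
  intro x hx y hy hxy
  have hsub := hD.out hx hy
  obtain ⟨c, hc, h⟩ := exists_slope_mul_eq hI hxy
    (fun z hz => (hm z (hsub hz)).continuousWithinAt.mono hsub) (hd.mono_Icc hsub)
  have hcD := hsub (Ioo_subset_Icc_self hc)
  have := h _ ((hm c hcD).mono hsub)
  have h2 := mul_pos (hpos c hcD) (sub_pos.2 hxy)
  linarith

/-- Darboux's argument, as the derivative need not be continuous. The maximum on `[x, y]` is not at
`x`, where the slope is positive, nor inside, where it would vanish; so it is at `y`, and the slope
there is non-negative. -/
theorem slope_pos_of_lt (hI : M.Induction) (hD : D.OrdConnected) (hd : M.DefOn f D)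
    (hm : ∀ x ∈ D, HasSlope f D x (m x)) (hne : ∀ x ∈ D, m x ≠ 0) {x y : Q} (hx : x ∈ D)
    (hy : y ∈ D) (hxy : x < y) (hpos : 0 < m x) : 0 < m y := by
  have hsub := hD.out hx hy
  obtain ⟨z, hz, hmax⟩ := exists_max hI hxy.le
    (fun z hz => (hm z (hsub hz)).continuousWithinAt.mono hsub) (hd.mono_Icc hsub)
  have hms := (hm z (hsub hz)).mono hsub
  rcases hz.1.eq_or_lt with rfl | h1
  · exact absurd (hms.nonpos_of_right hxy Ioo_subset_Icc_self
      fun w hw => hmax w (Ioo_subset_Icc_self hw)) (not_le.2 hpos)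
  rcases hz.2.eq_or_lt with rfl | h2
  · exact lt_of_le_of_ne (hms.nonneg_of_left hxy Ioo_subset_Icc_self
      fun w hw => hmax w (Ioo_subset_Icc_self hw)) (hne _ hy).symm
  · exact absurd (hms.eq_zero_of_max ⟨h1, h2⟩ hmax) (hne z (hsub hz))

/-- Nonvanishing derivatives have constant sign. -/
theorem slope_pos_of_pos (hI : M.Induction) (hD : D.OrdConnected) (hd : M.DefOn f D)
    (hm : ∀ x ∈ D, HasSlope f D x (m x)) (hne : ∀ x ∈ D, m x ≠ 0) {x y : Q} (hx : x ∈ D)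
    (hy : y ∈ D) (hpos : 0 < m x) : 0 < m y := by
  rcases lt_trichotomy x y with h | rfl | h
  · exact slope_pos_of_lt hI hD hd hm hne hx hy h hpos
  · exact hpos
  · rcases (hne y hy).lt_or_gt with h' | h'
    · have := slope_pos_of_lt hI hD hd.neg (m := fun x => -m x) (fun x hx => (hm x hx).neg)
        (fun x hx => neg_ne_zero.2 (hne x hx)) hy hx h (neg_pos.2 h')
      linarith
    · exact h'

theorem ordConnected_image (hI : M.Induction) (hD : D.OrdConnected) (hd : M.DefOn f D)
    (hc : ContinuousOn f D) (hmono : StrictMonoOn f D) : (f '' D).OrdConnected := by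
  refine ⟨?_⟩
  rintro _ ⟨x, hx, rfl⟩ _ ⟨y, hy, rfl⟩ z ⟨hz1, hz2⟩
  have hxy : x ≤ y := (hmono.le_iff_le hx hy).1 (hz1.trans hz2)
  have hsub := hD.out hx hy
  obtain ⟨w, hw, hwz⟩ := exists_eq_of_le_of_le hI hxy (hc.mono hsub) (hd.mono_Icc hsub) hz1 hz2
  exact ⟨w, hsub hw, hwz⟩

/-- A strictly increasing bijection of order-connected sets is an order isomorphism, hence a
homeomorphism for the order topologies. -/
theorem continuousOn_invFunOn (hD : D.OrdConnected) (hE : (f '' D).OrdConnected)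
    (hmono : StrictMonoOn f D) : ContinuousOn (Function.invFunOn f D) (f '' D) := by
  rw [continuousOn_iff_continuous_domRestrict]
  have h := (hmono.orderIso f D).symm.continuous
  have h2 := continuous_subtype_val.comp h
  convert h2 using 1
  ext ⟨_, x, hx, rfl⟩
  have : (hmono.orderIso f D).symm ⟨f x, x, hx, rfl⟩ = ⟨x, hx⟩ := by
    rw [OrderIso.symm_apply_eq]; rfl
  simp only [Set.domRestrict_apply, Function.comp_apply, this]
  exact hmono.injOn.leftInvOn_invFunOn hx

theorem _root_.AccRelTheory.HasSlope.invFunOn (hD : D.OrdConnected) (hE : (f '' D).OrdConnected)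
    (hmono : StrictMonoOn f D) {x k : Q} (hx : x ∈ D) (hk : HasSlope f D x k) (hk0 : k ≠ 0) :
    HasSlope (Function.invFunOn f D) (f '' D) (f x) k⁻¹ := by
  have hinv : ∀ y ∈ D, Function.invFunOn f D (f y) = y := hmono.injOn.leftInvOn_invFunOn
  have ht : Tendsto (Function.invFunOn f D) (𝓝[f '' D \ {f x}] (f x)) (𝓝[D \ {x}] x) := by
    refine tendsto_nhdsWithin_iff.2 ⟨?_, ?_⟩
    · have := continuousOn_invFunOn hD hE hmono (f x) ⟨x, hx, rfl⟩
      rw [ContinuousWithinAt, hinv x hx] at this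
      exact this.mono_left (nhdsWithin_mono _ sdiff_subset)
    · filter_upwards [self_mem_nhdsWithin] with y hy
      obtain ⟨⟨z, hz, rfl⟩, hne⟩ := hy
      rw [hinv z hz]
      exact ⟨hz, fun h => hne (by rw [mem_singleton_iff.1 h]; rfl)⟩
  refine ((Tendsto.comp hk ht).inv₀ hk0).congr' ?_
  filter_upwards [self_mem_nhdsWithin] with y hy
  obtain ⟨⟨z, hz, rfl⟩, hne⟩ := hy
  simp only [Function.comp_apply, hinv z hz, hinv x hx, smul_eq_mul, mul_inv_rev, inv_inv]

end Calculus

end Model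

end AccRelTheory

namespace AccRelTheory

open Filter Topology Set

/-! ### Timelike plane curves joined by photons. -/

namespace Model

variable {d : ℕ} {B Q : Type*} [Field Q] [LinearOrder Q] [IsStrictOrderedRing Q]
  [TopologicalSpace Q] [OrderTopology Q]

/-- A definable differentiable curve in the plane, in null coordinates `U`, `V`, which is
future-directed and timelike. -/
structure NullCurve (M : Model d B Q) (D : Set Q) (U V a a' : Q → Q) : Prop where
  ord : D.OrdConnected
  defU : M.DefOn U D
  defV : M.DefOn V D
  slopeU : ∀ t ∈ D, HasSlope U D t (a t)
  slopeV : ∀ t ∈ D, HasSlope V D t (a' t)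
  posU : ∀ t ∈ D, 0 < a t
  posV : ∀ t ∈ D, 0 < a' t

/-- The point with null coordinates `u₁`, `v₁` is on the past light cone of the point with null
coordinates `u`, `v`. -/
def PastNull (u v u₁ v₁ : Q) : Prop := (u = u₁ ∧ v₁ ≤ v) ∨ (v = v₁ ∧ u₁ ≤ u)

variable {M : Model d B Q} {D D₁ : Set Q} {U V a a' U₁ V₁ a₁ a₁' : Q → Q}

namespace NullCurve

theorem swap (h : NullCurve M D U V a a') : NullCurve M D V U a' a :=
  ⟨h.ord, h.defV, h.defU, h.slopeV, h.slopeU, h.posV, h.posU⟩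

/-- The time reversal of a curve. -/
theorem reverse (h : NullCurve M D U V a a') : NullCurve M {y | -1 * y ∈ D}
    (fun y => -U (-1 * y)) (fun y => -V (-1 * y)) (fun y => a (-1 * y)) (fun y => a' (-1 * y)) where
  ord := ⟨fun x hx y hy z hz => h.ord.out hy hx ⟨by linarith [hz.2], by linarith [hz.1]⟩⟩
  defU := (h.defU.comp_mul (-1)).neg
  defV := (h.defV.comp_mul (-1)).neg
  slopeU t ht := by simpa using ((h.slopeU _ ht).comp_mul (by norm_num : (-1 : Q) ≠ 0)).neg
  slopeV t ht := by simpa using ((h.slopeV _ ht).comp_mul (by norm_num : (-1 : Q) ≠ 0)).neg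
  posU t ht := h.posU _ ht
  posV t ht := h.posV _ ht

section

variable (hI : M.Induction) (h : NullCurve M D U V a a')
include hI h

theorem strictMonoU : StrictMonoOn U D :=
  strictMonoOn_of_slope_pos hI h.ord h.defU h.slopeU h.posU

theorem strictMonoV : StrictMonoOn V D := strictMonoU hI h.swap

theorem ordConnected_imageU : (U '' D).OrdConnected :=
  ordConnected_image hI h.ord h.defU (fun t ht => (h.slopeU t ht).continuousWithinAt)
    (strictMonoU hI h)

theorem continuousOn_comp_inv : ContinuousOn (fun u => V (Function.invFunOn U D u)) (U '' D) :=
  ContinuousOn.comp (fun t ht => (h.slopeV t ht).continuousWithinAt)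
    (continuousOn_invFunOn h.ord (ordConnected_imageU hI h) (strictMonoU hI h))
    fun _ hu => Function.invFunOn_mem hu

theorem defOn_inv : M.DefOn (Function.invFunOn U D) (U '' D) :=
  h.defU.invFunOn (strictMonoU hI h).injOn

theorem defOn_comp_inv : M.DefOn (fun u => V (Function.invFunOn U D u)) (U '' D) :=
  (defOn_inv hI h).comp h.defV fun _ hu => Function.invFunOn_mem hu

theorem inv_apply {t : Q} (ht : t ∈ D) : Function.invFunOn U D (U t) = t :=
  (strictMonoU hI h).injOn.leftInvOn_invFunOn ht

theorem slope_inv {u : Q} (hu : u ∈ U '' D) :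
    HasSlope (Function.invFunOn U D) (U '' D) u (a (Function.invFunOn U D u))⁻¹ := by
  obtain ⟨t, ht, rfl⟩ := hu
  rw [inv_apply hI h ht]
  exact (h.slopeU t ht).invFunOn h.ord (ordConnected_imageU hI h) (strictMonoU hI h) ht
    (h.posU t ht).ne'

end

variable (hI : M.Induction) (hb : NullCurve M D U V a a') (hc : NullCurve M D₁ U₁ V₁ a₁ a₁')
include hI hb hc

/-- Photon simultaneity is monotone. -/
theorem le_of_le {t₁ t₂ s₁ s₂ : Q} (ht₁ : t₁ ∈ D) (ht₂ : t₂ ∈ D) (hs₁ : s₁ ∈ D₁) (hs₂ : s₂ ∈ D₁)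
    (h₁ : PastNull (U t₁) (V t₁) (U₁ s₁) (V₁ s₁)) (h₂ : PastNull (U t₂) (V t₂) (U₁ s₂) (V₁ s₂)) :
    t₁ ≤ t₂ ↔ s₁ ≤ s₂ := by
  have hU := (strictMonoU hI hb).le_iff_le ht₁ ht₂
  have hV := (strictMonoV hI hb).le_iff_le ht₁ ht₂
  have hU₁ := (strictMonoU hI hc).le_iff_le hs₁ hs₂
  have hV₁ := (strictMonoV hI hc).le_iff_le hs₁ hs₂
  rcases h₁ with ⟨e₁, l₁⟩ | ⟨e₁, l₁⟩ <;> rcases h₂ with ⟨e₂, l₂⟩ | ⟨e₂, l₂⟩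
  · rw [← hU, ← hU₁, e₁, e₂]
  · constructor
    · intro h; rw [← hV₁, ← e₂]; exact l₁.trans (hV.2 h)
    · intro h; rw [← hU, e₁]; exact (hU₁.2 h).trans l₂
  · constructor
    · intro h; rw [← hU₁, ← e₂]; exact l₁.trans (hU.2 h)
    · intro h; rw [← hV, e₁]; exact (hV₁.2 h).trans l₂
  · rw [← hV, ← hV₁, e₁, e₂]

theorem lt_of_lt {t₁ t₂ s₁ s₂ : Q} (ht₁ : t₁ ∈ D) (ht₂ : t₂ ∈ D) (hs₁ : s₁ ∈ D₁) (hs₂ : s₂ ∈ D₁)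
    (h₁ : PastNull (U t₁) (V t₁) (U₁ s₁) (V₁ s₁)) (h₂ : PastNull (U t₂) (V t₂) (U₁ s₂) (V₁ s₂))
    (h : t₁ < t₂) : s₁ < s₂ := by
  by_contra! h'
  exact absurd ((le_of_le hI hb hc ht₂ ht₁ hs₂ hs₁ h₂ h₁).2 h') (not_le.2 h)

theorem gap_continuousOn {u₁ u₂ : Q} (hE : Icc u₁ u₂ ⊆ U '' D) (hE₁ : Icc u₁ u₂ ⊆ U₁ '' D₁) :
    ContinuousOn (fun u => V (Function.invFunOn U D u) - V₁ (Function.invFunOn U₁ D₁ u))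
      (Icc u₁ u₂) :=
  ((continuousOn_comp_inv hI hb).mono hE).sub ((continuousOn_comp_inv hI hc).mono hE₁)

theorem gap_defOn {u₁ u₂ : Q} (hE : Icc u₁ u₂ ⊆ U '' D) (hE₁ : Icc u₁ u₂ ⊆ U₁ '' D₁) :
    M.DefOn (fun u => V (Function.invFunOn U D u) - V₁ (Function.invFunOn U₁ D₁ u))
      (Icc u₁ u₂) :=
  ((defOn_comp_inv hI hb).mono_Icc hE).sub ((defOn_comp_inv hI hc).mono_Icc hE₁)

/-- Comparison of the elapsed times of curves connected by photons moving in one direction. -/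
theorem sub_lt_sub_of_left
    (hmeet : ∀ t ∈ D, ∀ t' ∈ D, ∀ s ∈ D₁, ∀ s' ∈ D₁, U t = U₁ s → V t = V₁ s → U t' = U₁ s' →
      V t' = V₁ s' → t = t')
    (hleft : ∀ t ∈ D, ∀ s ∈ D₁, U t = U₁ s → V₁ s < V t → a₁ s < a t)
    {t₁ t₂ s₁ s₂ : Q} (ht₁ : t₁ ∈ D) (ht₂ : t₂ ∈ D) (hs₁ : s₁ ∈ D₁) (hs₂ : s₂ ∈ D₁)
    (hU1 : U t₁ = U₁ s₁) (hV1 : V₁ s₁ ≤ V t₁) (hU2 : U t₂ = U₁ s₂) (hV2 : V₁ s₂ ≤ V t₂)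
    (ht : t₁ < t₂) : t₂ - t₁ < s₂ - s₁ := by
  set u₁ := U t₁ with hu₁
  set u₂ := U t₂ with hu₂
  have hu : u₁ < u₂ := strictMonoU hI hb ht₁ ht₂ ht
  have hE : Icc u₁ u₂ ⊆ U '' D := (ordConnected_imageU hI hb).out ⟨_, ht₁, rfl⟩ ⟨_, ht₂, rfl⟩
  have hE₁ : Icc u₁ u₂ ⊆ U₁ '' D₁ :=
    (ordConnected_imageU hI hc).out ⟨_, hs₁, hU1.symm⟩ ⟨_, hs₂, hU2.symm⟩
  set τ := Function.invFunOn U D with hτ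
  set τ₁ := Function.invFunOn U₁ D₁ with hτ₁
  have hτmem : ∀ u ∈ Icc u₁ u₂, τ u ∈ D ∧ U (τ u) = u := fun u hu =>
    ⟨Function.invFunOn_mem (hE hu), Function.invFunOn_eq (hE hu)⟩
  have hτ₁mem : ∀ u ∈ Icc u₁ u₂, τ₁ u ∈ D₁ ∧ U₁ (τ₁ u) = u := fun u hu =>
    ⟨Function.invFunOn_mem (hE₁ hu), Function.invFunOn_eq (hE₁ hu)⟩
  have e1 : τ u₁ = t₁ := inv_apply hI hb ht₁
  have e2 : τ u₂ = t₂ := inv_apply hI hb ht₂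
  have e1' : τ₁ u₁ = s₁ := by rw [hU1]; exact inv_apply hI hc hs₁
  have e2' : τ₁ u₂ = s₂ := by rw [hU2]; exact inv_apply hI hc hs₂
  -- The gap between the curves along the photon of coordinate u; its zeros are the meetings.
  set G : Q → Q := fun u => V (τ u) - V₁ (τ₁ u) with hG
  have hGc : ContinuousOn G (Icc u₁ u₂) := gap_continuousOn hI hb hc hE hE₁
  have hGd : M.DefOn G (Icc u₁ u₂) := gap_defOn hI hb hc hE hE₁
  have hG1 : 0 ≤ G u₁ := by simp only [hG, e1, e1']; linarith
  have hG2 : 0 ≤ G u₂ := by simp only [hG, e2, e2']; linarith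
  have hzero : ∀ u ∈ Icc u₁ u₂, ∀ u' ∈ Icc u₁ u₂, G u = 0 → G u' = 0 → u = u' := by
    intro u hu u' hu' h h'
    obtain ⟨m1, m2⟩ := hτmem u hu
    obtain ⟨m1', m2'⟩ := hτmem u' hu'
    obtain ⟨n1, n2⟩ := hτ₁mem u hu
    obtain ⟨n1', n2'⟩ := hτ₁mem u' hu'
    rw [← m2, ← m2', hmeet _ m1 _ m1' _ n1 _ n1' (m2.trans n2.symm) (sub_eq_zero.1 h)
      (m2'.trans n2'.symm) (sub_eq_zero.1 h')]
  -- A negative gap would force a zero on either side of it, that is, two meetings.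
  have hGnn : ∀ u ∈ Icc u₁ u₂, 0 ≤ G u := by
    intro w hw
    by_contra! hneg
    have sub1 : Icc u₁ w ⊆ Icc u₁ u₂ := Icc_subset_Icc_right hw.2
    have sub2 : Icc w u₂ ⊆ Icc u₁ u₂ := Icc_subset_Icc_left hw.1
    obtain ⟨z, hz, hz0⟩ := exists_eq_of_ge_of_ge (c := 0) hI hw.1 (hGc.mono sub1)
      (hGd.mono_Icc sub1) hG1 hneg.le
    obtain ⟨z', hz', hz0'⟩ := exists_eq_of_le_of_le (c := 0) hI hw.2 (hGc.mono sub2)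
      (hGd.mono_Icc sub2) hneg.le hG2
    have hzz := hzero z (sub1 hz) z' (sub2 hz') hz0 hz0'
    have : z = w := le_antisymm hz.2 (hzz ▸ hz'.1)
    rw [this] at hz0
    linarith
  set H : Q → Q := fun u => τ₁ u - τ u with hH
  -- `H` has derivative 1/a₁ - 1/a, which is positive where the gap is. At a meeting `hleft` says
  -- nothing, so the interval is cut at the zero of `G`, of which there is at most one.
  have hpiece : ∀ x y, u₁ ≤ x → x < y → y ≤ u₂ → (∀ u ∈ Ioo x y, G u ≠ 0) → H x < H y := by
    intro x y hx hxy hy hne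
    have hsub : Icc x y ⊆ Icc u₁ u₂ := Icc_subset_Icc hx hy
    have hslope : ∀ u ∈ Icc x y, HasSlope H (Icc x y) u ((a₁ (τ₁ u))⁻¹ - (a (τ u))⁻¹) :=
      fun u hu => ((slope_inv hI hc (hE₁ (hsub hu))).mono (hsub.trans hE₁)).sub
        ((slope_inv hI hb (hE (hsub hu))).mono (hsub.trans hE))
    obtain ⟨c, hc', h⟩ := exists_slope_mul_eq hI hxy
      (fun u hu => (hslope u hu).continuousWithinAt)
      (((defOn_inv hI hc).mono_Icc (hsub.trans hE₁)).sub
        ((defOn_inv hI hb).mono_Icc (hsub.trans hE)))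
    have hcI := Ioo_subset_Icc_self hc'
    have h1 := h _ (hslope c hcI)
    obtain ⟨m1, m2⟩ := hτmem c (hsub hcI)
    obtain ⟨n1, n2⟩ := hτ₁mem c (hsub hcI)
    have hGpos : 0 < G c := lt_of_le_of_ne (hGnn c (hsub hcI)) (hne c hc').symm
    have hlt := hleft _ m1 _ n1 (m2.trans n2.symm) (sub_pos.1 hGpos)
    have hinv := inv_strictAnti₀ (hc.posU _ n1) hlt
    have := mul_pos (sub_pos.2 hinv) (sub_pos.2 hxy)
    linarith
  have key : H u₁ < H u₂ := by
    by_cases hex : ∃ u ∈ Ioo u₁ u₂, G u = 0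
    · obtain ⟨u, hu, hu0⟩ := hex
      have huI := Ioo_subset_Icc_self hu
      exact (hpiece u₁ u le_rfl hu.1 hu.2.le fun w hw hw0 =>
        hw.2.ne (hzero w ⟨hw.1.le, (hw.2.trans hu.2).le⟩ u huI hw0 hu0)).trans
        (hpiece u u₂ hu.1.le hu.2 le_rfl fun w hw hw0 =>
          hw.1.ne' (hzero w ⟨(hu.1.trans hw.1).le, hw.2.le⟩ u huI hw0 hu0))
    · push Not at hex
      exact hpiece u₁ u₂ le_rfl hu le_rfl hex
  simp only [hH, e1, e2, e1', e2'] at key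
  linarith

/-- Curves that change sides meet in between. -/
theorem exists_meet {t₁ t₂ s₁ s₂ : Q} (ht₁ : t₁ ∈ D) (ht₂ : t₂ ∈ D) (hs₁ : s₁ ∈ D₁)
    (hs₂ : s₂ ∈ D₁) (hU1 : U t₁ = U₁ s₁) (hV1 : V₁ s₁ ≤ V t₁) (hV2 : V t₂ = V₁ s₂)
    (hU2 : U₁ s₂ ≤ U t₂) (ht : t₁ < t₂) :
    ∃ t ∈ Icc t₁ t₂, ∃ s ∈ D₁, U t = U₁ s ∧ V t = V₁ s := by
  have hs : s₁ < s₂ := lt_of_lt hI hb hc ht₁ ht₂ hs₁ hs₂ (Or.inl ⟨hU1, hV1⟩) (Or.inr ⟨hV2, hU2⟩) ht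
  have hw : U t₁ < U₁ s₂ := by rw [hU1]; exact strictMonoU hI hc hs₁ hs₂ hs
  have hE : Icc (U t₁) (U₁ s₂) ⊆ U '' D := (Icc_subset_Icc_right hU2).trans
    ((ordConnected_imageU hI hb).out ⟨_, ht₁, rfl⟩ ⟨_, ht₂, rfl⟩)
  have hE₁ : Icc (U t₁) (U₁ s₂) ⊆ U₁ '' D₁ :=
    (ordConnected_imageU hI hc).out ⟨_, hs₁, hU1.symm⟩ ⟨_, hs₂, rfl⟩
  have hmem := fun u hu => Function.invFunOn_mem (hE hu : u ∈ U '' D)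
  have heq := fun u hu => Function.invFunOn_eq (hE hu : u ∈ U '' D)
  have hr := right_mem_Icc.2 hw.le
  -- The gap is non-negative at `U t₁`. At `U₁ s₂` the first curve has not passed `t₂`, so its V is
  -- at most `V t₂ = V₁ s₂` and the gap is non-positive.
  obtain ⟨u, hu, hu0⟩ := exists_eq_of_ge_of_ge (c := 0) hI hw.le
    (gap_continuousOn hI hb hc hE hE₁) (gap_defOn hI hb hc hE hE₁) (by
      rw [inv_apply hI hb ht₁, hU1, inv_apply hI hc hs₁]; linarith) (by
      have : Function.invFunOn U D (U₁ s₂) ≤ t₂ := by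
        rw [← (strictMonoU hI hb).le_iff_le (hmem _ hr) ht₂, heq _ hr]; exact hU2
      have := ((strictMonoV hI hb).le_iff_le (hmem _ hr) ht₂).2 this
      rw [inv_apply hI hc hs₂]; linarith)
  refine ⟨_, ⟨?_, ?_⟩, _, Function.invFunOn_mem (hE₁ hu), ?_, sub_eq_zero.1 hu0⟩
  · rw [← (strictMonoU hI hb).le_iff_le ht₁ (hmem _ hu), heq _ hu]; exact hu.1
  · rw [← (strictMonoU hI hb).le_iff_le (hmem _ hu) ht₂, heq _ hu]; exact hu.2.trans hU2
  · rw [heq _ hu, Function.invFunOn_eq (hE₁ hu)]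

/-- The curves meet before the photons change direction. At the meeting both null coordinates agree,
so it ends a comparison along U and begins one along V; one of the two may be degenerate. -/
theorem sub_lt_sub_of_left_right
    (hmeet : ∀ t ∈ D, ∀ t' ∈ D, ∀ s ∈ D₁, ∀ s' ∈ D₁, U t = U₁ s → V t = V₁ s → U t' = U₁ s' →
      V t' = V₁ s' → t = t')
    (hleft : ∀ t ∈ D, ∀ s ∈ D₁, U t = U₁ s → V₁ s < V t → a₁ s < a t)
    (hright : ∀ t ∈ D, ∀ s ∈ D₁, V t = V₁ s → U₁ s < U t → a₁' s < a' t)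
    {t₁ t₂ s₁ s₂ : Q} (ht₁ : t₁ ∈ D) (ht₂ : t₂ ∈ D) (hs₁ : s₁ ∈ D₁) (hs₂ : s₂ ∈ D₁)
    (hU1 : U t₁ = U₁ s₁) (hV1 : V₁ s₁ ≤ V t₁) (hV2 : V t₂ = V₁ s₂) (hU2 : U₁ s₂ ≤ U t₂)
    (ht : t₁ < t₂) : t₂ - t₁ < s₂ - s₁ := by
  obtain ⟨t, htI, s, hs, hUs, hVs⟩ :=
    exists_meet hI hb hc ht₁ ht₂ hs₁ hs₂ hU1 hV1 hV2 hU2 ht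
  have htD := hb.ord.out ht₁ ht₂ htI
  have hmeet' : ∀ t ∈ D, ∀ t' ∈ D, ∀ s ∈ D₁, ∀ s' ∈ D₁, V t = V₁ s → U t = U₁ s → V t' = V₁ s' →
      U t' = U₁ s' → t = t' := fun t ht t' ht' s hs s' hs' h1 h2 h3 h4 =>
    hmeet t ht t' ht' s hs s' hs' h2 h1 h4 h3
  have hl : t₁ < t → t - t₁ < s - s₁ := sub_lt_sub_of_left hI hb hc hmeet hleft ht₁ htD hs₁ hs
    hU1 hV1 hUs hVs.ge
  have hr : t < t₂ → t₂ - t < s₂ - s := sub_lt_sub_of_left hI hb.swap hc.swap hmeet' hright htD ht₂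
    hs hs₂ hVs hUs.ge hV2 hU2
  rcases htI.1.eq_or_lt with h1 | h1
  · subst h1
    have : s = s₁ := (strictMonoU hI hc).injOn hs hs₁ (hUs.symm.trans hU1)
    rw [← this]; exact hr ht
  · rcases htI.2.eq_or_lt with h2 | h2
    · subst h2
      have : s = s₂ := (strictMonoV hI hc).injOn hs hs₂ (hVs.symm.trans hV2)
      rw [← this]; exact hl h1
    · linarith [hl h1, hr h2]

/-- If one of two curves always recedes less from the other one's light cone, more time elapses on
it between photon simultaneous events. -/
theorem sub_lt_sub
    (hmeet : ∀ t ∈ D, ∀ t' ∈ D, ∀ s ∈ D₁, ∀ s' ∈ D₁, U t = U₁ s → V t = V₁ s → U t' = U₁ s' →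
      V t' = V₁ s' → t = t')
    (hleft : ∀ t ∈ D, ∀ s ∈ D₁, U t = U₁ s → V₁ s < V t → a₁ s < a t)
    (hright : ∀ t ∈ D, ∀ s ∈ D₁, V t = V₁ s → U₁ s < U t → a₁' s < a' t)
    {t₁ t₂ s₁ s₂ : Q} (ht₁ : t₁ ∈ D) (ht₂ : t₂ ∈ D) (hs₁ : s₁ ∈ D₁) (hs₂ : s₂ ∈ D₁)
    (h₁ : PastNull (U t₁) (V t₁) (U₁ s₁) (V₁ s₁)) (h₂ : PastNull (U t₂) (V t₂) (U₁ s₂) (V₁ s₂))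
    (ht : t₁ < t₂) : t₂ - t₁ < s₂ - s₁ := by
  have hmeet' : ∀ t ∈ D, ∀ t' ∈ D, ∀ s ∈ D₁, ∀ s' ∈ D₁, V t = V₁ s → U t = U₁ s → V t' = V₁ s' →
      U t' = U₁ s' → t = t' := fun t ht t' ht' s hs s' hs' h1 h2 h3 h4 =>
    hmeet t ht t' ht' s hs s' hs' h2 h1 h4 h3
  rcases h₁ with ⟨e₁, l₁⟩ | ⟨e₁, l₁⟩ <;> rcases h₂ with ⟨e₂, l₂⟩ | ⟨e₂, l₂⟩
  · exact sub_lt_sub_of_left hI hb hc hmeet hleft ht₁ ht₂ hs₁ hs₂ e₁ l₁ e₂ l₂ ht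
  · exact sub_lt_sub_of_left_right hI hb hc hmeet hleft hright ht₁ ht₂ hs₁ hs₂ e₁ l₁ e₂ l₂ ht
  · exact sub_lt_sub_of_left_right hI hb.swap hc.swap hmeet' hright hleft ht₁ ht₂ hs₁ hs₂ e₁ l₁
      e₂ l₂ ht
  · exact sub_lt_sub_of_left hI hb.swap hc.swap hmeet' hright ht₁ ht₂ hs₁ hs₂ e₁ l₁ e₂ l₂ ht

/-- The time-reversed form of the comparison. -/
theorem sub_lt_sub'
    (hmeet : ∀ t ∈ D, ∀ t' ∈ D, ∀ s ∈ D₁, ∀ s' ∈ D₁, U t = U₁ s → V t = V₁ s → U t' = U₁ s' →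
      V t' = V₁ s' → t = t')
    (hleft : ∀ t ∈ D, ∀ s ∈ D₁, U t = U₁ s → V₁ s < V t → a t < a₁ s)
    (hright : ∀ t ∈ D, ∀ s ∈ D₁, V t = V₁ s → U₁ s < U t → a' t < a₁' s)
    {t₁ t₂ s₁ s₂ : Q} (ht₁ : t₁ ∈ D) (ht₂ : t₂ ∈ D) (hs₁ : s₁ ∈ D₁) (hs₂ : s₂ ∈ D₁)
    (h₁ : PastNull (U t₁) (V t₁) (U₁ s₁) (V₁ s₁)) (h₂ : PastNull (U t₂) (V t₂) (U₁ s₂) (V₁ s₂))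
    (ht : t₁ < t₂) : s₂ - s₁ < t₂ - t₁ := by
  have hneg : ∀ x : Q, -1 * -x = x := fun x => by ring
  have hP : ∀ {t s : Q}, PastNull (U t) (V t) (U₁ s) (V₁ s) →
      PastNull (-U₁ (-1 * -s)) (-V₁ (-1 * -s)) (-U (-1 * -t)) (-V (-1 * -t)) := by
    intro t s h
    rw [hneg, hneg]
    rcases h with ⟨h, h'⟩ | ⟨h, h'⟩
    · exact Or.inl ⟨by rw [h], neg_le_neg h'⟩
    · exact Or.inr ⟨by rw [h], neg_le_neg h'⟩
  have hs := lt_of_lt hI hb hc ht₁ ht₂ hs₁ hs₂ h₁ h₂ ht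
  -- Time reversal turns past light cones into future ones, so the two curves also exchange their
  -- roles.
  have := sub_lt_sub hI hc.reverse hb.reverse (t₁ := -s₂) (t₂ := -s₁) (s₁ := -t₂) (s₂ := -t₁)
    (fun s hs s' hs' t ht t' ht' e1 e2 e3 e4 => by
      have e := hmeet _ ht _ ht' _ hs _ hs' (neg_inj.1 e1).symm (neg_inj.1 e2).symm
        (neg_inj.1 e3).symm (neg_inj.1 e4).symm
      have e5 : U₁ (-1 * s) = U₁ (-1 * s') := by rw [neg_inj.1 e1, neg_inj.1 e3, e]
      have := (strictMonoU hI hc).injOn hs hs' e5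
      linarith)
    (fun s hs t ht e1 e2 => hleft _ ht _ hs (neg_inj.1 e1).symm (neg_lt_neg_iff.1 e2))
    (fun s hs t ht e1 e2 => hright _ ht _ hs (neg_inj.1 e1).symm (neg_lt_neg_iff.1 e2))
    (by simpa using hs₂) (by simpa using hs₁) (by simpa using ht₂) (by simpa using ht₁)
    (hP h₂) (hP h₁) (neg_lt_neg hs)
  linarith

end NullCurve

end Model

end AccRelTheory

namespace AccRelTheory

open Filter Topology Set

/-! ### Null coordinates in a vertical plane. -/

section VerticalPlane

variable {d : ℕ} [NeZero d] {Q : Type*} [Field Q] [LinearOrder Q] [IsStrictOrderedRing Q]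

theorem mink_self_nonpos {x : Fin d → Q} (h : x 0 = 0) : mink x x ≤ 0 := by
  rw [mink, h]
  have : 0 ≤ x ⬝ᵥ x := Finset.sum_nonneg fun i _ => mul_self_nonneg (x i)
  linarith

/-- A plane parallel to the time axis is spanned by the time axis and a spacelike unit vector. -/
theorem exists_unit_of_isVerticalPlane (hsq : ∀ x : Q, 0 < x → ∃ y : Q, y * y = x)
    {P : AffineSubspace Q (Fin d → Q)} (hP : IsVerticalPlane P) :
    ∃ n : Fin d → Q, n 0 = 0 ∧ mink n n = -1 ∧
      ∀ x ∈ P.direction, x = Pi.single 0 (x 0) - mink x n • n := by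
  obtain ⟨-, hfr, h0⟩ := hP
  obtain ⟨w, hw, hwn⟩ : ∃ w ∈ P.direction, w - Pi.single 0 (w 0) ≠ 0 := by
    by_contra! h
    have hle : P.direction ≤ Submodule.span Q {(Pi.single 0 1 : Fin d → Q)} := fun w hw => by
      rw [Submodule.mem_span_singleton]
      refine ⟨w 0, ?_⟩
      rw [← Pi.single_smul', smul_eq_mul, mul_one]
      exact (sub_eq_zero.1 (h w hw)).symm
    have h1 := Submodule.finrank_mono hle
    have h2 := finrank_span_singleton (K := Q) (v := (Pi.single 0 1 : Fin d → Q)) (by simp)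
    omega
  set w' := w - Pi.single 0 (w 0) with hw'
  have hw'0 : w' 0 = 0 := by simp [hw']
  have hw'P : w' ∈ P.direction := by
    refine P.direction.sub_mem hw ?_
    have := P.direction.smul_mem (w 0) h0
    rwa [← Pi.single_smul', smul_eq_mul, mul_one] at this
  have hneg : 0 < -mink w' w' := by
    refine neg_pos.2 (lt_of_le_of_ne (mink_self_nonpos hw'0) fun h => ?_)
    exact hwn (eq_zero_of_null_of_time_eq_zero h hw'0)
  obtain ⟨r, hr⟩ := hsq _ hneg
  have hr0 : r ≠ 0 := by rintro rfl; rw [mul_zero] at hr; exact hneg.ne hr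
  have hn0 : (r⁻¹ • w') 0 = 0 := by simp [hw'0]
  have hnn : mink (r⁻¹ • w') (r⁻¹ • w') = -1 := by
    rw [mink_smul_left, mink_smul_right, show mink w' w' = -(r * r) by rw [hr, neg_neg]]
    field_simp
  refine ⟨r⁻¹ • w', hn0, hnn, fun x hx => ?_⟩
  have hli : LinearIndependent Q ![(Pi.single 0 1 : Fin d → Q), r⁻¹ • w'] := by
    rw [LinearIndependent.pair_iff]
    intro s t hst
    have e := congrFun hst 0
    rw [Pi.add_apply, Pi.smul_apply, Pi.smul_apply, hn0, Pi.single_eq_same] at e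
    have hs : s = 0 := by simpa using e
    refine ⟨hs, ?_⟩
    rw [hs, zero_smul, zero_add] at hst
    refine (smul_eq_zero.1 hst).resolve_right fun h => ?_
    rw [h, mink_zero_left] at hnn
    norm_num at hnn
  have hspan : Submodule.span Q (Set.range ![(Pi.single 0 1 : Fin d → Q), r⁻¹ • w']) =
      P.direction := by
    refine Submodule.eq_of_le_of_finrank_eq ?_ ?_
    · rw [Submodule.span_le]
      rintro _ ⟨i, rfl⟩
      fin_cases i
      · exact h0
      · exact P.direction.smul_mem _ hw'P
    · rw [finrank_span_eq_card hli, hfr]; rfl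
  rw [← hspan, Matrix.range_cons, Matrix.range_cons, Matrix.range_empty, Set.union_empty,
    Set.singleton_union, Submodule.mem_span_pair] at hx
  obtain ⟨s, t, rfl⟩ := hx
  generalize r⁻¹ • w' = n at hn0 hnn
  have e1 : mink (s • (Pi.single 0 1 : Fin d → Q) + t • n) n = -t := by
    rw [mink_add_left, mink_smul_left, mink_smul_left, hnn, mink_comm, mink_single_zero_right, hn0]
    ring
  have e2 : (s • (Pi.single 0 1 : Fin d → Q) + t • n) 0 = s := by simp [hn0]
  rw [e1, e2, ← Pi.single_smul', smul_eq_mul, mul_one]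
  simp

/-- The null coordinate `σ (x₀ ∓ n · x)`. -/
def nullCoord (n : Fin d → Q) (σ τ : Q) : (Fin d → Q) →ₗ[Q] Q where
  toFun x := σ * (x 0 + τ * mink x n)
  map_add' x y := by rw [mink_add_left, Pi.add_apply]; ring
  map_smul' c x := by
    rw [mink_smul_left, Pi.smul_apply, smul_eq_mul, RingHom.id_apply, smul_eq_mul]; ring

theorem nullCoord_apply (n : Fin d → Q) (σ τ : Q) (x : Fin d → Q) :
    nullCoord n σ τ x = σ * (x 0 + τ * mink x n) := rfl

variable {n : Fin d → Q} {σ : Q}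

/-- The polarized form of t² - r² = (t - r)(t + r). Only `x` has to be parallel to the plane, since
the part of `y` orthogonal to the plane does not contribute. -/
theorem mink_eq_nullCoord (hσ : σ * σ = 1) {x : Fin d → Q}
    (hx : x = Pi.single 0 (x 0) - mink x n • n) (y : Fin d → Q) :
    2 * mink x y = nullCoord n σ 1 x * nullCoord n σ (-1) y +
      nullCoord n σ (-1) x * nullCoord n σ 1 y := by
  have h : mink x y = x 0 * y 0 - mink x n * mink y n := by
    conv_lhs => rw [hx]
    rw [mink_sub_left, mink_smul_left, mink_comm, mink_single_zero_right, mink_comm n y]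
  rw [h]
  simp only [nullCoord_apply]
  linear_combination -2 * (x 0 * y 0 - mink x n * mink y n) * hσ

theorem nullCoord_mul_nullCoord (hσ : σ * σ = 1) {x : Fin d → Q}
    (hx : x = Pi.single 0 (x 0) - mink x n • n) :
    nullCoord n σ 1 x * nullCoord n σ (-1) x = mink x x := by
  linear_combination (-1 / 2) * mink_eq_nullCoord hσ hx x

/-- The difference of the two sides is minus the square of the component orthogonal to the plane,
which has no time part. This controls tangents before they are known to be parallel to the plane. -/
theorem mink_le_nullCoord_mul_nullCoord (hσ : σ * σ = 1) (hn0 : n 0 = 0) (hnn : mink n n = -1)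
    (x : Fin d → Q) : mink x x ≤ nullCoord n σ 1 x * nullCoord n σ (-1) x := by
  have h := mink_self_nonpos (x := x - Pi.single 0 (x 0) + mink x n • n) (by simp [hn0])
  simp only [mink_add_left, mink_add_right, mink_sub_left, mink_sub_right, mink_smul_left,
    mink_smul_right, mink_single_zero_right, mink_comm (Pi.single 0 (x 0)), hnn, hn0,
    Pi.add_apply, Pi.sub_apply, Pi.smul_apply, smul_eq_mul, Pi.single_eq_same, mink_comm n x] at h
  simp only [nullCoord_apply]
  have e : σ * (x 0 + 1 * mink x n) * (σ * (x 0 + -1 * mink x n)) =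
      x 0 * x 0 - mink x n * mink x n := by
    linear_combination (x 0 * x 0 - mink x n * mink x n) * hσ
  rw [e]
  linarith

theorem eq_zero_of_nullCoord (hσ : σ * σ = 1) {x : Fin d → Q}
    (hx : x = Pi.single 0 (x 0) - mink x n • n) (hU : nullCoord n σ 1 x = 0)
    (hV : nullCoord n σ (-1) x = 0) : x = 0 := by
  rw [nullCoord_apply] at hU hV
  have h1 : x 0 = 0 := by linear_combination (σ / 2) * hU + (σ / 2) * hV - x 0 * hσ
  have h2 : mink x n = 0 := by
    linear_combination (σ / 2) * hU - (σ / 2) * hV - mink x n * hσ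
  rw [hx, h1, h2]
  simp

end VerticalPlane

/-! ### World-lines of observers and their tangents. -/

namespace Model

variable {d : ℕ} [NeZero d] {B Q : Type*} [Field Q] [LinearOrder Q] [IsStrictOrderedRing Q]

/-- The instants at which `b` is present in his own world-view. -/
def life (M : Model d B Q) (b : B) : Set Q := {t | b ∈ M.ev b (Pi.single 0 t)}

variable {M : Model d B Q}

theorem eq_single_of_spaceOf_eq_zero {p : Fin d → Q} (h : spaceOf p = 0) :
    p = Pi.single 0 (p 0) := by
  ext i
  by_cases hi : i = 0
  · subst hi; simp
  · rw [Pi.single_eq_of_ne hi]; exact congrFun h ⟨i, hi⟩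

theorem SpecRel.eq_single (hM : M.SpecRel) {b : B} (hb : b ∈ M.Ob) {p : Fin d → Q}
    (h : b ∈ M.ev b p) : p = Pi.single 0 (p 0) :=
  eq_single_of_spaceOf_eq_zero ((hM.axSelfMinus b hb p ⟨b, h⟩).1 h)

theorem SpecRel.timeOf_image (hM : M.SpecRel) {b : B} (hb : b ∈ M.Ob) :
    timeOf '' {p | b ∈ M.ev b p} = M.life b := by
  ext t
  constructor
  · rintro ⟨p, hp, rfl⟩
    have := hM.eq_single hb hp
    rw [mem_ofPred_eq, this] at hp
    exact hp
  · intro ht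
    exact ⟨_, ht, by simp [timeOf]⟩

theorem AccRel.life_ordConnected (hM : M.AccRel) {b : B} (hb : b ∈ M.Ob) :
    (M.life b).OrdConnected := by
  refine ⟨fun x hx y hy z hz => ?_⟩
  rcases hz.1.eq_or_lt with rfl | h1
  · exact hx
  rcases hz.2.eq_or_lt with rfl | h2
  · exact hy
  rw [← hM.timeOf_image hb] at hx hy ⊢
  exact hM.axSelfPlus b hb x hx y hy z h1 h2

theorem AccRel.exists_life (hM : M.AccRel) {b : B} (hb : b ∈ M.Ob) {e : Set B} (he : e ∈ M.Ev)
    (hbe : b ∈ e) : ∃ t ∈ M.life b, M.ev b (Pi.single 0 t) = e := by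
  obtain ⟨p, hp, rfl⟩ := hM.axEvTr b hb e he hbe
  have := hM.eq_single hb hbe
  refine ⟨p 0, ?_, by rw [← this]⟩
  rw [life, mem_ofPred_eq, ← this]
  exact hbe

theorem ev_mem_EvOf {b : B} {t : Q} (ht : t ∈ M.life b) :
    M.ev b (Pi.single 0 t) ∈ M.EvOf b := ⟨_, ⟨b, ht⟩, rfl⟩

theorem ev_mem_Ev {b : B} (hb : b ∈ M.Ob) {t : Q} (ht : t ∈ M.life b) :
    M.ev b (Pi.single 0 t) ∈ M.Ev := ⟨b, hb, ev_mem_EvOf ht⟩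

theorem SpecRel.elen_single (hM : M.SpecRel) (t : Q) :
    elen (Pi.single 0 t : Fin d → Q) = |t| := by
  obtain ⟨h0, h1⟩ := elen_nonneg_and_sq hM.axEOF (Pi.single 0 t : Fin d → Q)
  rw [← mul_self_inj h0 (abs_nonneg t), h1, abs_mul_abs_self]
  rw [Finset.sum_eq_single 0 (fun i _ hi => by simp [hi]) (by simp)]
  simp [pow_two]

/-- The co-moving condition restricted to the observer's own time axis. The existence and uniqueness
of the coordinates written in that condition are kept as conclusions. -/
theorem SpecRel.comoving_bound (hM : M.SpecRel) {b k : B} {t : Q} (ht : t ∈ M.life b)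
    (hk : M.CoMoving k b (M.ev b (Pi.single 0 t))) {ε : Q} (hε : 0 < ε) :
    ∃ δ, 0 < δ ∧ ∀ y ∈ M.life b, |y - t| < δ → ∃ p, M.IsCrd k (M.ev b (Pi.single 0 y)) p ∧
      M.IsCrd b (M.ev b (Pi.single 0 t)) (Pi.single 0 t) ∧
      elen (Pi.single 0 y - p) ≤ ε * |y - t| := by
  obtain ⟨δ, hδ, h⟩ := hk ε hε
  refine ⟨δ, hδ, fun y hy hyt => ?_⟩
  have hlen : elen (Pi.single 0 y - Pi.single 0 t : Fin d → Q) = |y - t| := by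
    rw [← Pi.single_sub, hM.elen_single]
  obtain ⟨p, r, hp, hr, hpr⟩ := h (Pi.single 0 y) ⟨⟨b, hy⟩, Pi.single 0 t, ⟨b, ht⟩, rfl, by
    rwa [hlen]⟩
  obtain rfl := hr.2.2 _ ⟨b, ht⟩ rfl
  exact ⟨p, hp, hr, by rwa [hlen] at hpr⟩

/-- Uniqueness of the observer's own coordinates is part of the co-moving condition that `axAcc`
provides. -/
theorem AccRel.isCrd_single (hM : M.AccRel) {b : B} (hb : b ∈ M.Ob) {t : Q} (ht : t ∈ M.life b) :
    M.IsCrd b (M.ev b (Pi.single 0 t)) (Pi.single 0 t) := by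
  obtain ⟨k, -, hk⟩ := hM.axAcc b hb _ (ev_mem_EvOf ht) ht
  obtain ⟨δ, hδ, h⟩ := hM.comoving_bound ht hk one_pos
  obtain ⟨p, -, h, -⟩ := h t ht (by simpa using hδ)
  exact h

/-- A co-moving inertial observer coordinatizes the event, and all inertial observers share their
events. -/
theorem AccRel.exists_ev_eq (hM : M.AccRel) {m b : B} (hm : m ∈ M.IOb) (hb : b ∈ M.Ob) {t : Q}
    (ht : t ∈ M.life b) : ∃ p, M.ev m p = M.ev b (Pi.single 0 t) := by
  obtain ⟨k, hkI, hk⟩ := hM.axAcc b hb _ (ev_mem_EvOf ht) ht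
  obtain ⟨δ, hδ, h⟩ := hM.comoving_bound ht hk one_pos
  obtain ⟨p, hp, -⟩ := h t ht (by simpa using hδ)
  have : M.ev b (Pi.single 0 t) ∈ M.EvOf m := by
    rw [hM.axEv m hm k hkI]; exact ⟨p, hp.1, hp.2.1⟩
  obtain ⟨q, -, hq⟩ := this
  exact ⟨q, hq⟩

/-- The world-line of `b` according to the inertial observer `m`, parametrized by the time of
`b`. -/
def IsWorldline (M : Model d B Q) (m b : B) (β : Q → Fin d → Q) : Prop :=
  ∀ t ∈ M.life b, M.ev m (β t) = M.ev b (Pi.single 0 t)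

theorem AccRel.exists_isWorldline (hM : M.AccRel) {m b : B} (hm : m ∈ M.IOb) (hb : b ∈ M.Ob) :
    ∃ β, M.IsWorldline m b β := by
  have : ∀ t, ∃ p, t ∈ M.life b → M.ev m p = M.ev b (Pi.single 0 t) := fun t => by
    by_cases ht : t ∈ M.life b
    · obtain ⟨p, hp⟩ := hM.exists_ev_eq hm hb ht
      exact ⟨p, fun _ => hp⟩
    · exact ⟨0, fun h => absurd h ht⟩
  choose β hβ using this
  exact ⟨β, hβ⟩

/-- Linear coordinates of a world-line are definable. -/
theorem IsWorldline.defOn (hM : M.SpecRel) (hd : 3 ≤ d) {m b : B} (hm : m ∈ M.IOb)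
    {β : Q → Fin d → Q} (hβ : M.IsWorldline m b β) (ℓ : (Fin d → Q) →ₗ[Q] Q) :
    M.DefOn (fun t => ℓ (β t)) (M.life b) := by
  have haxis : ∀ i : Fin d, M.DefFun (fun q : Fin 2 ⊕ Fin d → Q =>
      (Pi.single 0 (q (Sum.inl 0)) : Fin d → Q) i) := fun i => by
    by_cases hi : i = 0
    · subst hi; simpa using defFun_var (Sum.inl 0)
    · simpa [hi] using defFun_const 0
  have h1 : M.Def (fun q : Fin 2 ⊕ Fin d → Q => M.W b b (Pi.single 0 (q (Sum.inl 0)))) :=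
    (def_W b b).subst haxis
  have h2 : M.Def (fun q : Fin 2 ⊕ Fin d → Q =>
      M.ev b (Pi.single 0 (q (Sum.inl 0))) = M.ev m (fun i => q (Sum.inr i))) :=
    (def_ev_eq b m).subst (f := Sum.elim
      (fun i => fun q : Fin 2 ⊕ Fin d → Q => (Pi.single 0 (q (Sum.inl 0)) : Fin d → Q) i)
      (fun i q => q (Sum.inr i))) (by
        rintro (i | i)
        · exact haxis i
        · exact defFun_var _)
  have h3 : M.Def (fun q : Fin 2 ⊕ Fin d → Q => q (Sum.inl 1) =
      ∑ i, q (Sum.inr i) * ℓ (fun j => if i = j then 1 else 0)) :=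
    Def.eq (defFun_var _) (DefFun.sum _ fun i => (defFun_var _).mul (defFun_const _))
  have := Def.exs (P := fun (q : Fin 2 → Q) (p : Fin d → Q) => M.W b b (Pi.single 0 (q 0)) ∧
    M.ev b (Pi.single 0 (q 0)) = M.ev m p ∧
      q 1 = ∑ i, p i * ℓ (fun j => if i = j then 1 else 0)) (h1.and (h2.and h3))
  refine this.congr fun q => ?_
  have hℓ : ∀ p, ∑ i, p i * ℓ (fun j => if i = j then 1 else 0) = ℓ p := fun p => by
    rw [LinearMap.pi_apply_eq_sum_univ ℓ p]; rfl
  simp only [hℓ]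
  constructor
  · rintro ⟨ht, h⟩
    exact ⟨β (q 0), ht, (hβ _ ht).symm, h⟩
  · rintro ⟨p, ht, h, h'⟩
    refine ⟨ht, ?_⟩
    rw [h', hM.ev_injective hd hm ((hβ _ ht).trans h)]

variable [TopologicalSpace Q] [OrderTopology Q]

/-- The world-line of `b` is tangent to the world-lines of his co-moving inertial observers. -/
theorem IsWorldline.slope (hM : M.AccRel) (hd : 3 ≤ d) {m b k : B} (hm : m ∈ M.IOb)
    (hk : k ∈ M.IOb) (hb : b ∈ M.Ob) {β : Q → Fin d → Q} (hβ : M.IsWorldline m b β) {t : Q}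
    (ht : t ∈ M.life b) (hco : M.CoMoving k b (M.ev b (Pi.single 0 t)))
    {L : (Fin d → Q) →ₗ[Q] (Fin d → Q)} {a : Fin d → Q}
    (hL : ∀ p, M.ev k p = M.ev m (L p + a)) :
    β t = L (Pi.single 0 t) + a ∧ HasSlope β (M.life b) t (L (Pi.single 0 1)) := by
  -- In the coordinates of `k` the co-moving bound makes the world-line tangent to the time axis;
  -- the Poincaré transformation carries this to `m`.
  obtain ⟨α, hα⟩ := hM.exists_isWorldline hk hb
  have hβα : ∀ y ∈ M.life b, β y = L (α y) + a := fun y hy =>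
    hM.ev_injective hd hm (by rw [hβ y hy, ← hL, hα y hy])
  have hbound : ∀ ε : Q, 0 < ε → ∃ δ, 0 < δ ∧ ∀ y ∈ M.life b, |y - t| < δ → ∀ i,
      |(Pi.single 0 y : Fin d → Q) i - α y i| ≤ ε * |y - t| := by
    intro ε hε
    obtain ⟨δ, hδ, h⟩ := hM.comoving_bound ht hco hε
    refine ⟨δ, hδ, fun y hy hyt i => ?_⟩
    obtain ⟨p, hp, -, hle⟩ := h y hy hyt
    obtain rfl : α y = p := hM.ev_injective hd hk ((hα y hy).trans hp.2.1.symm)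
    exact (abs_le_elen hM.axEOF _ i).trans hle
  have hαt : α t = Pi.single 0 t := by
    obtain ⟨δ, hδ, h⟩ := hbound 1 one_pos
    ext i
    have := h t ht (by simpa using hδ) i
    rw [sub_self, abs_zero, mul_zero] at this
    exact (sub_eq_zero.1 (abs_nonpos_iff.1 this)).symm
  refine ⟨by rw [hβα t ht, hαt], ?_⟩
  have hsα : HasSlope α (M.life b) t (Pi.single 0 1) := by
    refine tendsto_pi_nhds.2 fun i => ?_
    refine LinearOrderedAddCommGroup.tendsto_nhds.2 fun ε hε => ?_
    obtain ⟨δ, hδ, h⟩ := hbound (ε / 2) (half_pos hε)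
    have hev : ∀ᶠ y in 𝓝[M.life b \ {t}] t, |y - t| < δ :=
      nhdsWithin_le_nhds (eventually_abs_sub_lt t hδ)
    filter_upwards [hev, self_mem_nhdsWithin] with y hy hyD
    have hne : y - t ≠ 0 := sub_ne_zero.2 hyD.2
    have e : ((y - t)⁻¹ • (α y - α t)) i - (Pi.single 0 1 : Fin d → Q) i =
        -((y - t)⁻¹ * ((Pi.single 0 y : Fin d → Q) i - α y i)) := by
      rw [hαt]
      simp only [Pi.smul_apply, Pi.sub_apply, smul_eq_mul]
      by_cases hi : i = 0
      · subst hi; simp only [Pi.single_eq_same]; field_simp; ring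
      · simp only [Pi.single_eq_of_ne hi]; ring
    rw [e, abs_neg, abs_mul, abs_inv]
    have h1 := h y hyD.1 hy i
    have h2 : 0 < |y - t| := abs_pos.2 hne
    calc |y - t|⁻¹ * |(Pi.single 0 y : Fin d → Q) i - α y i|
        ≤ |y - t|⁻¹ * (ε / 2 * |y - t|) := mul_le_mul_of_nonneg_left h1 (inv_nonneg.2 h2.le)
      _ = ε / 2 := by field_simp
      _ < ε := half_lt_self hε
  have hs := hsα.map L (LinearMap.continuous_on_pi L)
  refine Tendsto.congr' ?_ hs
  filter_upwards [self_mem_nhdsWithin] with y hy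
  rw [hβα y hy.1, hβα t ht, add_sub_add_right_eq_sub]

end Model

end AccRelTheory

/-! ### Doppler shift and the comparison of clocks. -/

namespace AccRelTheory

open Filter Topology Set

/-- Whether world-lines that are connected by a photon approach each other decides the sign of the
Doppler shift. -/
theorem doppler {Q : Type*} [Field Q] [LinearOrder Q] [IsStrictOrderedRing Q]
    {a a' g g' l k Δ : Q} (ha : 0 < a) (hg : 0 < g) (haa : a * a' = 1) (hgg : g * g' = 1)
    (h₁ : l * a = k * g) (h₂ : Δ + l * a' = k * g') (hΔ : 0 < Δ) :
    (0 ≤ l → g < a) ∧ (l ≤ 0 → a < g) := by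
  have hg' : 0 < g' := pos_of_mul_pos_right (by rw [hgg]; exact one_pos) hg.le
  have ha' : 0 < a' := pos_of_mul_pos_right (by rw [haa]; exact one_pos) ha.le
  -- Eliminating `k` from the two equations of the crossing point shows that `l` and `a - g` have
  -- the same sign.
  have key : Δ * g * g = l * a' * (a * a - g * g) := by
    have e : k = l * a * g' := by linear_combination (-k) * hgg - g' * h₁
    have e2 : Δ = l * a * g' * g' - l * a' := by rw [← e]; linear_combination h₂
    rw [e2]
    linear_combination (l * a * (g * g' + 1)) * hgg - l * a * haa
  have hpos : 0 < Δ * g * g := by positivity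
  rw [key] at hpos
  constructor
  · intro hl
    by_contra! h
    have : a * a ≤ g * g := mul_self_le_mul_self ha.le h
    exact absurd hpos (not_lt.2 (mul_nonpos_of_nonneg_of_nonpos (mul_nonneg hl ha'.le)
      (by linarith)))
  · intro hl
    by_contra! h
    have : g * g ≤ a * a := mul_self_le_mul_self hg.le h
    exact absurd hpos (not_lt.2 (mul_nonpos_of_nonpos_of_nonneg
      (mul_nonpos_of_nonpos_of_nonneg hl ha'.le) (by linarith)))

namespace Model

variable {d : ℕ} [NeZero d] {B Q : Type*} [Field Q] [LinearOrder Q] [IsStrictOrderedRing Q]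
  {M : Model d B Q}

theorem AccRel.induction (hM : M.AccRel) : M.Induction := hM.ind

theorem SpecRel.exists_crd (hM : M.SpecRel) (hd : 3 ≤ d) {m k : B} (hm : m ∈ M.IOb)
    (hk : k ∈ M.IOb) (p : Fin d → Q) : ∃ p', M.IsCrd k (M.ev m p) p' := by
  have : M.ev m p ∈ M.EvOf k := by
    rw [hM.axEv k hk m hm]; exact ⟨p, hM.mem_Cd hm p, rfl⟩
  obtain ⟨p', -, hp'⟩ := this
  exact ⟨p', (hM.isCrd_iff hd hk _ _).2 hp'⟩

variable [TopologicalSpace Q] [OrderTopology Q]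

/-- The vector `z` is the direction, in the coordinates of `m`, of the time axis of `k` and the
tangent at `t` of the world-line `β` of `b`. -/
structure IsTangent (M : Model d B Q) (m k b : B) (β : Q → Fin d → Q) (t : Q) (z : Fin d → Q) :
    Prop where
  unit : mink z z = 1
  slope : HasSlope β (M.life b) t z
  line : ∀ q, k ∈ M.ev m q → ∃ l : Q, q = β t + l • z
  time : ∀ p q, (∃ p' q', M.IsCrd k (M.ev m p) p' ∧ M.IsCrd k (M.ev m q) q' ∧
    timeOf p' ≤ timeOf q') ↔ 0 ≤ mink (q - p) z

/-- The vector is the image of the time unit vector under the Poincaré transformation from `k` to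
`m`. By isometry, the Minkowski product with it is the time that `k` measures. -/
theorem IsWorldline.exists_isTangent (hM : M.AccRel) (hd : 3 ≤ d) {m b k : B} (hm : m ∈ M.IOb)
    (hk : k ∈ M.IOb) (hb : b ∈ M.Ob) {β : Q → Fin d → Q} (hβ : M.IsWorldline m b β) {t : Q}
    (ht : t ∈ M.life b) (hco : M.CoMoving k b (M.ev b (Pi.single 0 t))) :
    ∃ z, M.IsTangent m k b β t z := by
  obtain ⟨L, a, hiso, hL⟩ := hM.poincare hd hm hk
  obtain ⟨hβt, hs⟩ := hβ.slope hM hd hm hk hb ht hco hL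
  have hsmul : ∀ c : Q, (Pi.single 0 c : Fin d → Q) = c • Pi.single 0 1 := fun c => by
    rw [← Pi.single_smul', smul_eq_mul, mul_one]
  refine ⟨L (Pi.single 0 1), ?_, hs, ?_, ?_⟩
  · rw [hiso, mink_single_zero_right, Pi.single_eq_same, one_mul]
  · intro q hq
    obtain ⟨r, hr⟩ := hM.exists_crd hd hm hk q
    have hkr : k ∈ M.ev k r := by rw [hr.2.1]; exact hq
    have hr0 := hM.eq_single (M.iob_subset_ob hk) hkr
    have hqr : q = L r + a := hM.ev_injective hd hm (by rw [← hL, hr.2.1])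
    refine ⟨r 0 - t, ?_⟩
    rw [hqr, hβt, hr0, hsmul (r 0), hsmul t, map_smul, map_smul, sub_smul]
    simp only [Pi.smul_apply, Pi.single_eq_same, smul_eq_mul, mul_one]
    abel
  · intro p q
    obtain ⟨p', hp'⟩ := hM.exists_crd hd hm hk p
    obtain ⟨q', hq'⟩ := hM.exists_crd hd hm hk q
    have hp : p = L p' + a := hM.ev_injective hd hm (by rw [← hL, hp'.2.1])
    have hq : q = L q' + a := hM.ev_injective hd hm (by rw [← hL, hq'.2.1])
    rw [hp, hq, add_sub_add_right_eq_sub, ← map_sub, hiso, mink_single_zero_right, one_mul,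
      Pi.sub_apply, sub_nonneg, ← hp, ← hq]
    constructor
    · rintro ⟨p'', q'', h1, h2, h3⟩
      obtain rfl := h1.2.2 p' hp'.1 hp'.2.1
      obtain rfl := h2.2.2 q' hq'.1 hq'.2.1
      exact h3
    · intro h
      exact ⟨p', q', hp', hq', h⟩

theorem IsWorldline.exists_tangents (hM : M.AccRel) (hd : 3 ≤ d) {m b : B} (hm : m ∈ M.IOb)
    (hb : b ∈ M.Ob) {β : Q → Fin d → Q} (hβ : M.IsWorldline m b β) :
    ∃ x : Q → Fin d → Q, ∀ t ∈ M.life b, ∃ k ∈ M.IOb, M.CoMoving k b (M.ev b (Pi.single 0 t)) ∧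
      M.IsTangent m k b β t (x t) := by
  have : ∀ t, ∃ z, t ∈ M.life b → ∃ k ∈ M.IOb, M.CoMoving k b (M.ev b (Pi.single 0 t)) ∧
      M.IsTangent m k b β t z := fun t => by
    by_cases ht : t ∈ M.life b
    · obtain ⟨k, hk, hco⟩ := hM.axAcc b hb _ (ev_mem_EvOf ht) ht
      obtain ⟨z, hz⟩ := hβ.exists_isTangent hM hd hm hk hb ht hco
      exact ⟨z, fun _ => ⟨k, hk, hco, hz⟩⟩
    · exact ⟨0, fun h => absurd h ht⟩
  choose x hx using this
  exact ⟨x, hx⟩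

variable {n : Fin d → Q} {σ : Q}

/-- The tangent of a curve in a plane is parallel to the plane. -/
theorem tangent_mem_plane {D : Set Q} {β : Q → Fin d → Q} {t : Q} {z : Fin d → Q}
    (hs : HasSlope β D t z) (hne : (𝓝[D \ {t}] t).NeBot)
    (hβ : ∀ y ∈ D, β y - β t = Pi.single 0 ((β y - β t) 0) - mink (β y - β t) n • n) :
    z = Pi.single 0 (z 0) - mink z n • n := by
  let ρ : (Fin d → Q) →ₗ[Q] (Fin d → Q) :=
    { toFun := fun x => x - (Pi.single 0 (x 0) - mink x n • n)
      map_add' := fun x y => by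
        rw [mink_add_left, Pi.add_apply, Pi.single_add, add_smul]; abel
      map_smul' := fun c x => by
        rw [mink_smul_left, Pi.smul_apply, Pi.single_smul', RingHom.id_apply, smul_sub, smul_sub,
          smul_smul] }
  have h := hs.map ρ (LinearMap.continuous_on_pi ρ)
  have h0 : Tendsto (fun y => (y - t)⁻¹ • (ρ (β y) - ρ (β t))) (𝓝[D \ {t}] t) (𝓝 0) := by
    refine tendsto_const_nhds.congr' ?_
    filter_upwards [self_mem_nhdsWithin] with y hy
    rw [← map_sub]
    have : ρ (β y - β t) = 0 := sub_eq_zero.2 (hβ y hy.1)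
    rw [this, smul_zero]
  exact sub_eq_zero.1 (tendsto_nhds_unique h h0)

/-- The null components of a unit tangent have product at least 1, so neither vanishes. Nonvanishing
derivatives keep their sign, hence positivity at the single instant `t₀` suffices. -/
theorem IsWorldline.nullCurve (hM : M.AccRel) (hd : 3 ≤ d) {m b : B} (hm : m ∈ M.IOb)
    (hb : b ∈ M.Ob) {β : Q → Fin d → Q} (hβ : M.IsWorldline m b β) (hσ : σ * σ = 1)
    (hn0 : n 0 = 0) (hnn : mink n n = -1) {x : Q → Fin d → Q}
    (hx : ∀ t ∈ M.life b, mink (x t) (x t) = 1 ∧ HasSlope β (M.life b) t (x t)) {t₀ : Q}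
    (ht₀ : t₀ ∈ M.life b) (hpos : 0 < nullCoord n σ 1 (x t₀)) :
    M.NullCurve (M.life b) (fun t => nullCoord n σ 1 (β t)) (fun t => nullCoord n σ (-1) (β t))
      (fun t => nullCoord n σ 1 (x t)) (fun t => nullCoord n σ (-1) (x t)) := by
  have hsl : ∀ τ, ∀ t ∈ M.life b,
      HasSlope (fun t => nullCoord n σ τ (β t)) (M.life b) t (nullCoord n σ τ (x t)) :=
    fun τ t ht => (hx t ht).2.map _ (LinearMap.continuous_on_pi _)
  have hprod : ∀ t ∈ M.life b, 0 < nullCoord n σ 1 (x t) * nullCoord n σ (-1) (x t) :=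
    fun t ht => by
      have := mink_le_nullCoord_mul_nullCoord hσ hn0 hnn (x t)
      rw [(hx t ht).1] at this
      exact one_pos.trans_le this
  have hU : ∀ t ∈ M.life b, 0 < nullCoord n σ 1 (x t) := fun t ht =>
    slope_pos_of_pos (f := fun t => nullCoord n σ 1 (β t)) (m := fun t => nullCoord n σ 1 (x t))
      hM.induction (hM.life_ordConnected hb)
      (hβ.defOn hM.toSpecRel hd hm (nullCoord n σ 1)) (hsl 1)
      (fun t ht h => (hprod t ht).ne' (by rw [h, zero_mul])) ht₀ ht hpos
  exact
    { ord := hM.life_ordConnected hb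
      defU := hβ.defOn hM.toSpecRel hd hm _
      defV := hβ.defOn hM.toSpecRel hd hm _
      slopeU := hsl 1
      slopeV := hsl (-1)
      posU := hU
      posV := fun t ht => pos_of_mul_pos_right (hprod t ht) (hU t ht).le }

/-- A world-line in null coordinates, if necessary after time reversal, is future-directed. -/
theorem IsWorldline.exists_nullCurve (hM : M.AccRel) (hd : 3 ≤ d) {m b : B} (hm : m ∈ M.IOb)
    (hb : b ∈ M.Ob) {β : Q → Fin d → Q} (hβ : M.IsWorldline m b β) (hσ : σ * σ = 1)
    (hn0 : n 0 = 0) (hnn : mink n n = -1) {x : Q → Fin d → Q}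
    (hx : ∀ t ∈ M.life b, mink (x t) (x t) = 1 ∧ HasSlope β (M.life b) t (x t)) {t₀ : Q}
    (ht₀ : t₀ ∈ M.life b) :
    ∃ ε : Q, ε * ε = 1 ∧ M.NullCurve {s | ε * s ∈ M.life b}
      (fun s => nullCoord n σ 1 (β (ε * s))) (fun s => nullCoord n σ (-1) (β (ε * s)))
      (fun s => ε * nullCoord n σ 1 (x (ε * s))) (fun s => ε * nullCoord n σ (-1) (x (ε * s))) := by
  have hprod : 0 < nullCoord n σ 1 (x t₀) * nullCoord n σ (-1) (x t₀) := by
    have := mink_le_nullCoord_mul_nullCoord hσ hn0 hnn (x t₀)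
    rw [(hx t₀ ht₀).1] at this
    exact one_pos.trans_le this
  rcases lt_trichotomy 0 (nullCoord n σ 1 (x t₀)) with h | h | h
  · refine ⟨1, one_mul 1, ?_⟩
    have := hβ.nullCurve hM hd hm hb hσ hn0 hnn hx ht₀ h
    simp only [one_mul]
    exact this
  · rw [← h, zero_mul] at hprod
    exact absurd hprod (lt_irrefl _)
  · refine ⟨-1, by ring, ?_⟩
    have hneg : ∀ τ z, nullCoord n (-σ) τ z = -nullCoord n σ τ z := fun τ z => by
      simp only [nullCoord_apply]; ring
    have := (hβ.nullCurve hM hd hm hb (σ := -σ) (by linear_combination hσ) hn0 hnn hx ht₀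
      (by rw [hneg]; linarith)).reverse
    simpa only [hneg, neg_neg, neg_one_mul] using this

theorem PhotonSim.symm {k : B} {e₁ e₂ : Set B} (h : M.PhotonSim k e₁ e₂) :
    M.PhotonSim k e₂ e₁ := by
  obtain ⟨e, he, p₁, hp₁, p₂, hp₂, hk, h₁, h₂, hpr₁, hpr₂⟩ := h
  exact ⟨e, he, p₂, hp₂, p₁, hp₁, hk, h₂, h₁, hpr₂, hpr₁⟩

/-- The elapsed times between events on the world-lines of coplanar observers which are photon
simultaneous for one of them. -/
theorem AccRel.compare_times (hM : M.AccRel) (hd : 3 ≤ d) {b c : B} (hb : b ∈ M.Ob) (hc : c ∈ M.Ob)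
    (hcoplanar : M.Coplanar c b) (hmeet : M.MeetAtMostOnce b c) {eb eb' ec ec' : Set B}
    (heb : eb ∈ M.Ev) (heb' : eb' ∈ M.Ev) (hec : ec ∈ M.Ev) (hec' : ec' ∈ M.Ev)
    (hbe : b ∈ eb ∩ eb') (hce : c ∈ ec ∩ ec') (hph : M.PhotonSim b eb ec)
    (hph' : M.PhotonSim b eb' ec') (hne : ¬(eb = eb' ∧ ec = ec')) :
    ∃ s t : Q, M.HasTime b eb eb' s ∧ M.HasTime c ec ec' t ∧
      (M.Approaching c b → s < t) ∧ (M.MovingAway c b → t < s) := by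
  have hI := hM.induction
  have hS := hM.toSpecRel
  obtain ⟨m, hm, P, hP, hsub⟩ := hcoplanar
  obtain ⟨β, hβ⟩ := hM.exists_isWorldline hm hb
  obtain ⟨γ, hγ⟩ := hM.exists_isWorldline hm hc
  obtain ⟨x, hx⟩ := hβ.exists_tangents hM hd hm hb
  obtain ⟨y, hy⟩ := hγ.exists_tangents hM hd hm hc
  obtain ⟨t₁, ht₁, rfl⟩ := hM.exists_life hb heb hbe.1
  obtain ⟨t₂, ht₂, rfl⟩ := hM.exists_life hb heb' hbe.2
  obtain ⟨s₁, hs₁, rfl⟩ := hM.exists_life hc hec hce.1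
  obtain ⟨s₂, hs₂, rfl⟩ := hM.exists_life hc hec' hce.2
  obtain ⟨n, hn0, hnn, hplane⟩ := exists_unit_of_isVerticalPlane hM.axEOF hP
  have hβP : ∀ t ∈ M.life b, β t ∈ P := fun t ht =>
    hsub (Or.inr (by change b ∈ M.ev m (β t); rw [hβ t ht]; exact ht))
  have hγP : ∀ s ∈ M.life c, γ s ∈ P := fun s hs =>
    hsub (Or.inl (by change c ∈ M.ev m (γ s); rw [hγ s hs]; exact hs))
  have hdir : ∀ p ∈ P, ∀ q ∈ P, p - q = Pi.single 0 ((p - q) 0) - mink (p - q) n • n :=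
    fun p hp q hq => hplane _ (AffineSubspace.vsub_mem_direction hp hq)
  have hx' : ∀ t ∈ M.life b, mink (x t) (x t) = 1 ∧ HasSlope β (M.life b) t (x t) :=
    fun t ht => by
      obtain ⟨k, -, -, h⟩ := hx t ht
      exact ⟨h.unit, h.slope⟩
  have hy' : ∀ s ∈ M.life c, mink (y s) (y s) = 1 ∧ HasSlope γ (M.life c) s (y s) :=
    fun s hs => by
      obtain ⟨k, -, -, h⟩ := hy s hs
      exact ⟨h.unit, h.slope⟩
  -- The sign `σ` orients the plane so that the clock of `b` runs forward. The clock of `c` may run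
  -- against this orientation; below, the sign `ε` corrects its parameter.
  obtain ⟨σ, hσ, hσpos⟩ : ∃ σ : Q, σ * σ = 1 ∧ 0 < nullCoord n σ 1 (x t₁) := by
    have hle := mink_le_nullCoord_mul_nullCoord (σ := 1) (one_mul 1) hn0 hnn (x t₁)
    rw [(hx' t₁ ht₁).1] at hle
    rcases lt_trichotomy 0 (nullCoord n 1 1 (x t₁)) with h | h | h
    · exact ⟨1, one_mul 1, h⟩
    · rw [← h, zero_mul] at hle
      exact absurd one_pos (not_lt.2 hle)
    · refine ⟨-1, by ring, ?_⟩
      simp only [nullCoord_apply] at h ⊢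
      linarith
  have hB := hβ.nullCurve hM hd hm hb hσ hn0 hnn hx' ht₁ hσpos
  obtain ⟨ε, hε, hC⟩ := hγ.exists_nullCurve hM hd hm hc hσ hn0 hnn hy' hs₁
  have hεε : ∀ s, ε * (ε * s) = s := fun s => by rw [← mul_assoc, hε, one_mul]
  set U := nullCoord n σ 1 with hU
  set V := nullCoord n σ (-1) with hV
  have hUV : ∀ p ∈ P, ∀ q ∈ P, mink (p - q) (p - q) = (U p - U q) * (V p - V q) :=
    fun p hp q hq => by
      rw [← map_sub, ← map_sub, nullCoord_mul_nullCoord hσ (hdir p hp q hq)]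
  have hUVx : ∀ p ∈ P, ∀ q ∈ P, ∀ z, 2 * mink (p - q) z =
      (U p - U q) * V z + (V p - V q) * U z := fun p hp q hq z => by
    rw [← map_sub, ← map_sub, mink_eq_nullCoord hσ (hdir p hp q hq)]
  have hinjU := (NullCurve.strictMonoU hI hB).injOn
  have hinjV := (NullCurve.strictMonoV hI hB).injOn
  have hpast : ∀ t ∈ M.life b, ∀ s ∈ M.life c,
      M.PhotonSim b (M.ev b (Pi.single 0 t)) (M.ev c (Pi.single 0 s)) →
      PastNull (U (β t)) (V (β t)) (U (γ s)) (V (γ s)) := by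
    rintro t ht s hs ⟨e, heE, p₁, hp₁, p₂, hp₂, hbe, hpe₁, hpe₂, -, hprec⟩
    obtain ⟨t', ht', rfl⟩ := hM.exists_life hb heE hbe
    rw [← hβ t ht, ← hβ t' ht'] at hpe₁
    rw [← hγ s hs, ← hβ t' ht'] at hpe₂
    have h1 := (hS.photon_iff hm (β t') (β t)).2 ⟨p₁, ⟨hp₁, hpe₁.1⟩, hpe₁.2⟩
    have h2 := (hS.photon_iff hm (β t') (γ s)).2 ⟨p₂, ⟨hp₂, hpe₂.1⟩, hpe₂.2⟩
    rw [hUV _ (hβP t' ht') _ (hβP t ht), mul_eq_zero] at h1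
    -- A photon joins two events of `b`, so they agree in U or in V. Both are strictly increasing
    -- along the world-line, hence the observing event is the event of `b` itself.
    have htt : t' = t := by
      rcases h1 with h | h
      · exact hinjU ht' ht (sub_eq_zero.1 h)
      · exact hinjV ht' ht (sub_eq_zero.1 h)
    subst htt
    rw [hUV _ (hβP t' ht') _ (hγP s hs), mul_eq_zero] at h2
    -- Precedence holds for all co-moving observers, so the one at `t₁` may test it. Its tangent has
    -- positive null components, which gives the sign of the null difference that need not vanish.
    obtain ⟨k, hk, hco, htan⟩ := hx t₁ ht₁
    have h3 := hprec k ⟨hk, _, ev_mem_EvOf ht₁, ht₁, hco⟩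
    rw [← hγ s hs, ← hβ t' ht', htan.time] at h3
    have h4 := hUVx _ (hβP t' ht') _ (hγP s hs) (x t₁)
    have hUx := hB.posU t₁ ht₁
    have hVx := hB.posV t₁ ht₁
    rcases h2 with h | h
    · rw [h, zero_mul, zero_add] at h4
      exact Or.inl ⟨sub_eq_zero.1 h, sub_nonneg.1 (nonneg_of_mul_nonneg_left (by linarith) hUx)⟩
    · rw [h, zero_mul, add_zero] at h4
      exact Or.inr ⟨sub_eq_zero.1 h, sub_nonneg.1 (nonneg_of_mul_nonneg_left (by linarith) hVx)⟩
  have hP₁ := hpast t₁ ht₁ s₁ hs₁ hph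
  have hP₂ := hpast t₂ ht₂ s₂ hs₂ hph'
  rw [← hεε s₁] at hP₁
  rw [← hεε s₂] at hP₂
  have hD₁ : ε * s₁ ∈ {s | ε * s ∈ M.life c} := by rw [mem_ofPred_eq, hεε]; exact hs₁
  have hD₂ : ε * s₂ ∈ {s | ε * s ∈ M.life c} := by rw [mem_ofPred_eq, hεε]; exact hs₂
  have hle₁₂ := NullCurve.le_of_le hI hB hC ht₁ ht₂ hD₁ hD₂ hP₁ hP₂
  have hle₂₁ := NullCurve.le_of_le hI hB hC ht₂ ht₁ hD₂ hD₁ hP₂ hP₁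
  have htne : t₁ ≠ t₂ := by
    rintro rfl
    have : ε * s₁ = ε * s₂ := le_antisymm (hle₁₂.1 le_rfl) (hle₂₁.1 le_rfl)
    have hs : s₁ = s₂ := by rw [← hεε s₁, this, hεε]
    exact hne ⟨rfl, by rw [hs]⟩
  have hsne : s₁ ≠ s₂ := by
    rintro rfl
    exact htne (le_antisymm (hle₁₂.2 le_rfl) (hle₂₁.2 le_rfl))
  -- Two distinct instants in each life leave no instant isolated, so that tangents are unique and
  -- parallel to the plane.
  have hneB : ∀ t ∈ M.life b, (𝓝[M.life b \ {t}] t).NeBot := fun t ht => by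
    by_cases h : t = t₁
    · exact nhdsWithin_sdiff_neBot hB.ord ht ht₂ (h ▸ htne)
    · exact nhdsWithin_sdiff_neBot hB.ord ht ht₁ h
  have hneC : ∀ s ∈ M.life c, (𝓝[M.life c \ {s}] s).NeBot := fun s hs => by
    by_cases h : s = s₁
    · exact nhdsWithin_sdiff_neBot (hM.life_ordConnected hc) hs hs₂ (h ▸ hsne)
    · exact nhdsWithin_sdiff_neBot (hM.life_ordConnected hc) hs hs₁ h
  have hxUV : ∀ t ∈ M.life b, U (x t) * V (x t) = 1 := fun t ht => by
    rw [nullCoord_mul_nullCoord hσ (tangent_mem_plane (hx' t ht).2 (hneB t ht)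
      fun t' ht' => hdir _ (hβP t' ht') _ (hβP t ht)), (hx' t ht).1]
  have hyUV : ∀ s ∈ M.life c, U (y s) * V (y s) = 1 := fun s hs => by
    rw [nullCoord_mul_nullCoord hσ (tangent_mem_plane (hy' s hs).2 (hneC s hs)
      fun s' hs' => hdir _ (hγP s' hs') _ (hγP s hs)), (hy' s hs).1]
  have hphoton : ∀ t ∈ M.life b, ∀ s ∈ M.life c,
      PastNull (U (β t)) (V (β t)) (U (γ s)) (V (γ s)) →
      M.PhotonSim b (M.ev b (Pi.single 0 t)) (M.ev c (Pi.single 0 s)) := by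
    intro t ht s hs h
    have h1 : mink (β t - β t) (β t - β t) = 0 := by rw [sub_self, mink_zero_left]
    have h2 : mink (β t - γ s) (β t - γ s) = 0 := by
      rw [hUV _ (hβP t ht) _ (hγP s hs)]
      rcases h with ⟨h, -⟩ | ⟨h, -⟩ <;> rw [h] <;> ring
    rw [hS.photon_iff hm, hβ t ht] at h1
    rw [hS.photon_iff hm, hβ t ht, hγ s hs] at h2
    obtain ⟨p₁, ⟨hp₁, hpe₁⟩, hpe₁'⟩ := h1
    obtain ⟨p₂, ⟨hp₂, hpe₂⟩, hpe₂'⟩ := h2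
    have hprec : ∀ p ∈ P, U p ≤ U (β t) → V p ≤ V (β t) →
        M.Precedes b (M.ev m p) (M.ev m (β t)) := by
      rintro p hp hpU hpV k ⟨hk, e, heE, hbe, hco⟩
      obtain ⟨t', ht', rfl⟩ := hM.exists_life hb ⟨b, hb, heE⟩ hbe
      obtain ⟨z, hz⟩ := hβ.exists_isTangent hM hd hm hk hb ht' hco
      have := hneB t' ht'
      -- All co-moving inertial observers at one instant share their unit tangent, so the chosen
      -- family `x` represents each of them.
      obtain rfl : z = x t' := tendsto_nhds_unique hz.slope (hx' t' ht').2
      rw [hz.time]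
      have h4 := hUVx _ (hβP t ht) _ hp (x t')
      have e1 := mul_nonneg (sub_nonneg.2 hpU) (hB.posV t' ht').le
      have e2 := mul_nonneg (sub_nonneg.2 hpV) (hB.posU t' ht').le
      linarith
    have hp1 := hprec (β t) (hβP t ht) le_rfl le_rfl
    have hp2 := hprec (γ s) (hγP s hs)
      (by rcases h with ⟨h, -⟩ | ⟨-, h⟩; exacts [h.ge, h])
      (by rcases h with ⟨-, h⟩ | ⟨h, -⟩; exacts [h, h.ge])
    rw [hβ t ht] at hp1
    rw [hγ s hs, hβ t ht] at hp2
    exact ⟨_, ev_mem_Ev hb ht, p₁, hp₁, p₂, hp₂, ht, ⟨hpe₁, hpe₁'⟩, ⟨hpe₂, hpe₂'⟩, hp1, hp2⟩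
  have hmeet' : ∀ t ∈ M.life b, ∀ t' ∈ M.life b, ∀ s ∈ {s | ε * s ∈ M.life c},
      ∀ s' ∈ {s | ε * s ∈ M.life c}, U (β t) = U (γ (ε * s)) → V (β t) = V (γ (ε * s)) →
      U (β t') = U (γ (ε * s')) → V (β t') = V (γ (ε * s')) → t = t' := by
    have hcom : ∀ t ∈ M.life b, ∀ s ∈ M.life c, U (β t) = U (γ s) → V (β t) = V (γ s) →
        c ∈ M.ev b (Pi.single 0 t) := by
      intro t ht s hs h1 h2
      have h3 := eq_zero_of_nullCoord hσ (hdir _ (hβP t ht) _ (hγP s hs))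
        (by rw [map_sub, ← hU, h1, sub_self]) (by rw [map_sub, ← hV, h2, sub_self])
      rw [← hβ t ht, sub_eq_zero.1 h3, hγ s hs]
      exact hs
    intro t ht t' ht' s hs s' hs' h1 h2 h3 h4
    have h5 := hmeet _ (ev_mem_Ev hb ht) _ (ev_mem_Ev hb ht') ht (hcom t ht _ hs h1 h2) ht'
      (hcom t' ht' _ hs' h3 h4)
    rw [← hβ t ht, ← hβ t' ht'] at h5
    exact hinjU ht ht' (congrArg U (hS.ev_injective hd hm h5))
  -- The would-be meeting is the crossing of the two tangent lines. As the tangent is a unit vector,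
  -- `l` is the time from the event of `b` to the crossing for the co-moving observer, and its sign
  -- expresses precedence.
  have hcross : ∀ t ∈ M.life b, ∀ s ∈ M.life c, ∀ e ∈ M.Ev,
      M.WouldMeetAt b c (M.ev b (Pi.single 0 t)) (M.ev c (Pi.single 0 s)) e →
      ∃ l k : Q, β t + l • x t = γ s + k • y s ∧
        (M.Precedes b (M.ev b (Pi.single 0 t)) e → 0 ≤ l) ∧
        (M.Precedes b e (M.ev b (Pi.single 0 t)) → l ≤ 0) := by
    intro t ht s hs e he hwould
    obtain ⟨k, hk, hco, htan⟩ := hx t ht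
    obtain ⟨k', hk', hco', htan'⟩ := hy s hs
    obtain ⟨hke, hke'⟩ := hwould k hk k' hk' hco hco'
    obtain ⟨p, -, rfl⟩ := hM.axEvTr k (M.iob_subset_ob hk) e he hke
    obtain ⟨q, hq⟩ := hS.exists_crd hd hk hm p
    rw [← hq.2.1] at hke hke' ⊢
    obtain ⟨l, hl⟩ := htan.line q hke
    obtain ⟨l', hl'⟩ := htan'.line q hke'
    refine ⟨l, l', hl.symm.trans hl', fun h => ?_, fun h => ?_⟩
    · have := h k ⟨hk, _, ev_mem_EvOf ht, ht, hco⟩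
      rw [← hβ t ht, htan.time, hl, add_sub_cancel_left, mink_smul_left, htan.unit, mul_one] at this
      exact this
    · have := h k ⟨hk, _, ev_mem_EvOf ht, ht, hco⟩
      rw [← hβ t ht, htan.time, hl, sub_add_cancel_left, mink_neg_left, mink_smul_left, htan.unit,
        mul_one] at this
      linarith
  -- In the corrected parameter the tangent of `c` is `ε • y`, so its coefficient at the crossing
  -- becomes `ε * k`.
  have hdop : ∀ t ∈ M.life b, ∀ s ∈ {s | ε * s ∈ M.life c}, ∀ l k : Q,
      β t + l • x t = γ (ε * s) + k • y (ε * s) →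
      (U (β t) = U (γ (ε * s)) → V (γ (ε * s)) < V (β t) →
        (0 ≤ l → ε * U (y (ε * s)) < U (x t)) ∧ (l ≤ 0 → U (x t) < ε * U (y (ε * s)))) ∧
      (V (β t) = V (γ (ε * s)) → U (γ (ε * s)) < U (β t) →
        (0 ≤ l → ε * V (y (ε * s)) < V (x t)) ∧ (l ≤ 0 → V (x t) < ε * V (y (ε * s)))) := by
    intro t ht s hs l k h
    have hhU := congrArg U h
    have hhV := congrArg V h
    simp only [map_add, map_smul, smul_eq_mul] at hhU hhV
    have hyy := hyUV _ hs
    have hxx := hxUV t ht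
    constructor
    · intro h1 h2
      exact doppler (k := ε * k) (Δ := V (β t) - V (γ (ε * s))) (a' := V (x t))
        (g' := ε * V (y (ε * s))) (hB.posU t ht) (hC.posU s hs) hxx
        (by linear_combination (U (y (ε * s)) * V (y (ε * s))) * hε + hyy)
        (by linear_combination hhU - h1 - k * U (y (ε * s)) * hε)
        (by linear_combination hhV - k * V (y (ε * s)) * hε) (sub_pos.2 h2)
    · intro h1 h2
      exact doppler (k := ε * k) (Δ := U (β t) - U (γ (ε * s))) (a' := U (x t))
        (g' := ε * U (y (ε * s))) (hB.posV t ht) (hC.posV s hs) ((mul_comm _ _).trans hxx)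
        (by linear_combination (U (y (ε * s)) * V (y (ε * s))) * hε + hyy)
        (by linear_combination hhV - h1 - k * V (y (ε * s)) * hε)
        (by linear_combination hhU - k * U (y (ε * s)) * hε) (sub_pos.2 h2)
  have habs : |s₁ - s₂| = |ε * s₁ - ε * s₂| := by
    rw [← mul_sub, abs_mul]
    have : |ε| = 1 := by
      rcases mul_self_eq_one_iff.1 hε with h | h <;> simp [h]
    rw [this, one_mul]
  refine ⟨|t₁ - t₂|, |s₁ - s₂|,
    ⟨_, _, hM.isCrd_single hb ht₁, hM.isCrd_single hb ht₂, by simp [timeOf]⟩,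
    ⟨_, _, hM.isCrd_single hc hs₁, hM.isCrd_single hc hs₂, by simp [timeOf]⟩, ?_, ?_⟩
  · intro happ
    have hl : ∀ t ∈ M.life b, ∀ s ∈ {s | ε * s ∈ M.life c},
        PastNull (U (β t)) (V (β t)) (U (γ (ε * s))) (V (γ (ε * s))) →
        ∃ l k : Q, β t + l • x t = γ (ε * s) + k • y (ε * s) ∧ 0 ≤ l := by
      intro t ht s hs h
      obtain ⟨e, he, hw, hprec⟩ := (happ _ (ev_mem_Ev hb ht) ht).2 _ (ev_mem_Ev hc hs) hs
        (hphoton t ht _ hs h)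
      obtain ⟨l, k, h1, h2, -⟩ := hcross t ht _ hs e he hw
      exact ⟨l, k, h1, h2 hprec⟩
    have hmain : ∀ {t₁ t₂ s₁ s₂ : Q}, t₁ ∈ M.life b → t₂ ∈ M.life b →
        s₁ ∈ {s | ε * s ∈ M.life c} → s₂ ∈ {s | ε * s ∈ M.life c} → _ → _ → t₁ < t₂ →
        t₂ - t₁ < s₂ - s₁ := NullCurve.sub_lt_sub hI hB hC hmeet'
      (fun t ht s hs h1 h2 => by
        obtain ⟨l, k, h3, h4⟩ := hl t ht s hs (Or.inl ⟨h1, h2.le⟩)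
        exact ((hdop t ht s hs l k h3).1 h1 h2).1 h4)
      (fun t ht s hs h1 h2 => by
        obtain ⟨l, k, h3, h4⟩ := hl t ht s hs (Or.inr ⟨h1, h2.le⟩)
        exact ((hdop t ht s hs l k h3).2 h1 h2).1 h4)
    rw [habs]
    rcases htne.lt_or_gt with h | h
    · rw [abs_sub_comm, abs_sub_comm (ε * s₁), abs_of_pos (sub_pos.2 h)]
      exact (hmain ht₁ ht₂ hD₁ hD₂ hP₁ hP₂ h).trans_le (le_abs_self _)
    · rw [abs_of_pos (sub_pos.2 h)]
      exact (hmain ht₂ ht₁ hD₂ hD₁ hP₂ hP₁ h).trans_le (le_abs_self _)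
  · intro hmov
    have hl : ∀ t ∈ M.life b, ∀ s ∈ {s | ε * s ∈ M.life c},
        PastNull (U (β t)) (V (β t)) (U (γ (ε * s))) (V (γ (ε * s))) →
        ∃ l k : Q, β t + l • x t = γ (ε * s) + k • y (ε * s) ∧ l ≤ 0 := by
      intro t ht s hs h
      obtain ⟨e, he, hw, hprec⟩ := (hmov _ (ev_mem_Ev hb ht) ht).2 _ (ev_mem_Ev hc hs) hs
        (hphoton t ht _ hs h)
      obtain ⟨l, k, h1, -, h2⟩ := hcross t ht _ hs e he hw
      exact ⟨l, k, h1, h2 hprec⟩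
    have hmain : ∀ {t₁ t₂ s₁ s₂ : Q}, t₁ ∈ M.life b → t₂ ∈ M.life b →
        s₁ ∈ {s | ε * s ∈ M.life c} → s₂ ∈ {s | ε * s ∈ M.life c} → _ → _ → t₁ < t₂ →
        s₂ - s₁ < t₂ - t₁ := NullCurve.sub_lt_sub' hI hB hC hmeet'
      (fun t ht s hs h1 h2 => by
        obtain ⟨l, k, h3, h4⟩ := hl t ht s hs (Or.inl ⟨h1, h2.le⟩)
        exact ((hdop t ht s hs l k h3).1 h1 h2).2 h4)
      (fun t ht s hs h1 h2 => by
        obtain ⟨l, k, h3, h4⟩ := hl t ht s hs (Or.inr ⟨h1, h2.le⟩)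
        exact ((hdop t ht s hs l k h3).2 h1 h2).2 h4)
    rw [habs]
    rcases htne.lt_or_gt with h | h
    · have h' := NullCurve.lt_of_lt hI hB hC ht₁ ht₂ hD₁ hD₂ hP₁ hP₂ h
      rw [abs_sub_comm (ε * s₁), abs_of_pos (sub_pos.2 h'), abs_sub_comm]
      exact (hmain ht₁ ht₂ hD₁ hD₂ hP₁ hP₂ h).trans_le (le_abs_self _)
    · have h' := NullCurve.lt_of_lt hI hB hC ht₂ ht₁ hD₂ hD₁ hP₂ hP₁ h
      rw [abs_of_pos (sub_pos.2 h')]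
      exact (hmain ht₂ ht₁ hD₂ hD₁ hP₂ hP₁ h).trans_le (le_abs_self _)

end Model

end AccRelTheory

theorem mainTheorem3 {d : ℕ} [NeZero d] (hd : 3 ≤ d) {B Q : Type*}
    [Field Q] [LinearOrder Q] [IsStrictOrderedRing Q]
    (M : AccRelTheory.Model d B Q) (hM : M.AccRel)
    (b c : B) (hb : b ∈ M.Ob) (hc : c ∈ M.Ob)
    (hcoplanar : M.Coplanar c b) (hmeet : M.MeetAtMostOnce b c) :
    (M.Approaching c b → M.RunsSlower b b c) ∧
      (M.MovingAway c b → M.RunsSlower b c b) := by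
  -- The order topology supplies the limits used for derivatives.
  let _ : TopologicalSpace Q := Preorder.topology Q
  have : OrderTopology Q := ⟨rfl⟩
  constructor
  · intro h eb heb eb' heb' ec hec ec' hec' hbe hce hph hph' hne
    obtain ⟨s, t, hs, ht, hlt, -⟩ := hM.compare_times hd hb hc hcoplanar hmeet heb heb' hec hec'
      hbe hce hph hph' hne
    exact ⟨s, t, hs, ht, hlt h⟩
  · intro h ec hec ec' hec' eb heb eb' heb' hce hbe hph hph' hne
    obtain ⟨s, t, hs, ht, -, hlt⟩ := hM.compare_times hd hb hc hcoplanar hmeet heb heb' hec hec'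
      hbe hce hph.symm hph'.symm fun h => hne h.symm
    exact ⟨t, s, ht, hs, hlt h⟩
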